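/- Let $d\in\{2,3\}$ and $M>0$. Let $G_2(x)=-\frac1{2\pi}\log|x|$ and $G_3(x)=\frac1{4\pi|x|}$. Let $\phi\in C^1(\mathbb R^d)$ have a globally Lipschitz gradient (so that $\Delta\phi\in L^\infty(\mathbb R^d)$) and satisfy assumption (C): * $\displaystyle\liminf_{|x|\to\infty}\frac{\phi(x)}{\log|x|}>d$, and if $d=2$ also $\displaystyle\liminf_{|x|\to\infty}\frac{\phi(x)}{\log|x|}>4+\frac M{2\pi}$; * $\displaystyle\lim_{r\to\infty}\operatorname*{ess\,inf}_{|x|\ge r}\Big(\tfrac14|\nabla\phi|^2-\tfrac12\Delta\phi\Big)>0$ and $\displaystyle\lim_{r\to\infty}\operatorname*{ess\,inf}_{|x|\ge r}|\nabla\phi|>0$. Let $n_0\in L^1(\mathbb R^d)$ with $n_0\ge0$ and $\int n_0\,dx=M$, and let $n$ be a solution of $$\partial_t n=\Delta n+\nabla\cdot(n\nabla c)+\nabla\cdot(n\nabla\phi),\qquad c=G_d*n,\qquad n(0,\cdot)=n_0 .$$ Here a solution is a nonnegative $n\in C([0,\infty);L^1(\mathbb R^d))\cap L^2_{\rm loc}((0,\infty);H^1(\mathbb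 R^d))$ with $n(0,\cdot)=n_0$ such that, for a.e. $t>0$, the convolution integral $c(t,x)=\int G_d(x-y)\,n(t,y)\,dy$ converges absolutely for a.e. $x$ and $c(t,\cdot)$ has a locally integrable weak gradient, such that $n\nabla c$ is integrable on $(a,b)\times B_R$ for all $0<a<b$ and $R>0$, and such that for all $0<s<t$ and all $\psi\in C_c^\infty(\mathbb R^d)$ $$\int n(t,x)\,\psi(x)\,dx-\int n(s,x)\,\psi(x)\,dx=-\int_s^t\!\!\int\big(\nabla n+n\nabla c+n\nabla\phi\big)\cdot\nabla\psi\,dx\,d\tau .$$ Then there exist a constant $C>0$ and a time $T>0$ such that $$\|n(t,\cdot)\|_{L^p(\mathbb R^d)}\le C\qquad\text{for all }t\ge T\text{ and all }p\in(1,\infty].$$ -/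

import Mathlib

open MeasureTheory Filter Topology Set
open scoped ENNReal NNReal ContDiff Gradient

noncomputable section

namespace NernstPlanck

/-- The Green function of `-Δ` on `ℝ^d` for `d = 2` and `d = 3`:
`G₂(x) = -(1/2π) log |x|` and `G₃(x) = 1/(4π|x|)`. -/
def green (d : ℕ) (x : EuclideanSpace ℝ (Fin d)) : ℝ :=
  if d = 2 then -(1 / (2 * Real.pi)) * Real.log ‖x‖ else 1 / (4 * Real.pi * ‖x‖)

/-- The potential `c = G_d * ρ` generated by a density `ρ`. -/
def potential (d : ℕ) (ρ : EuclideanSpace ℝ (Fin d) → ℝ) (x : EuclideanSpace ℝ (Fin d)) : ℝ :=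
  ∫ y, green d (x - y) * ρ y

/-- `v` is the weak (distributional) gradient of `u` on `ℝ^d`. -/
def IsWeakGradient {d : ℕ} (u : EuclideanSpace ℝ (Fin d) → ℝ)
    (v : EuclideanSpace ℝ (Fin d) → EuclideanSpace ℝ (Fin d)) : Prop :=
  LocallyIntegrable u ∧ LocallyIntegrable v ∧
    ∀ ψ : EuclideanSpace ℝ (Fin d) → ℝ, ContDiff ℝ ∞ ψ → HasCompactSupport ψ →
      ∫ x, u x • ∇ ψ x = -∫ x, ψ x • v x

/-- Assumption (C) on the confinement potential `φ`, for the dimension `d` and the mass `M`.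
The regularity assumption says that the weak derivatives of order two of `φ` are bounded: such a
`φ` has a (unique) `C¹` representative with Lipschitz gradient, and `φ` is this representative.
Its Laplacian exists in the classical sense almost everywhere and is the distributional one. -/
structure ConfinementC (d : ℕ) (M : ℝ) (φ : EuclideanSpace ℝ (Fin d) → ℝ) : Prop where
  contDiff : ContDiff ℝ 1 φ
  lipschitz_gradient : ∃ K : ℝ≥0, LipschitzWith K (∇ φ)
  growth : ((d : ℝ) : EReal) <
    liminf (fun x => ((φ x / Real.log ‖x‖ : ℝ) : EReal))
      (Bornology.cobounded (EuclideanSpace ℝ (Fin d)))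
  persson : ∃ σ : EReal, 0 < σ ∧
    Tendsto (fun r : ℝ =>
      essInf (fun x => ((1 / 4 * ‖∇ φ x‖ ^ 2 - 1 / 2 * Laplacian.laplacian φ x : ℝ) : EReal))
        (volume.restrict (Metric.ball (0 : EuclideanSpace ℝ (Fin d)) r)ᶜ)) atTop (𝓝 σ)
  gradient_lower : ∃ l : EReal, 0 < l ∧
    Tendsto (fun r : ℝ =>
      essInf (fun x => ((‖∇ φ x‖ : ℝ) : EReal))
        (volume.restrict (Metric.ball (0 : EuclideanSpace ℝ (Fin d)) r)ᶜ)) atTop (𝓝 l)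
  growth_two : d = 2 → ((4 + M / (2 * Real.pi) : ℝ) : EReal) <
    liminf (fun x => ((φ x / Real.log ‖x‖ : ℝ) : EReal))
      (Bornology.cobounded (EuclideanSpace ℝ (Fin d)))

/-- `n` is a (weak) solution of the confined Poisson-Nernst-Planck system
`∂ₜ n = Δ n + ∇·(n ∇c) + ∇·(n ∇φ)`, `c = G_d * n`, `n(0,·) = n₀ ≥ 0`, `∫ n₀ = M`:
`n` is nonnegative, belongs to `C([0,∞); L¹) ∩ L²_loc((0,∞); H¹)`, the convolution `G_d * n(t,·)`
converges, and the equation holds in the sense of distributions. -/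
structure IsSolution (d : ℕ) (M : ℝ) (φ n₀ : EuclideanSpace ℝ (Fin d) → ℝ)
    (n : ℝ → EuclideanSpace ℝ (Fin d) → ℝ) : Prop where
  initial_nonneg : 0 ≤ᵐ[volume] n₀
  initial_integrable : Integrable n₀
  initial_mass : ∫ x, n₀ x = M
  initial : n 0 =ᵐ[volume] n₀
  nonneg : ∀ t, 0 ≤ t → 0 ≤ᵐ[volume] n t
  integrable : ∀ t, 0 ≤ t → Integrable (n t)
  continuous_L1 : ∀ t, 0 ≤ t →
    Tendsto (fun s => eLpNorm (n s - n t) 1 volume) (𝓝[Ici 0] t) (𝓝 0)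
  /-- The integral defining `c(t, x)` converges. -/
  potential_converges : ∀ᵐ t ∂(volume.restrict (Ioi (0 : ℝ))),
    ∀ᵐ x : EuclideanSpace ℝ (Fin d), Integrable (fun y => green d (x - y) * n t y)
  /-- Here `g = ∇n` and `h = ∇c`, in the weak sense. -/
  equation : ∃ g h : ℝ → EuclideanSpace ℝ (Fin d) → EuclideanSpace ℝ (Fin d),
    (∀ᵐ t ∂(volume.restrict (Ioi (0 : ℝ))), IsWeakGradient (n t) (g t)) ∧
    (∀ᵐ t ∂(volume.restrict (Ioi (0 : ℝ))), IsWeakGradient (potential d (n t)) (h t)) ∧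
    (∀ a b : ℝ, 0 < a → a < b →
      MemLp (Function.uncurry n) 2 ((volume.restrict (Ioc a b)).prod volume) ∧
      MemLp (Function.uncurry g) 2 ((volume.restrict (Ioc a b)).prod volume) ∧
      ∀ R : ℝ, IntegrableOn (fun z : ℝ × EuclideanSpace ℝ (Fin d) => n z.1 z.2 • h z.1 z.2)
        (Ioc a b ×ˢ Metric.ball 0 R) (volume.prod volume)) ∧
    ∀ ψ : EuclideanSpace ℝ (Fin d) → ℝ, ContDiff ℝ ∞ ψ → HasCompactSupport ψ →
      ∀ s t : ℝ, 0 < s → s < t →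
        (∫ x, n t x * ψ x) - ∫ x, n s x * ψ x =
          -∫ τ in s..t, ∫ x,
            inner ℝ (g τ x + n τ x • h τ x + n τ x • ∇ φ x) (∇ ψ x)

end NernstPlanck

end

/-!
The bound is a comparison with a solution of an ordinary differential equation. Since
`Δc = -n`, the equation reads, in non-divergence form,
`∂ₜ n = Δ n + (∇c + ∇φ) · ∇n + n (Δφ - n)`,
and `m = Δφ` is bounded because `∇φ` is Lipschitz. If `L ≥ max m 1` then `L + 1 / t` is a supersolution
which is infinite at `t = 0`, so that `n(t) ≤ L + 1 / t` for every initial datum. The mass does not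
increase, and both bounds together control all the `L^p` norms for `t ≥ 1`, with the constant
`max (L + 1) M` (`eLpNorm_le_of_le`).

The comparison is proved for weak solutions by showing that the entropy `∫ θ(n(t) - L - 1 / t)`
does not increase in time (`IsDriftSolution.integral_hinge_le`), where `θ` is the smooth convex
function `hinge`, an approximation of the positive part. This rests on the following facts.

* The weak gradient of the potential is the field `∇G * n` (`IsWeakGradient.ae_eq_field`), whose
  distributional divergence is `-n` (`integral_inner_field_gradient`). The field is the sum of a
  bounded part and of a part in `L²`, so that `n ∇c` is integrable.
* The equation is renormalized: `∂ₜ θ(n - y) ≤ Δ θ(n - y) + θ'(n - y) (F - y')` in weak form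
  (`IsLocalSolution.integral_comp_sub_le`). The solution is mollified in space; the mollified
  solution is absolutely continuous in time at each point, so that the chain rule applies, and
  convexity of `θ` permits dropping the term `-θ''(n - y) ‖∇n‖²`.
* The convective terms are integrated by parts with the product rule
  `integral_comp_mul_inner_gradient`; what remains has a sign where `n > L + 1 / t`
  (`deriv_hinge_mul_reaction_le`).
* Cutoff functions localize the computation. The drift grows at most linearly and the gradient of
  the cutoff at scale `R` is of size `1 / R`, so that the fluxes through the transition region are
  dominated by the tail of one integrable function, `energy`. Where `θ'` does not vanish,
  `1 ≤ n`, hence `‖∇n‖ ≤ n ‖∇n‖` is integrable although `∇n` is only in `L²`.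
-/

noncomputable section

namespace NernstPlanck

/-! ### Mollification -/

/-- Euclidean space of dimension `d`. -/
abbrev Space (d : ℕ) := EuclideanSpace ℝ (Fin d)

/-- A bump function on `ℝ^d` with support the closed ball of radius `1 / (k + 1)`. -/
def bump (d k : ℕ) : ContDiffBump (0 : Space d) where
  rIn := 1 / (2 * ((k : ℝ) + 1))
  rOut := 1 / ((k : ℝ) + 1)
  rIn_pos := by positivity
  rIn_lt_rOut := by
    apply one_div_lt_one_div_of_lt (by positivity)
    have : (0 : ℝ) ≤ k := k.cast_nonneg
    linarith

/-- The standard mollifier of `ℝ^d`, of integral one, at scale `1 / (k + 1)`. -/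
def mollifier (d k : ℕ) : Space d → ℝ := (bump d k).normed volume

/-- Translations act continuously on `L^p`. -/
theorem tendsto_eLpNorm_translate {d : ℕ} {F : Type*} [NormedAddCommGroup F]
    {p : ℝ≥0∞} (hp : 1 ≤ p) (hp' : p ≠ ⊤)
    {f : Space d → F} (hf : MemLp f p) :
    Tendsto (fun h : Space d => eLpNorm (fun x => f (x - h) - f x) p volume) (𝓝 0) (𝓝 0) := by
  have := Fact.mk hp
  let T : Space d → C(Space d, Space d) := fun h => ⟨fun x => x - h, by fun_prop⟩
  have hT : Continuous T := ContinuousMap.continuous_of_continuous_uncurry _ (by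
    simp only [T, Function.uncurry_def]; exact continuous_snd.sub continuous_fst)
  have hm : ∀ h, MeasurePreserving (T h) (volume : Measure (Space d)) volume := fun h =>
    measurePreserving_sub_right volume h
  have key := Filter.Tendsto.compMeasurePreservingLp (μ := (volume : Measure (Space d))) (ν := volume)
    (f := fun _ : Space d => hf.toLp f) (g := T) (l := 𝓝 0)
    tendsto_const_nhds (hT.tendsto 0) hm (hm 0) hp'
  rw [Lp.tendsto_Lp_iff_tendsto_eLpNorm'] at key
  refine key.congr fun h => eLpNorm_congr_ae ?_
  have h0 := fun h => Lp.coeFn_compMeasurePreserving (hf.toLp f) (hm h)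
  have h1 := fun h => (hm h).quasiMeasurePreserving.ae_eq_comp hf.coeFn_toLp
  filter_upwards [h0 h, h0 0, h1 h, h1 0] with x a b c e
  simp only [Pi.sub_apply, a, b]
  rw [c, e]
  simp [T]

section Mollify

variable {d : ℕ} {F : Type*} [NormedAddCommGroup F] [NormedSpace ℝ F]

/-- The convolution of `f` with the mollifier at scale `1 / (k + 1)`. -/
def mollify (k : ℕ) (f : Space d → F) : Space d → F :=
  convolution (mollifier d k) f (ContinuousLinearMap.lsmul ℝ ℝ) volume

theorem mollifier_nonneg (k : ℕ) (x : Space d) : 0 ≤ mollifier d k x :=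
  (bump d k).nonneg_normed x

theorem contDiff_mollifier (k : ℕ) : ContDiff ℝ ∞ (mollifier d k) :=
  (bump d k).contDiff_normed

theorem hasCompactSupport_mollifier (k : ℕ) : HasCompactSupport (mollifier d k) :=
  (bump d k).hasCompactSupport_normed

theorem continuous_mollifier (k : ℕ) : Continuous (mollifier d k) :=
  (contDiff_mollifier k).continuous

theorem integrable_mollifier (k : ℕ) : Integrable (mollifier d k) :=
  (bump d k).integrable_normed

theorem integral_mollifier (k : ℕ) : ∫ x, mollifier d k x = 1 :=
  (bump d k).integral_normed

theorem mollifier_eq_zero {k : ℕ} {x : Space d} (hx : 1 / ((k : ℝ) + 1) ≤ ‖x‖) :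
    mollifier d k x = 0 := by
  have : x ∉ Function.support (mollifier d k) := by
    rw [mollifier, ContDiffBump.support_normed_eq]
    simpa [bump] using hx
  simpa using this

theorem mollify_apply (k : ℕ) (f : Space d → F) (x : Space d) :
    mollify k f x = ∫ y, mollifier d k y • f (x - y) := rfl

theorem mollify_apply_swap (k : ℕ) (f : Space d → F) (x : Space d) :
    mollify k f x = ∫ y, mollifier d k (x - y) • f y := by
  rw [mollify, convolution_eq_swap]
  rfl

theorem contDiff_mollify [CompleteSpace F] (k : ℕ) {f : Space d → F} (hf : LocallyIntegrable f) :
    ContDiff ℝ ∞ (mollify k f) :=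
  (hasCompactSupport_mollifier k).contDiff_convolution_left _ (contDiff_mollifier k) hf

theorem tendsto_radius : Tendsto (fun k : ℕ => 1 / ((k : ℝ) + 1)) atTop (𝓝 0) :=
  tendsto_one_div_add_atTop_nhds_zero_nat

theorem ae_tendsto_mollify [CompleteSpace F] {f : Space d → F} (hf : LocallyIntegrable f) :
    ∀ᵐ x, Tendsto (fun k => mollify k f x) atTop (𝓝 (f x)) := by
  refine ContDiffBump.ae_convolution_tendsto_right_of_locallyIntegrable (K := 2)
    (φ := fun k => bump d k) tendsto_radius (Eventually.of_forall fun k => ?_) hf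
  have : (0 : ℝ) < k + 1 := by positivity
  simp only [bump]
  apply le_of_eq
  field_simp

/-- The mollification error is an average of the errors of small translations. The proof applies
Jensen's inequality to the probability measure with density `mollifier d k`. -/
theorem eLpNorm_mollify_sub_le {p : ℝ≥0∞} (hp : 1 ≤ p) (hp' : p ≠ ⊤) {f : Space d → F}
    [CompleteSpace F]
    (hf : MemLp f p) (k : ℕ) {ε : ℝ≥0∞}
    (h : ∀ y : Space d, ‖y‖ < 1 / ((k : ℝ) + 1) →
      eLpNorm (fun x => f (x - y) - f x) p volume ≤ ε) :
    eLpNorm (mollify k f - f) p volume ≤ ε := by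
  set ν : Measure (Space d) := volume.withDensity fun y => ENNReal.ofReal (mollifier d k y) with hν
  have hρm : Measurable fun y : Space d => ENNReal.ofReal (mollifier d k y) :=
    (continuous_mollifier k).measurable.ennreal_ofReal
  have hν1 : IsProbabilityMeasure ν := by
    refine ⟨?_⟩
    rw [hν, withDensity_apply _ MeasurableSet.univ, Measure.restrict_univ,
      ← ofReal_integral_eq_lintegral_ofReal (integrable_mollifier k)
        (Eventually.of_forall (mollifier_nonneg k)), integral_mollifier, ENNReal.ofReal_one]
  have hac : ν ≪ volume := withDensity_absolutelyContinuous _ _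
  have p0 : p ≠ 0 := (zero_lt_one.trans_le hp).ne'
  have q0 : 0 < p.toReal := ENNReal.toReal_pos p0 hp'
  have hloc : LocallyIntegrable f := hf.locallyIntegrable hp
  have hmeas : AEStronglyMeasurable (fun z : Space d × Space d => f (z.1 - z.2) - f z.1)
      (volume.prod ν) := by
    have h1 : AEStronglyMeasurable (fun z : Space d × Space d => f (z.1 - z.2) - f z.1)
        (volume.prod volume) :=
      (hf.1.comp_quasiMeasurePreserving
        (quasiMeasurePreserving_sub_of_right_invariant volume volume)).sub
        (hf.1.comp_quasiMeasurePreserving Measure.quasiMeasurePreserving_fst)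
    exact h1.mono_ac (Measure.AbsolutelyContinuous.rfl.prod hac)
  have hpt : ∀ᵐ x, ‖mollify k f x - f x‖ₑ ^ p.toReal ≤ ∫⁻ y, ‖f (x - y) - f x‖ₑ ^ p.toReal ∂ν := by
    have hsec := hmeas.prodMk_left
    filter_upwards [hsec] with x hx
    have h1 : mollify k f x - f x = ∫ y, mollifier d k y • (f (x - y) - f x) := by
      have i1 : Integrable fun y => mollifier d k y • f (x - y) :=
        (hasCompactSupport_mollifier k).convolutionExists_left
          (ContinuousLinearMap.lsmul ℝ ℝ) (continuous_mollifier k) hloc x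
      have i2 : Integrable fun y => mollifier d k y • f x := (integrable_mollifier k).smul_const _
      simp_rw [smul_sub]
      rw [integral_sub i1 i2, integral_smul_const, integral_mollifier, one_smul, mollify_apply]
    have h2 : ‖mollify k f x - f x‖ₑ ≤ eLpNorm (fun y => f (x - y) - f x) 1 ν := by
      rw [h1, eLpNorm_one_eq_lintegral_enorm, hν, lintegral_withDensity_eq_lintegral_mul₀' hρm.aemeasurable]
      · refine (enorm_integral_le_lintegral_enorm _).trans (le_of_eq ?_)
        refine lintegral_congr fun y => ?_
        rw [enorm_smul, Pi.mul_apply, Real.enorm_eq_ofReal (mollifier_nonneg k y)]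
      · exact hx.enorm
    have h3 := h2.trans (eLpNorm_le_eLpNorm_of_exponent_le hp hx)
    rw [eLpNorm_eq_lintegral_rpow_enorm_toReal p0 hp'] at h3
    calc _ ≤ _ := ENNReal.rpow_le_rpow h3 q0.le
      _ = _ := by rw [← ENNReal.rpow_mul, one_div, inv_mul_cancel₀ q0.ne', ENNReal.rpow_one]
  have hfin : ∫⁻ x, ‖mollify k f x - f x‖ₑ ^ p.toReal ≤ ε ^ p.toReal := by
    refine (lintegral_mono_ae hpt).trans ?_
    rw [lintegral_lintegral_swap (hmeas.enorm.pow_const _)]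
    have : ∀ᵐ y ∂ν, ∫⁻ x, ‖f (x - y) - f x‖ₑ ^ p.toReal ≤ ε ^ p.toReal := by
      rw [hν, ae_withDensity_iff hρm]
      refine Eventually.of_forall fun y hy => ?_
      have hy' : ‖y‖ < 1 / ((k : ℝ) + 1) := by
        by_contra hc
        exact hy (by rw [mollifier_eq_zero (not_lt.1 hc), ENNReal.ofReal_zero])
      have h4 := h y hy'
      rw [eLpNorm_eq_lintegral_rpow_enorm_toReal p0 hp'] at h4
      calc _ = ((∫⁻ x, ‖f (x - y) - f x‖ₑ ^ p.toReal) ^ (1 / p.toReal)) ^ p.toReal := by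
            rw [← ENNReal.rpow_mul, one_div, inv_mul_cancel₀ q0.ne', ENNReal.rpow_one]
        _ ≤ _ := ENNReal.rpow_le_rpow h4 q0.le
    refine (lintegral_mono_ae this).trans ?_
    simp
  rw [eLpNorm_eq_lintegral_rpow_enorm_toReal p0 hp']
  calc _ ≤ (ε ^ p.toReal) ^ (1 / p.toReal) := ENNReal.rpow_le_rpow hfin (by positivity)
    _ = ε := by rw [← ENNReal.rpow_mul, one_div, mul_inv_cancel₀ q0.ne', ENNReal.rpow_one]

theorem tendsto_eLpNorm_mollify_sub [CompleteSpace F] {p : ℝ≥0∞} (hp : 1 ≤ p) (hp' : p ≠ ⊤)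
    {f : Space d → F} (hf : MemLp f p) :
    Tendsto (fun k => eLpNorm (mollify k f - f) p volume) atTop (𝓝 0) := by
  rw [ENNReal.tendsto_nhds_zero]
  intro ε hε
  have h1 := ENNReal.tendsto_nhds_zero.1 (tendsto_eLpNorm_translate hp hp' hf) ε hε
  obtain ⟨δ, hδ, h2⟩ := Metric.eventually_nhds_iff.1 h1
  filter_upwards [tendsto_radius.eventually_lt_const hδ] with k hk
  exact eLpNorm_mollify_sub_le hp hp' hf k fun y hy => h2 (by simpa using hy.trans hk)

end Mollify

/-! ### Convolutions depending on a parameter -/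

section Param

variable {d : ℕ} {X : Type*} [MeasurableSpace X] {μ : Measure X} [SFinite μ]
  {F G H : Type*} [NormedAddCommGroup F] [NormedSpace ℝ F] [NormedAddCommGroup G]
  [NormedSpace ℝ G] [NormedAddCommGroup H] [NormedSpace ℝ H]

/-- The shear that turns a product of a function of `(τ, x)` and a function of `y` into the integrand
of a convolution in space, `τ` being a parameter. -/
theorem measurePreserving_shear :
    MeasurePreserving (fun z : (X × Space d) × Space d => ((z.1.1, z.2), z.1.2 - z.2))
      ((μ.prod volume).prod volume) ((μ.prod volume).prod volume) := by
  have h1 : MeasurePreserving (fun z : (X × Space d) × Space d => ((z.1.1, z.2), z.1.2))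
      ((μ.prod volume).prod volume) ((μ.prod volume).prod volume) := by
    have a := measurePreserving_prodAssoc μ (volume : Measure (Space d)) (volume : Measure (Space d))
    have b := (MeasurePreserving.id μ).prod
      (Measure.measurePreserving_swap (μ := (volume : Measure (Space d)))
        (ν := (volume : Measure (Space d))))
    exact (a.symm _).comp (b.comp a)
  have h2 : MeasurePreserving (fun z : (X × Space d) × Space d => (z.1, z.2 - z.1.2))
      ((μ.prod volume).prod volume) ((μ.prod volume).prod volume) :=
    (MeasurePreserving.id (μ.prod volume)).skew_product
      (g := fun (a : X × Space d) (b : Space d) => b - a.2)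
      (measurable_snd.sub (measurable_snd.comp measurable_fst))
      (Eventually.of_forall fun a => (measurePreserving_sub_right volume a.2).map_eq)
  exact h2.comp h1

/-- The integrand of a convolution in space which depends on a parameter is jointly integrable. -/
theorem integrable_convolution_param (B : G →L[ℝ] F →L[ℝ] H) {w : X × Space d → F}
    (hw : Integrable w (μ.prod volume)) {κ : Space d → G} (hκ : Integrable κ) :
    Integrable (fun z : (X × Space d) × Space d => B (κ (z.1.2 - z.2)) (w (z.1.1, z.2)))
      ((μ.prod volume).prod volume) := by
  have h : Integrable (fun z : (X × Space d) × Space d => B (κ z.2) (w z.1))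
      ((μ.prod volume).prod volume) := by
    refine ((hw.norm.mul_prod hκ.norm).const_mul ‖B‖).mono'
      (B.aestronglyMeasurable_comp₂
        (hκ.1.comp_quasiMeasurePreserving Measure.quasiMeasurePreserving_snd)
        (hw.1.comp_quasiMeasurePreserving Measure.quasiMeasurePreserving_fst))
      (Eventually.of_forall fun z => ?_)
    refine (B.le_opNorm₂ _ _).trans (le_of_eq ?_)
    ring
  exact measurePreserving_shear.integrable_comp_of_integrable h

end Param

/-! ### Gradients and integration by parts -/

section Gradient

variable {d : ℕ}

theorem continuous_gradient {ψ : Space d → ℝ} (hψ : ContDiff ℝ 1 ψ) : Continuous (∇ ψ) :=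
  (InnerProductSpace.toDual ℝ (Space d)).symm.continuous.comp (hψ.continuous_fderiv one_ne_zero)

theorem contDiff_gradient {ψ : Space d → ℝ} (hψ : ContDiff ℝ ∞ ψ) : ContDiff ℝ ∞ (∇ ψ) :=
  (InnerProductSpace.toDual ℝ (Space d)).symm.toContinuousLinearEquiv.contDiff.comp
    (hψ.fderiv_right (m := ∞) (by simp))

theorem gradient_eq_zero_of_notMem_tsupport {ψ : Space d → ℝ} {x : Space d}
    (hx : x ∉ tsupport ψ) : ∇ ψ x = 0 := by
  have : fderiv ℝ ψ x = 0 := by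
    by_contra h
    exact hx (support_fderiv_subset ℝ h)
  simp [gradient, this]

theorem tsupport_gradient_subset (ψ : Space d → ℝ) : tsupport (∇ ψ) ⊆ tsupport ψ := by
  refine closure_minimal (fun x hx => ?_) (isClosed_tsupport ψ)
  by_contra h
  exact hx (gradient_eq_zero_of_notMem_tsupport h)

theorem hasCompactSupport_gradient {ψ : Space d → ℝ} (hψ : HasCompactSupport ψ) :
    HasCompactSupport (∇ ψ) :=
  hψ.mono' (subset_trans subset_closure (tsupport_gradient_subset ψ))

theorem gradient_mul {u v : Space d → ℝ} {x : Space d} (hu : DifferentiableAt ℝ u x)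
    (hv : DifferentiableAt ℝ v x) :
    ∇ (fun y => u y * v y) x = u x • ∇ v x + v x • ∇ u x := by
  refine ext_inner_right ℝ fun w => ?_
  rw [inner_gradient_left, inner_add_left, inner_smul_left, inner_smul_left,
    inner_gradient_left, inner_gradient_left, fderiv_fun_mul hu hv]
  simp

theorem gradient_comp {u : Space d → ℝ} {θ : ℝ → ℝ} {θ' : ℝ} {x : Space d}
    (hθ : HasDerivAt θ θ' (u x)) (hu : DifferentiableAt ℝ u x) :
    ∇ (fun y => θ (u y)) x = θ' • ∇ u x := by
  refine ext_inner_right ℝ fun w => ?_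
  have := (hθ.comp_hasFDerivAt x hu.hasFDerivAt).fderiv
  rw [inner_gradient_left, inner_smul_left, inner_gradient_left]
  change fderiv ℝ (θ ∘ u) x w = _
  rw [this]
  simp

theorem gradient_comp_sub_right (ψ : Space d → ℝ) (a x : Space d) :
    ∇ (fun y => ψ (y - a)) x = ∇ ψ (x - a) := by
  simp only [gradient, sub_eq_add_neg, fderiv_comp_add_right]

theorem _root_.MeasureTheory.LocallyIntegrable.integrable_inner {b v : Space d → Space d}
    (hb : LocallyIntegrable b) (hv : Continuous v) (hc : HasCompactSupport v) :
    Integrable fun x => inner ℝ (b x) (v x) := by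
  have hb' : LocallyIntegrable fun x => ‖b x‖ := fun x => (hb x).norm
  have h := hb'.integrable_smul_right_of_hasCompactSupport hv.norm hc.norm
  refine h.mono' (hb.aestronglyMeasurable.inner hv.aestronglyMeasurable)
    (Eventually.of_forall fun x => ?_)
  simpa [mul_comm] using norm_inner_le_norm (𝕜 := ℝ) (b x) (v x)

/-- Integration by parts against a compactly supported function. -/
theorem integral_smul_gradient_eq_neg {u ψ : Space d → ℝ} (hu : ContDiff ℝ 1 u)
    (hψ : ContDiff ℝ 1 ψ) (hc : HasCompactSupport ψ) :
    ∫ x, u x • ∇ ψ x = -∫ x, ψ x • ∇ u x := by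
  have i1 : Integrable fun x => u x • ∇ ψ x :=
    (hu.continuous.smul (continuous_gradient hψ)).integrable_of_hasCompactSupport
      ((hasCompactSupport_gradient hc).smul_left)
  have i2 : Integrable fun x => ψ x • ∇ u x :=
    (hψ.continuous.smul (continuous_gradient hu)).integrable_of_hasCompactSupport hc.smul_right
  have i3 : Integrable fun x => u x * ψ x :=
    (hu.continuous.mul hψ.continuous).integrable_of_hasCompactSupport hc.mul_left
  refine ext_inner_left ℝ fun v => ?_
  rw [inner_neg_right, ← integral_inner (𝕜 := ℝ) i1, ← integral_inner (𝕜 := ℝ) i2]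
  have e1 : ∀ x, inner ℝ v (u x • ∇ ψ x) = u x * fderiv ℝ ψ x v := fun x => by
    rw [inner_smul_right, inner_gradient_right]; simp
  have e2 : ∀ x, inner ℝ v (ψ x • ∇ u x) = fderiv ℝ u x v * ψ x := fun x => by
    rw [inner_smul_right, inner_gradient_right, mul_comm]; simp
  simp_rw [e1, e2]
  refine integral_mul_fderiv_eq_neg_fderiv_mul_of_integrable ?_ ?_ i3
    (fun x _ => hu.differentiable one_ne_zero x) (fun x _ => hψ.differentiable one_ne_zero x)
  · simpa only [e2] using i2.const_inner (𝕜 := ℝ) v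
  · simpa only [e1] using i1.const_inner (𝕜 := ℝ) v

end Gradient

/-! ### The kernel `∇G` and the fundamental solution -/

/-- The constant of the field of a point charge: `1/2π` in the plane, `1/4π` in space. -/
def kernelConst (d : ℕ) : ℝ := if d = 2 then 1 / (2 * Real.pi) else 1 / (4 * Real.pi)

/-- The gradient of the Green function, `-c_d x / |x|^d`, with value zero at the origin. -/
def kernel (d : ℕ) (x : Space d) : Space d := -((kernelConst d / ‖x‖ ^ d) • x)

section Kernel

variable {d : ℕ}

theorem kernelConst_pos (d : ℕ) : 0 < kernelConst d := by
  unfold kernelConst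
  split_ifs <;> positivity

theorem measurable_kernel (d : ℕ) : Measurable (kernel d) := by
  unfold kernel
  fun_prop

theorem norm_kernel_le (x : Space d) :
    ‖kernel d x‖ ≤ kernelConst d * ‖x‖ ^ (-((d : ℝ) - 1)) := by
  have hc := kernelConst_pos d
  rcases eq_or_ne x 0 with rfl | hx
  · simp only [kernel, smul_zero, neg_zero, norm_zero]
    positivity
  · have hx' : 0 < ‖x‖ := norm_pos_iff.2 hx
    rw [kernel, norm_neg, norm_smul, norm_div, Real.norm_of_nonneg hc.le, norm_pow, norm_norm,
      Real.rpow_neg hx'.le, Real.rpow_sub hx', Real.rpow_one, Real.rpow_natCast]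
    apply le_of_eq
    field_simp

theorem norm_kernel_le_of_one_le (hd : 2 ≤ d) {x : Space d} (hx : 1 ≤ ‖x‖) :
    ‖kernel d x‖ ≤ kernelConst d := by
  refine (norm_kernel_le x).trans ?_
  have hd' : (2 : ℝ) ≤ d := by exact_mod_cast hd
  have := Real.rpow_le_one_of_one_le_of_nonpos hx (z := -((d : ℝ) - 1)) (by linarith)
  nlinarith [kernelConst_pos d]

theorem locallyIntegrable_kernel (hd : 2 ≤ d) : LocallyIntegrable (kernel d) := by
  refine locallyIntegrable_of_norm_le_rpow (C := kernelConst d) (α := (d : ℝ) - 1) ?_ ?_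
    (Eventually.of_forall norm_kernel_le) (measurable_kernel d).aestronglyMeasurable
  · simp; omega
  · simp

theorem locallyIntegrable_norm_inv (hd : 2 ≤ d) :
    LocallyIntegrable fun x : Space d => ‖x‖⁻¹ := by
  refine locallyIntegrable_of_norm_le_rpow (C := 1) (α := 1) ?_ ?_
    (Eventually.of_forall fun x => ?_) (by fun_prop)
  · simp; omega
  · simp; omega
  · rw [Real.rpow_neg_one]; simp

/-- Integration in polar coordinates. -/
theorem integral_polar (hd : 2 ≤ d) {f : Space d → ℝ} (hf : Integrable f) :
    ∫ x, f x = ∫ ξ : Metric.sphere (0 : Space d) 1, (∫ r in Ioi (0 : ℝ), r ^ (d - 1) * f (r • ξ.1))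
      ∂(volume : Measure (Space d)).toSphere := by
  have : Nontrivial (Space d) := by
    have : Nonempty (Fin d) := ⟨⟨0, by omega⟩⟩
    infer_instance
  have hfr : Module.finrank ℝ (Space d) = d := by simp
  set μ : Measure (Space d) := volume
  let Φ := homeomorphUnitSphereProd (Space d)
  have hmp : MeasurePreserving Φ (μ.comap (↑)) (μ.toSphere.prod (.volumeIoiPow (d - 1))) := by
    have := μ.measurePreserving_homeomorphUnitSphereProd
    rwa [hfr] at this
  have hint : Integrable (fun p : Metric.sphere (0 : Space d) 1 × Ioi (0 : ℝ) =>
      f (p.2.1 • p.1.1)) (μ.toSphere.prod (.volumeIoiPow (d - 1))) := by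
    rw [← hmp.integrable_comp_emb Φ.measurableEmbedding]
    have h1 : Integrable (fun x : ({(0)}ᶜ : Set (Space d)) => f x.1) (μ.comap (↑)) := by
      change Integrable (f ∘ Subtype.val) _
      rw [← integrableOn_iff_comap_subtypeVal (by measurability)]
      exact hf.integrableOn
    refine h1.congr (Eventually.of_forall fun x => ?_)
    have := Φ.symm_apply_apply x
    simp only [Function.comp]
    congr 1
    conv_lhs => rw [← this]
    rfl
  calc ∫ x, f x = ∫ x : ({(0)}ᶜ : Set (Space d)), f x.1 ∂(μ.comap (↑)) := by
        rw [integral_subtype_comap (measurableSet_singleton _).compl f, restrict_compl_singleton]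
    _ = ∫ p, f (p.2.1 • p.1.1) ∂(μ.toSphere.prod (.volumeIoiPow (d - 1))) := by
        rw [← hmp.integral_comp Φ.measurableEmbedding]
        refine integral_congr_ae (Eventually.of_forall fun x => ?_)
        have := Φ.symm_apply_apply x
        change f x.1 = f _
        congr 1
        conv_lhs => rw [← this]
        rfl
    _ = ∫ ξ, (∫ r : Ioi (0 : ℝ), f (r.1 • ξ.1) ∂.volumeIoiPow (d - 1)) ∂μ.toSphere :=
        integral_prod _ hint
    _ = _ := by
        refine integral_congr_ae (Eventually.of_forall fun ξ => ?_)
        simp only [Measure.volumeIoiPow, ENNReal.ofReal]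
        rw [integral_withDensity_eq_integral_smul,
          integral_subtype_comap measurableSet_Ioi
            fun a ↦ Real.toNNReal (a ^ (d - 1)) • f (a • ξ.1),
          setIntegral_congr_fun measurableSet_Ioi fun x hx ↦ ?_]
        · rw [NNReal.smul_def, Real.coe_toNNReal _ (pow_nonneg hx.out.le _), smul_eq_mul]
        · exact (measurable_subtype_coe.pow_const _).real_toNNReal

/-- The field of a unit charge has unit flux through the unit sphere. -/
theorem kernelConst_mul_sphere (hd : d = 2 ∨ d = 3) :
    (volume : Measure (Space d)).toSphere.real univ * kernelConst d = 1 := by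
  rw [Measure.toSphere_real_apply_univ]
  have := Real.pi_pos
  rcases hd with rfl | rfl
  · simp [Measure.real, kernelConst]
    rw [ENNReal.toReal_ofReal (by positivity)]
    field_simp
  · simp [Measure.real, kernelConst]
    rw [ENNReal.toReal_ofReal (by positivity)]
    field_simp

/-- The Green function is the fundamental solution: `-div ∇G = δ₀`. -/
theorem integral_inner_kernel_gradient (hd : d = 2 ∨ d = 3) {ψ : Space d → ℝ}
    (hψ : ContDiff ℝ 1 ψ) (hc : HasCompactSupport ψ) :
    ∫ x, inner ℝ (kernel d x) (∇ ψ x) = ψ 0 := by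
  have hd2 : 2 ≤ d := by omega
  have hint : Integrable fun x => inner ℝ (kernel d x) (∇ ψ x) :=
    (locallyIntegrable_kernel hd2).integrable_inner (continuous_gradient hψ)
      (hasCompactSupport_gradient hc)
  rw [integral_polar hd2 hint]
  -- On a ray the weight `r ^ (d - 1)` cancels the decay of the kernel, and the integrand is a
  -- multiple of the radial derivative of `ψ`.
  have key : ∀ ξ : Metric.sphere (0 : Space d) 1,
      ∫ r in Ioi (0 : ℝ), r ^ (d - 1) * inner ℝ (kernel d (r • ξ.1)) (∇ ψ (r • ξ.1))
        = kernelConst d * ψ 0 := by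
    intro ξ
    have hξ : ‖ξ.1‖ = 1 := by simp
    have hder : ∀ r : ℝ, HasDerivAt (fun s : ℝ => ψ (s • ξ.1)) (fderiv ℝ ψ (r • ξ.1) ξ.1) r := by
      intro r
      have h1 : HasDerivAt (fun s : ℝ => s • ξ.1) ξ.1 r := by
        simpa using (hasDerivAt_id r).smul_const ξ.1
      exact ((hψ.differentiable one_ne_zero _).hasFDerivAt).comp_hasDerivAt r h1
    have e : ∀ r ∈ Ioi (0 : ℝ), r ^ (d - 1) * inner ℝ (kernel d (r • ξ.1)) (∇ ψ (r • ξ.1))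
        = -kernelConst d * deriv (fun s : ℝ => ψ (s • ξ.1)) r := by
      intro r hr
      have hr0 : (0 : ℝ) < r := hr
      rw [(hder r).deriv, kernel, inner_neg_left, inner_smul_left, inner_smul_left,
        inner_gradient_right, norm_smul, hξ]
      obtain ⟨m, rfl⟩ : ∃ m, d = m + 1 := ⟨d - 1, by omega⟩
      simp only [Nat.add_sub_cancel, Real.norm_of_nonneg hr0.le]
      simp
      field_simp
      ring
    rw [setIntegral_congr_fun measurableSet_Ioi e, integral_const_mul]
    have hcs : HasCompactSupport fun s : ℝ => ψ (s • ξ.1) := by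
      refine hc.comp_isClosedEmbedding ?_
      exact isClosedEmbedding_smul_left (by intro h; simp [h] at hξ)
    rw [hcs.integral_Ioi_deriv_eq]
    · simp
    · exact hψ.comp (contDiff_id.smul contDiff_const)
  simp_rw [key]
  rw [integral_const, smul_eq_mul, ← mul_assoc, kernelConst_mul_sphere hd, one_mul]

end Kernel

section Regularize

variable {d : ℕ}

/-- Integration by parts for a limit of dominated smooth functions. -/
theorem integral_smul_gradient_eq_neg_of_tendsto {G Γ Λ : Space d → ℝ} {k : Space d → Space d}
    {u : ℕ → Space d → ℝ} (hu : ∀ j, ContDiff ℝ 1 (u j)) (hΓ : LocallyIntegrable Γ)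
    (hΛ : LocallyIntegrable Λ) (huΓ : ∀ j, ∀ x ≠ 0, |u j x| ≤ Γ x)
    (huΛ : ∀ j, ∀ x ≠ 0, ‖∇ (u j) x‖ ≤ Λ x)
    (hG : ∀ x ≠ 0, Tendsto (fun j => u j x) atTop (𝓝 (G x)))
    (hk : ∀ x ≠ 0, Tendsto (fun j => ∇ (u j) x) atTop (𝓝 (k x)))
    (hd : 2 ≤ d)
    {ψ : Space d → ℝ} (hψ : ContDiff ℝ 1 ψ) (hc : HasCompactSupport ψ) :
    ∫ x, G x • ∇ ψ x = -∫ x, ψ x • k x := by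
  have : Nonempty (Fin d) := ⟨⟨0, by omega⟩⟩
  have hne : ∀ᵐ x : Space d, x ≠ 0 := Measure.ae_ne _ _
  have hψ' := continuous_gradient hψ
  have l1 : Tendsto (fun j => ∫ x, u j x • ∇ ψ x) atTop (𝓝 (∫ x, G x • ∇ ψ x)) := by
    refine tendsto_integral_of_dominated_convergence (fun x => Γ x • ‖∇ ψ x‖)
      (fun j => ((hu j).continuous.smul hψ').aestronglyMeasurable)
      (hΓ.integrable_smul_right_of_hasCompactSupport hψ'.norm (hasCompactSupport_gradient hc).norm)
      (fun j => ?_) ?_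
    · filter_upwards [hne] with x hx
      rw [norm_smul, smul_eq_mul]
      exact mul_le_mul_of_nonneg_right (huΓ j x hx) (norm_nonneg _)
    · filter_upwards [hne] with x hx
      exact (hG x hx).smul_const _
  have l2 : Tendsto (fun j => ∫ x, ψ x • ∇ (u j) x) atTop (𝓝 (∫ x, ψ x • k x)) := by
    refine tendsto_integral_of_dominated_convergence (fun x => ‖ψ x‖ • Λ x)
      (fun j => (hψ.continuous.smul (continuous_gradient (hu j))).aestronglyMeasurable)
      (hΛ.integrable_smul_left_of_hasCompactSupport hψ.continuous.norm hc.norm)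
      (fun j => ?_) ?_
    · filter_upwards [hne] with x hx
      rw [norm_smul, smul_eq_mul]
      exact mul_le_mul_of_nonneg_left (huΛ j x hx) (norm_nonneg _)
    · filter_upwards [hne] with x hx
      exact (hk x hx).const_smul _
  refine tendsto_nhds_unique l1 ?_
  simp_rw [fun j => integral_smul_gradient_eq_neg (hu j) hψ hc]
  exact l2.neg

theorem abs_log_le {r : ℝ} (hr : 0 < r) : |Real.log r| ≤ r + r⁻¹ := by
  have h1 := Real.log_le_sub_one_of_pos hr
  have h2 := Real.log_le_sub_one_of_pos (inv_pos.2 hr)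
  rw [Real.log_inv] at h2
  have := inv_pos.2 hr
  rw [abs_le]
  constructor <;> linarith

theorem gradient_norm_sq_add (ε : ℝ) (x : Space d) :
    ∇ (fun y : Space d => ‖y‖ ^ 2 + ε) x = (2 : ℝ) • x := by
  refine ext_inner_right ℝ fun w => ?_
  rw [inner_gradient_left, inner_smul_left, fderiv_add_const, fderiv_norm_sq]
  simp

theorem contDiff_norm_sq_add (ε : ℝ) : ContDiff ℝ 1 (fun y : Space d => ‖y‖ ^ 2 + ε) :=
  (contDiff_norm_sq ℝ).add contDiff_const

theorem tendsto_norm_sq_add (x : Space d) :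
    Tendsto (fun j : ℕ => ‖x‖ ^ 2 + 1 / ((j : ℝ) + 1)) atTop (𝓝 (‖x‖ ^ 2)) := by
  simpa using tendsto_radius.const_add (‖x‖ ^ 2)

/-- The weak gradient of the Green function is `kernel d`. The Green function is approximated by
the smooth functions obtained on replacing `‖x‖` by the square root of `‖x‖ ^ 2 + 1 / (j + 1)`. -/
theorem integral_green_smul_gradient (hd : d = 2 ∨ d = 3) {ψ : Space d → ℝ}
    (hψ : ContDiff ℝ 1 ψ) (hc : HasCompactSupport ψ) :
    ∫ x, green d x • ∇ ψ x = -∫ x, ψ x • kernel d x := by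
  have hd2 : 2 ≤ d := by omega
  have hpi := Real.pi_pos
  have hloc := locallyIntegrable_norm_inv hd2
  have hpos : ∀ (j : ℕ) (x : Space d), 0 < ‖x‖ ^ 2 + 1 / ((j : ℝ) + 1) := fun j x => by positivity
  have hΛ : LocallyIntegrable fun x : Space d => ‖kernel d x‖ :=
    fun x => (locallyIntegrable_kernel hd2 x).norm
  have hΓ : LocallyIntegrable fun x : Space d => (‖x‖ ^ 2 + 2 * ‖x‖) + (‖x‖⁻¹ + ‖x‖⁻¹) :=
    (Continuous.locallyIntegrable (by fun_prop)).add (hloc.add hloc)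
  rcases hd with rfl | rfl
  · have hder : ∀ (j : ℕ) (x : Space 2), HasDerivAt (fun s => -(1 / (4 * Real.pi)) * Real.log s)
        (-(1 / (4 * Real.pi)) * (‖x‖ ^ 2 + 1 / ((j : ℝ) + 1))⁻¹) (‖x‖ ^ 2 + 1 / ((j : ℝ) + 1)) :=
      fun j x => (Real.hasDerivAt_log (hpos j x).ne').const_mul _
    have hgr : ∀ (j : ℕ) (x : Space 2),
        ∇ (fun y : Space 2 => -(1 / (4 * Real.pi)) * Real.log (‖y‖ ^ 2 + 1 / ((j : ℝ) + 1))) x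
          = -((kernelConst 2 / (‖x‖ ^ 2 + 1 / ((j : ℝ) + 1))) • x) := by
      intro j x
      rw [gradient_comp (u := fun y : Space 2 => ‖y‖ ^ 2 + 1 / ((j : ℝ) + 1)) (hder j x)
        ((contDiff_norm_sq_add _).differentiable one_ne_zero x), gradient_norm_sq_add, smul_smul,
        ← neg_smul]
      congr 1
      have := (hpos j x).ne'
      simp only [kernelConst, if_true]
      field_simp
      norm_num
    refine integral_smul_gradient_eq_neg_of_tendsto
      (u := fun j y => -(1 / (4 * Real.pi)) * Real.log (‖y‖ ^ 2 + 1 / ((j : ℝ) + 1)))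
      (fun j => ?_) hΓ hΛ (fun j x hx => ?_) (fun j x hx => ?_) (fun x hx => ?_) (fun x hx => ?_)
      hd2 hψ hc
    · exact contDiff_const.mul ((contDiff_norm_sq_add _).log fun x => (hpos j x).ne')
    · have hx' : 0 < ‖x‖ := norm_pos_iff.2 hx
      have hj : 1 / ((j : ℝ) + 1) ≤ 1 := by
        rw [div_le_one (by positivity)]
        have : (0 : ℝ) ≤ j := j.cast_nonneg
        linarith
      have hj0 : 0 < 1 / ((j : ℝ) + 1) := by positivity
      have h1 : |Real.log (‖x‖ ^ 2 + 1 / ((j : ℝ) + 1))| ≤ ‖x‖ ^ 2 + 2 * (‖x‖ + ‖x‖⁻¹) := by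
        have h2 := Real.log_le_sub_one_of_pos (hpos j x)
        have h3 : Real.log (‖x‖ ^ 2) ≤ Real.log (‖x‖ ^ 2 + 1 / ((j : ℝ) + 1)) :=
          Real.log_le_log (by positivity) (by linarith)
        rw [Real.log_pow] at h3
        have h4 := abs_le.1 (abs_log_le hx')
        have := inv_pos.2 hx'
        rw [abs_le]
        push_cast at h3
        constructor
        · nlinarith
        · linarith
      rw [abs_mul, abs_neg, abs_of_pos (by positivity)]
      have h5 : 1 / (4 * Real.pi) ≤ 1 := by
        rw [div_le_one (by positivity)]; linarith [Real.pi_gt_three]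
      refine (mul_le_of_le_one_left (abs_nonneg _) h5).trans (h1.trans (le_of_eq ?_))
      ring
    · have hx' : 0 < ‖x‖ := norm_pos_iff.2 hx
      rw [hgr, kernel, norm_neg, norm_neg, norm_smul, norm_smul,
        Real.norm_of_nonneg (div_nonneg (kernelConst_pos 2).le (hpos j x).le),
        Real.norm_of_nonneg (div_nonneg (kernelConst_pos 2).le (by positivity))]
      refine mul_le_mul_of_nonneg_right ?_ hx'.le
      refine div_le_div_of_nonneg_left (kernelConst_pos 2).le (by positivity) ?_
      have hj0 : 0 < 1 / ((j : ℝ) + 1) := by positivity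
      linarith
    · have hx' : 0 < ‖x‖ := norm_pos_iff.2 hx
      have := ((tendsto_norm_sq_add x).log (by positivity)).const_mul (-(1 / (4 * Real.pi)))
      convert this using 2
      simp only [green, if_true]
      rw [Real.log_pow]
      push_cast
      field_simp
      ring
    · have hx' : 0 < ‖x‖ := norm_pos_iff.2 hx
      simp_rw [hgr]
      exact (((tendsto_const_nhds (x := kernelConst 2)).div (tendsto_norm_sq_add x)
        (by positivity)).smul_const x).neg
  · have hder : ∀ (j : ℕ) (x : Space 3), HasDerivAt (fun s => 1 / (4 * Real.pi) * (√s)⁻¹)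
        (1 / (4 * Real.pi) * (-(1 / (2 * √(‖x‖ ^ 2 + 1 / ((j : ℝ) + 1)))) /
          √(‖x‖ ^ 2 + 1 / ((j : ℝ) + 1)) ^ 2)) (‖x‖ ^ 2 + 1 / ((j : ℝ) + 1)) :=
      fun j x => ((Real.hasDerivAt_sqrt (hpos j x).ne').fun_inv
        (Real.sqrt_pos.2 (hpos j x)).ne').const_mul _
    have hsq : ∀ (j : ℕ) (x : Space 3), ‖x‖ ≤ √(‖x‖ ^ 2 + 1 / ((j : ℝ) + 1)) := fun j x => by
      apply Real.le_sqrt_of_sq_le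
      have hj0 : 0 < 1 / ((j : ℝ) + 1) := by positivity
      linarith
    have hgr : ∀ (j : ℕ) (x : Space 3),
        ∇ (fun y : Space 3 => 1 / (4 * Real.pi) * (√(‖y‖ ^ 2 + 1 / ((j : ℝ) + 1)))⁻¹) x
          = -((kernelConst 3 / √(‖x‖ ^ 2 + 1 / ((j : ℝ) + 1)) ^ 3) • x) := by
      intro j x
      rw [gradient_comp (u := fun y : Space 3 => ‖y‖ ^ 2 + 1 / ((j : ℝ) + 1)) (hder j x)
        ((contDiff_norm_sq_add _).differentiable one_ne_zero x), gradient_norm_sq_add, smul_smul,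
        ← neg_smul]
      congr 1
      have := (Real.sqrt_pos.2 (hpos j x)).ne'
      simp only [kernelConst]
      rw [if_neg (by norm_num)]
      field_simp
    have hsqt : ∀ x : Space 3,
        Tendsto (fun j : ℕ => √(‖x‖ ^ 2 + 1 / ((j : ℝ) + 1))) atTop (𝓝 ‖x‖) := fun x => by
      have := (Real.continuous_sqrt.tendsto _).comp (tendsto_norm_sq_add x)
      rwa [Real.sqrt_sq (norm_nonneg x)] at this
    refine integral_smul_gradient_eq_neg_of_tendsto
      (u := fun j y => 1 / (4 * Real.pi) * (√(‖y‖ ^ 2 + 1 / ((j : ℝ) + 1)))⁻¹)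
      (fun j => ?_) hΓ hΛ (fun j x hx => ?_) (fun j x hx => ?_) (fun x hx => ?_) (fun x hx => ?_)
      hd2 hψ hc
    · exact contDiff_const.mul (((contDiff_norm_sq_add _).sqrt fun x => (hpos j x).ne').inv
        fun x => (Real.sqrt_pos.2 (hpos j x)).ne')
    · have hx' : 0 < ‖x‖ := norm_pos_iff.2 hx
      have h0 := Real.sqrt_pos.2 (hpos j x)
      rw [abs_of_pos (by positivity)]
      have h5 : 1 / (4 * Real.pi) ≤ 1 := by
        rw [div_le_one (by positivity)]; linarith [Real.pi_gt_three]
      have h6 := inv_anti₀ hx' (hsq j x)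
      have := inv_pos.2 hx'
      refine (mul_le_of_le_one_left (by positivity) h5).trans ?_
      nlinarith
    · have hx' : 0 < ‖x‖ := norm_pos_iff.2 hx
      rw [hgr, kernel, norm_neg, norm_neg, norm_smul, norm_smul,
        Real.norm_of_nonneg (div_nonneg (kernelConst_pos 3).le (by positivity)),
        Real.norm_of_nonneg (div_nonneg (kernelConst_pos 3).le (by positivity))]
      refine mul_le_mul_of_nonneg_right ?_ hx'.le
      refine div_le_div_of_nonneg_left (kernelConst_pos 3).le (by positivity) ?_
      exact pow_le_pow_left₀ hx'.le (hsq j x) 3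
    · have hx' : 0 < ‖x‖ := norm_pos_iff.2 hx
      have := ((hsqt x).inv₀ hx'.ne').const_mul (1 / (4 * Real.pi))
      convert this using 2
      simp only [green]
      rw [if_neg (by norm_num)]
      field_simp
    · have hx' : 0 < ‖x‖ := norm_pos_iff.2 hx
      simp_rw [hgr]
      exact (((tendsto_const_nhds (x := kernelConst 3)).div ((hsqt x).pow 3)
        (by positivity)).smul_const x).neg

/-- Translates of the identity `∇G = kernel d`. -/
theorem integral_green_sub_smul_gradient (hd : d = 2 ∨ d = 3) {ψ : Space d → ℝ}
    (hψ : ContDiff ℝ 1 ψ) (hc : HasCompactSupport ψ) (y : Space d) :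
    ∫ x, green d (x - y) • ∇ ψ x = -∫ x, ψ x • kernel d (x - y) := by
  have h := integral_green_smul_gradient hd (ψ := fun x => ψ (x - -y))
    (hψ.comp (contDiff_id.sub contDiff_const))
    (hc.comp_homeomorph (Homeomorph.subRight (-y)))
  simp_rw [gradient_comp_sub_right] at h
  rw [← integral_sub_right_eq_self _ y, ← integral_sub_right_eq_self (fun x => _ • kernel d x) y] at h
  simpa using h

/-- Translates of the identity `-div (kernel d) = δ₀`. -/
theorem integral_inner_kernel_sub_gradient (hd : d = 2 ∨ d = 3) {ψ : Space d → ℝ}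
    (hψ : ContDiff ℝ 1 ψ) (hc : HasCompactSupport ψ) (y : Space d) :
    ∫ x, inner ℝ (kernel d (x - y)) (∇ ψ x) = ψ y := by
  have h := integral_inner_kernel_gradient hd (ψ := fun x => ψ (x - -y))
    (hψ.comp (contDiff_id.sub contDiff_const))
    (hc.comp_homeomorph (Homeomorph.subRight (-y)))
  simp_rw [gradient_comp_sub_right] at h
  rw [← integral_sub_right_eq_self _ y] at h
  simpa using h

end Regularize

/-! ### The field `∇c` generated by a density -/

section Field

variable {d : ℕ}

/-- The field `∇G * ρ` generated by a density `ρ`. -/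
def field (d : ℕ) (ρ : Space d → ℝ) (x : Space d) : Space d := ∫ y, ρ y • kernel d (x - y)

/-- The modulus of `kernel d`, cut off outside of the unit ball; it is integrable. -/
def nearKernel (d : ℕ) : Space d → ℝ := (Metric.ball 0 1).indicator fun x => ‖kernel d x‖

/-- The convolution of `|ρ|` with `nearKernel d`; it dominates the field up to a constant. -/
def nearField (d : ℕ) (ρ : Space d → ℝ) (x : Space d) : ℝ := ∫ y, nearKernel d (x - y) * |ρ y|

theorem nearKernel_nonneg (x : Space d) : 0 ≤ nearKernel d x :=
  indicator_nonneg (fun _ _ => norm_nonneg _) x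

theorem integrable_nearKernel (hd : 2 ≤ d) : Integrable (nearKernel d) := by
  rw [nearKernel, integrable_indicator_iff Metric.isOpen_ball.measurableSet]
  exact (((locallyIntegrable_kernel hd).integrableOn_isCompact
    (isCompact_closedBall 0 1)).mono_set Metric.ball_subset_closedBall).norm

theorem norm_kernel_le_nearKernel_add (hd : 2 ≤ d) (x : Space d) :
    ‖kernel d x‖ ≤ nearKernel d x + kernelConst d := by
  by_cases hx : x ∈ Metric.ball (0 : Space d) 1
  · rw [nearKernel, indicator_of_mem hx]
    linarith [kernelConst_pos d]
  · have : 1 ≤ ‖x‖ := by simpa using hx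
    linarith [norm_kernel_le_of_one_le hd this, nearKernel_nonneg x]

theorem nearField_nonneg (ρ : Space d → ℝ) (x : Space d) : 0 ≤ nearField d ρ x :=
  integral_nonneg fun _ => mul_nonneg (nearKernel_nonneg _) (abs_nonneg _)

/-- The far part of the kernel is bounded, and so contributes at most a multiple of the mass. -/
theorem norm_field_le (hd : 2 ≤ d) {ρ : Space d → ℝ} (hρ : Integrable ρ) {x : Space d}
    (hx : Integrable fun y => nearKernel d (x - y) * |ρ y|) :
    ‖field d ρ x‖ ≤ nearField d ρ x + kernelConst d * ∫ y, |ρ y| := by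
  rw [field, nearField, ← integral_const_mul, ← integral_add hx (hρ.abs.const_mul _)]
  refine (norm_integral_le_integral_norm _).trans
    (integral_mono_of_nonneg (Eventually.of_forall fun _ => norm_nonneg _)
      (hx.add (hρ.abs.const_mul _)) (Eventually.of_forall fun y => ?_))
  simp only [norm_smul, Real.norm_eq_abs]
  nlinarith [norm_kernel_le_nearKernel_add hd (x - y), abs_nonneg (ρ y)]

/-- The Cauchy-Schwarz inequality for `nearField`. -/
theorem nearField_sq_le {ρ : Space d → ℝ} {x : Space d} (hd : 2 ≤ d)
    (h1 : Integrable fun y => nearKernel d (x - y) * |ρ y|)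
    (h2 : Integrable fun y => nearKernel d (x - y) * ρ y ^ 2) :
    nearField d ρ x ^ 2 ≤
      (∫ y, nearKernel d y) * ∫ y, nearKernel d (x - y) * ρ y ^ 2 := by
  have h0 : Integrable fun y => nearKernel d (x - y) := (integrable_nearKernel hd).comp_sub_left x
  have e0 : ∫ y, nearKernel d (x - y) = ∫ y, nearKernel d y :=
    integral_sub_left_eq_self (nearKernel d) volume x
  -- The quadratic polynomial `t ↦ ∫ κ (|ρ| - t)²` is nonnegative, so its discriminant is not
  -- positive.
  have key : ∀ t : ℝ, 0 ≤ (∫ y, nearKernel d y) * (t * t) + (-2 * nearField d ρ x) * t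
      + ∫ y, nearKernel d (x - y) * ρ y ^ 2 := by
    intro t
    have e : ∫ y, nearKernel d (x - y) * (|ρ y| - t) ^ 2 =
        (∫ y, nearKernel d y) * (t * t) + (-2 * nearField d ρ x) * t
          + ∫ y, nearKernel d (x - y) * ρ y ^ 2 := by
      have i1 := (h0.mul_const (t * t))
      have i2 := (h1.const_mul (-2)).mul_const t
      rw [nearField, ← e0, ← integral_const_mul, ← integral_mul_const, ← integral_mul_const,
        ← integral_add i1 i2]
      refine Eq.trans ?_ (integral_add (i1.add i2) h2)
      refine integral_congr_ae (Eventually.of_forall fun y => ?_)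
      simp only
      rw [← sq_abs (ρ y)]
      ring
    rw [← e]
    exact integral_nonneg fun y => mul_nonneg (nearKernel_nonneg _) (sq_nonneg _)
  have := discrim_le_zero key
  rw [discrim] at this
  nlinarith

section SpaceTime

variable {X : Type*} [MeasurableSpace X] {μ : Measure X} [SFinite μ] {n : X → Space d → ℝ}

theorem aestronglyMeasurable_field
    (hn : AEStronglyMeasurable (Function.uncurry n) (μ.prod volume)) :
    AEStronglyMeasurable (fun z : X × Space d => field d (n z.1) z.2) (μ.prod volume) := by
  have h : AEStronglyMeasurable
      (fun z : (X × Space d) × Space d => Function.uncurry n z.1 • kernel d z.2)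
      ((μ.prod volume).prod volume) :=
    (hn.comp_quasiMeasurePreserving Measure.quasiMeasurePreserving_fst).smul
      (((measurable_kernel d).comp measurable_snd).aestronglyMeasurable)
  exact (h.comp_measurePreserving measurePreserving_shear).integral_prod_right'

theorem integrable_nearKernel_mul (hd : 2 ≤ d) {w : X × Space d → ℝ}
    (hw : Integrable w (μ.prod volume)) :
    Integrable (fun z : (X × Space d) × Space d => nearKernel d (z.1.2 - z.2) * w (z.1.1, z.2))
      ((μ.prod volume).prod volume) := by
  simpa using integrable_convolution_param (ContinuousLinearMap.mul ℝ ℝ) hw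
    (integrable_nearKernel hd)

theorem ae_integrable_nearKernel_mul (hd : 2 ≤ d)
    (hn : Integrable (Function.uncurry n) (μ.prod volume)) :
    ∀ᵐ z ∂(μ.prod volume), Integrable fun y => nearKernel d (z.2 - y) * |n z.1 y| :=
  (integrable_nearKernel_mul hd hn.abs).prod_right_ae

/-- Convolution with the integrable kernel `nearKernel d` maps `L²` to `L²`. -/
theorem integrable_nearField_sq (hd : 2 ≤ d)
    (hn : Integrable (Function.uncurry n) (μ.prod volume))
    (hn2 : Integrable (fun z => Function.uncurry n z ^ 2) (μ.prod volume)) :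
    Integrable (fun z : X × Space d => nearField d (n z.1) z.2 ^ 2) (μ.prod volume) := by
  have h1 := integrable_nearKernel_mul hd hn.abs
  have h2 := integrable_nearKernel_mul hd hn2
  have hm : AEStronglyMeasurable (fun z : X × Space d => nearField d (n z.1) z.2)
      (μ.prod volume) := h1.1.integral_prod_right'
  refine (h2.integral_prod_left.const_mul (∫ y, nearKernel d y)).mono' (hm.pow 2) ?_
  filter_upwards [h1.prod_right_ae, h2.prod_right_ae] with z a b
  rw [Real.norm_of_nonneg (sq_nonneg _)]
  exact nearField_sq_le hd a b

end SpaceTime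

/-- A kernel which is locally integrable, and bounded away from the origin, can be integrated
against an integrable density. -/
theorem integrable_kernel_prod {F : Type*} [NormedAddCommGroup F] [NormedSpace ℝ F]
    {Q : Space d → F} (hQ : LocallyIntegrable Q) {C : ℝ} (hC : ∀ x, 1 ≤ ‖x‖ → ‖Q x‖ ≤ C)
    {η : Space d → ℝ} (hη : Continuous η) (hc : HasCompactSupport η)
    {ρ : Space d → ℝ} (hρ : Integrable ρ) :
    Integrable (fun z : Space d × Space d => (η z.1 * ρ z.2) • Q (z.1 - z.2))
      (volume.prod volume) := by
  have hηi : Integrable η := hη.integrable_of_hasCompactSupport hc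
  have hQ1 : Integrable ((Metric.ball (0 : Space d) 1).indicator Q) := by
    rw [integrable_indicator_iff Metric.isOpen_ball.measurableSet]
    exact (hQ.integrableOn_isCompact (isCompact_closedBall 0 1)).mono_set
      Metric.ball_subset_closedBall
  obtain ⟨A, hA⟩ := hη.bounded_above_of_compact_support hc
  have hA0 : 0 ≤ A := (norm_nonneg _).trans (hA 0)
  have hC0 : 0 ≤ |C| := abs_nonneg C
  have i1 : Integrable (fun z : Space d × Space d =>
      A * (‖ρ z.2‖ * ‖(Metric.ball (0 : Space d) 1).indicator Q (z.1 - z.2)‖))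
      (volume.prod volume) :=
    (hρ.norm.convolution_integrand (ContinuousLinearMap.mul ℝ ℝ) hQ1.norm).const_mul A
  have i2 : Integrable (fun z : Space d × Space d => |C| * (‖η z.1‖ * ‖ρ z.2‖))
      (volume.prod volume) := (hηi.norm.mul_prod hρ.norm).const_mul _
  refine (i1.add i2).mono' ?_ (Eventually.of_forall fun z => ?_)
  · exact ((hηi.1.comp_quasiMeasurePreserving Measure.quasiMeasurePreserving_fst).mul
      (hρ.1.comp_quasiMeasurePreserving Measure.quasiMeasurePreserving_snd)).smul
      (hQ.aestronglyMeasurable.comp_quasiMeasurePreserving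
        (quasiMeasurePreserving_sub_of_right_invariant volume volume))
  · rw [norm_smul, norm_mul]
    simp only [Pi.add_apply]
    by_cases hz : z.1 - z.2 ∈ Metric.ball (0 : Space d) 1
    · rw [indicator_of_mem hz]
      have : ‖η z.1‖ * (‖ρ z.2‖ * ‖Q (z.1 - z.2)‖) ≤ A * (‖ρ z.2‖ * ‖Q (z.1 - z.2)‖) :=
        mul_le_mul_of_nonneg_right (hA _) (by positivity)
      have : 0 ≤ |C| * (‖η z.1‖ * ‖ρ z.2‖) := by positivity
      linarith
    · rw [indicator_of_notMem hz, norm_zero, mul_zero, mul_zero, zero_add, mul_comm]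
      exact mul_le_mul_of_nonneg_right ((hC _ (by simpa using hz)).trans (le_abs_self C))
        (by positivity)

theorem integrable_kernel_mul_density (hd : 2 ≤ d) {η : Space d → ℝ} (hη : Continuous η)
    (hc : HasCompactSupport η) {ρ : Space d → ℝ} (hρ : Integrable ρ) :
    Integrable (fun z : Space d × Space d => (η z.1 * ρ z.2) • kernel d (z.1 - z.2))
      (volume.prod volume) :=
  integrable_kernel_prod (locallyIntegrable_kernel hd) (fun _ => norm_kernel_le_of_one_le hd)
    hη hc hρ

theorem locallyIntegrable_field (hd : 2 ≤ d) {ρ : Space d → ℝ} (hρ : Integrable ρ) :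
    LocallyIntegrable (field d ρ) := by
  intro x
  let η : ContDiffBump x := ⟨1, 2, one_pos, one_lt_two⟩
  have hi : Integrable fun x => η x • field d ρ x := by
    refine (integrable_kernel_mul_density hd η.continuous η.hasCompactSupport
      hρ).integral_prod_left.congr (Eventually.of_forall fun x => ?_)
    simp only [mul_smul, field, integral_smul]
  refine ⟨Metric.closedBall x 1, Metric.closedBall_mem_nhds x one_pos,
    (hi.integrableOn (s := Metric.closedBall x 1)).congr_fun (fun y hy => ?_)
      Metric.isClosed_closedBall.measurableSet⟩
  simp only
  rw [η.one_of_mem_closedBall hy, one_smul]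

/-- `div (∇G * ρ) = -ρ` in the sense of distributions. -/
theorem integral_inner_field_gradient (hd : d = 2 ∨ d = 3) {ρ : Space d → ℝ} (hρ : Integrable ρ)
    {ψ : Space d → ℝ} (hψ : ContDiff ℝ ∞ ψ) (hc : HasCompactSupport ψ) :
    ∫ x, inner ℝ (field d ρ x) (∇ ψ x) = ∫ x, ρ x * ψ x := by
  have hd2 : 2 ≤ d := by omega
  have hψ1 : ContDiff ℝ 1 ψ := hψ.of_le (by simp)
  have hg := continuous_gradient hψ1
  have hi := integrable_kernel_mul_density hd2 hg.norm (hasCompactSupport_gradient hc).norm hρ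
  have hi2 : Integrable (fun z : Space d × Space d =>
      inner ℝ (ρ z.2 • kernel d (z.1 - z.2)) (∇ ψ z.1)) (volume.prod volume) := by
    refine hi.norm.mono' ?_ (Eventually.of_forall fun z => ?_)
    · exact ((hρ.1.comp_quasiMeasurePreserving Measure.quasiMeasurePreserving_snd).smul
        ((measurable_kernel d).comp (measurable_fst.sub measurable_snd)).aestronglyMeasurable).inner
        (hg.comp continuous_fst).aestronglyMeasurable
    · refine (norm_inner_le_norm _ _).trans (le_of_eq ?_)
      simp only [norm_smul, norm_mul, norm_norm]
      ring
  have e1 : ∀ᵐ x, inner ℝ (field d ρ x) (∇ ψ x) =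
      ∫ y, inner ℝ (ρ y • kernel d (x - y)) (∇ ψ x) := by
    filter_upwards [hi.prod_right_ae] with x hx
    by_cases h0 : ∇ ψ x = 0
    · simp [h0]
    · have hx' : Integrable fun y => ρ y • kernel d (x - y) := by
        have := hx.smul (‖∇ ψ x‖⁻¹)
        refine this.congr (Eventually.of_forall fun y => ?_)
        simp only [Pi.smul_apply, smul_smul]
        rw [← mul_assoc, inv_mul_cancel₀ (norm_ne_zero_iff.2 h0), one_mul]
      rw [field, real_inner_comm, ← integral_inner hx']
      simp_rw [real_inner_comm]
  rw [integral_congr_ae e1, integral_integral_swap hi2]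
  refine integral_congr_ae (Eventually.of_forall fun y => ?_)
  simp only [inner_smul_left]
  rw [integral_const_mul, integral_inner_kernel_sub_gradient hd hψ1 hc]
  rfl

theorem log_one_add_le {r : ℝ} (hr : 0 ≤ r) : Real.log (1 + r) ≤ Real.log 2 + |Real.log r| := by
  rcases le_or_gt r 1 with h | h
  · have := Real.log_le_log (by linarith) (by linarith : 1 + r ≤ 2)
    linarith [abs_nonneg (Real.log r)]
  · have := Real.log_le_log (by linarith) (by linarith : 1 + r ≤ 2 * r)
    rw [Real.log_mul two_ne_zero (by linarith)] at this
    linarith [le_abs_self (Real.log r)]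

theorem abs_log_le_inv_add_log_one_add {r : ℝ} (hr : 0 ≤ r) :
    |Real.log r| ≤ r⁻¹ + Real.log (1 + r) := by
  rcases hr.eq_or_lt with rfl | hr
  · simp
  have h1 := Real.log_le_sub_one_of_pos (inv_pos.2 hr)
  rw [Real.log_inv] at h1
  have h2 := Real.log_le_log hr (by linarith : r ≤ 1 + r)
  have h3 := Real.log_nonneg (by linarith : 1 ≤ 1 + r)
  have h4 := inv_pos.2 hr
  rw [abs_le]
  constructor <;> linarith

theorem log_one_add_norm_sub_le (x y : Space d) :
    Real.log (1 + ‖x - y‖) ≤ Real.log (1 + ‖x‖) + Real.log (1 + ‖y‖) := by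
  have h := norm_sub_le x y
  rw [← Real.log_mul (by positivity) (by positivity)]
  refine Real.log_le_log (by positivity) ?_
  nlinarith [norm_nonneg x, norm_nonneg y]

/-- The convergence of the logarithmic potential at one point yields a logarithmic moment. -/
theorem integrable_log_moment {ρ : Space 2 → ℝ} (hρ : Integrable ρ) {x : Space 2}
    (hx : Integrable fun y => green 2 (x - y) * ρ y) :
    Integrable fun y => Real.log (1 + ‖y‖) * ρ y := by
  have h1 : Integrable fun y => Real.log ‖x - y‖ * ρ y := by
    refine (hx.const_mul (-(2 * Real.pi))).congr (Eventually.of_forall fun y => ?_)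
    simp only [green, if_true]
    field_simp
  refine ((hρ.norm.const_mul (Real.log (1 + ‖x‖) + Real.log 2)).add h1.norm).mono'
    ((by fun_prop : Measurable fun y : Space 2 => Real.log (1 + ‖y‖)).aestronglyMeasurable.mul
      hρ.1) (Eventually.of_forall fun y => ?_)
  have h2 : Real.log (1 + ‖y‖) ≤ Real.log (1 + ‖x‖) + Real.log (1 + ‖x - y‖) := by
    have := log_one_add_norm_sub_le x (x - y)
    rwa [sub_sub_cancel] at this
  have h3 := log_one_add_le (norm_nonneg (x - y))
  have h4 := Real.log_nonneg (by linarith [norm_nonneg y] : 1 ≤ 1 + ‖y‖)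
  rw [norm_mul, Real.norm_of_nonneg h4]
  simp only [Pi.add_apply, norm_mul, Real.norm_eq_abs]
  nlinarith [abs_nonneg (ρ y)]

/-- In the plane the Green function grows at infinity. The growth is absorbed by the logarithmic
moment of the density, which the convergence of the potential provides. -/
theorem integrable_green_mul_density (hd : d = 2 ∨ d = 3) {η : Space d → ℝ} (hη : Continuous η)
    (hc : HasCompactSupport η) {ρ : Space d → ℝ} (hρ : Integrable ρ)
    (hconv : ∀ᵐ x, Integrable fun y => green d (x - y) * ρ y) :
    Integrable (fun z : Space d × Space d => (η z.1 * ρ z.2) * green d (z.1 - z.2))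
      (volume.prod volume) := by
  have hd2 : 2 ≤ d := by omega
  have hm : Measurable (green d) := by
    unfold green
    split_ifs <;> fun_prop
  have hmeas : AEStronglyMeasurable (fun z : Space d × Space d =>
      (η z.1 * ρ z.2) * green d (z.1 - z.2)) (volume.prod volume) :=
    ((hη.comp continuous_fst).aestronglyMeasurable.mul
      (hρ.1.comp_quasiMeasurePreserving Measure.quasiMeasurePreserving_snd)).mul
      (hm.comp (measurable_fst.sub measurable_snd)).aestronglyMeasurable
  have hinv := integrable_kernel_prod (locallyIntegrable_norm_inv hd2) (C := 1)
    (fun x hx => by rw [norm_inv, norm_norm]; exact inv_le_one_of_one_le₀ hx) hη hc hρ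
  have hpi := Real.pi_gt_three
  rcases hd with rfl | rfl
  · obtain ⟨x, hx⟩ := hconv.exists
    have hlog := integrable_log_moment hρ hx
    have i1 : Integrable (fun z : Space 2 × Space 2 => (η z.1 * Real.log (1 + ‖z.1‖)) * ρ z.2)
        (volume.prod volume) := by
      refine Integrable.mul_prod (f := fun x => η x * Real.log (1 + ‖x‖)) ?_ hρ
      refine Continuous.integrable_of_hasCompactSupport (hη.mul ?_) hc.mul_right
      exact Continuous.log (by fun_prop) fun x => by positivity
    have i2 : Integrable (fun z : Space 2 × Space 2 => η z.1 * (Real.log (1 + ‖z.2‖) * ρ z.2))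
        (volume.prod volume) :=
      (hη.integrable_of_hasCompactSupport hc).mul_prod hlog
    refine ((hinv.norm.add i1.norm).add i2.norm).mono' hmeas (Eventually.of_forall fun z => ?_)
    have h1 : |green 2 (z.1 - z.2)| ≤
        ‖z.1 - z.2‖⁻¹ + (Real.log (1 + ‖z.1‖) + Real.log (1 + ‖z.2‖)) := by
      simp only [green, if_true]
      rw [abs_mul, abs_neg, abs_of_pos (by positivity)]
      have h1 : 1 / (2 * Real.pi) ≤ 1 := by rw [div_le_one (by positivity)]; linarith
      have := abs_log_le_inv_add_log_one_add (norm_nonneg (z.1 - z.2))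
      have := log_one_add_norm_sub_le z.1 z.2
      exact (mul_le_of_le_one_left (abs_nonneg _) h1).trans (by linarith)
    have h3 := Real.log_nonneg (by linarith [norm_nonneg z.1] : 1 ≤ 1 + ‖z.1‖)
    have h4 := Real.log_nonneg (by linarith [norm_nonneg z.2] : 1 ≤ 1 + ‖z.2‖)
    simp only [Pi.add_apply, norm_mul, smul_eq_mul, norm_inv, norm_norm]
    rw [Real.norm_of_nonneg h3, Real.norm_of_nonneg h4]
    refine (mul_le_mul_of_nonneg_left h1 (by positivity)).trans (le_of_eq ?_)
    ring
  · refine hinv.norm.mono' hmeas (Eventually.of_forall fun z => ?_)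
    rw [norm_mul, norm_smul]
    refine mul_le_mul_of_nonneg_left ?_ (norm_nonneg _)
    simp only [green]
    rw [if_neg (by norm_num), one_div, mul_inv, norm_mul]
    refine mul_le_of_le_one_left (norm_nonneg _) ?_
    rw [Real.norm_of_nonneg (by positivity)]
    exact inv_le_one_of_one_le₀ (by linarith)

/-- The weak gradient of the potential is the field. -/
theorem integral_potential_smul_gradient (hd : d = 2 ∨ d = 3) {ρ : Space d → ℝ}
    (hρ : Integrable ρ) (hconv : ∀ᵐ x, Integrable fun y => green d (x - y) * ρ y)
    {ψ : Space d → ℝ} (hψ : ContDiff ℝ ∞ ψ) (hc : HasCompactSupport ψ) :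
    ∫ x, potential d ρ x • ∇ ψ x = -∫ x, ψ x • field d ρ x := by
  have hd2 : 2 ≤ d := by omega
  have hψ1 : ContDiff ℝ 1 ψ := hψ.of_le (by simp)
  have hg := continuous_gradient hψ1
  have hi := integrable_green_mul_density hd hg.norm (hasCompactSupport_gradient hc).norm hρ hconv
  have hk := integrable_kernel_mul_density hd2 hψ.continuous hc hρ
  have hm : Measurable (green d) := by
    unfold green
    split_ifs <;> fun_prop
  have hi2 : Integrable (fun z : Space d × Space d =>
      (green d (z.1 - z.2) * ρ z.2) • ∇ ψ z.1) (volume.prod volume) := by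
    refine hi.norm.mono' ?_ (Eventually.of_forall fun z => ?_)
    · exact ((hm.comp (measurable_fst.sub measurable_snd)).aestronglyMeasurable.mul
        (hρ.1.comp_quasiMeasurePreserving Measure.quasiMeasurePreserving_snd)).smul
        (hg.comp continuous_fst).aestronglyMeasurable
    · simp only [norm_smul, norm_mul, norm_norm]
      apply le_of_eq
      ring
  have e1 : ∀ x, potential d ρ x • ∇ ψ x = ∫ y, (green d (x - y) * ρ y) • ∇ ψ x := fun x => by
    rw [integral_smul_const]; rfl
  have e2 : ∀ x, ψ x • field d ρ x = ∫ y, (ψ x * ρ y) • kernel d (x - y) := fun x => by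
    simp_rw [mul_smul, integral_smul]; rfl
  simp_rw [e1, e2]
  have hsw := integral_integral_swap (f := fun x y => (ψ x * ρ y) • kernel d (x - y)) hk
  rw [integral_integral_swap hi2, hsw, ← integral_neg]
  refine integral_congr_ae (Eventually.of_forall fun y => ?_)
  have h := integral_green_sub_smul_gradient hd hψ1 hc y
  have e3 : ∀ x, (green d (x - y) * ρ y) • ∇ ψ x = ρ y • (green d (x - y) • ∇ ψ x) := fun x => by
    rw [smul_smul, mul_comm]
  have e4 : ∀ x, (ψ x * ρ y) • kernel d (x - y) = ρ y • (ψ x • kernel d (x - y)) := fun x => by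
    rw [smul_smul, mul_comm]
  simp only [e3, e4, integral_smul]
  rw [h, smul_neg]

/-- A weak gradient of the potential coincides with the field. -/
theorem IsWeakGradient.ae_eq_field (hd : d = 2 ∨ d = 3) {ρ : Space d → ℝ} {h : Space d → Space d}
    (hh : IsWeakGradient (potential d ρ) h)
    (hρ : Integrable ρ) (hconv : ∀ᵐ x, Integrable fun y => green d (x - y) * ρ y) :
    h =ᵐ[volume] field d ρ := by
  refine ae_eq_of_integral_contDiff_smul_eq hh.2.1 (locallyIntegrable_field (by omega) hρ)
    fun ψ hψ hc => ?_
  have h1 := hh.2.2 ψ hψ hc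
  rw [integral_potential_smul_gradient hd hρ hconv hψ hc] at h1
  exact (neg_injective h1).symm

end Field

/-! ### The chain and product rules for Sobolev functions -/

section ProductRule

variable {d : ℕ}

theorem gradient_mollifier_sub (k : ℕ) (x y : Space d) :
    ∇ (fun y => mollifier d k (x - y)) y = -∇ (mollifier d k) (x - y) := by
  refine ext_inner_right ℝ fun w => ?_
  have h := (((contDiff_mollifier (d := d) k).differentiable (by simp) (x - y)).hasFDerivAt.comp y
    ((hasFDerivAt_id y).const_sub x)).fderiv
  rw [inner_neg_left, inner_gradient_left, inner_gradient_left]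
  have h' : fderiv ℝ (fun y => mollifier d k (x - y)) y = _ := h
  rw [h']
  simp

theorem gradient_mollify_eq_integral (k : ℕ) {u : Space d → ℝ} (hu : LocallyIntegrable u)
    (x : Space d) : ∇ (mollify k u) x = ∫ y, u y • ∇ (mollifier d k) (x - y) := by
  have hρ : ContDiff ℝ 1 (mollifier d k) := (contDiff_mollifier k).of_le (by simp)
  have hder := ((hasCompactSupport_mollifier (d := d) k).hasFDerivAt_convolution_left
    (ContinuousLinearMap.lsmul ℝ ℝ) hρ hu x).fderiv
  have hex := (((hasCompactSupport_mollifier (d := d) k).fderiv ℝ).convolutionExists_left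
    ((ContinuousLinearMap.lsmul ℝ ℝ : ℝ →L[ℝ] ℝ →L[ℝ] ℝ).precompL (Space d))
    (hρ.continuous_fderiv one_ne_zero) hu x).integrable_swap
  have hint : Integrable fun y => u y • ∇ (mollifier d k) (x - y) := by
    refine hu.integrable_smul_right_of_hasCompactSupport
      ((continuous_gradient hρ).comp (continuous_const.sub continuous_id)) ?_
    exact (hasCompactSupport_gradient (hasCompactSupport_mollifier k)).comp_homeomorph
      (Homeomorph.subLeft x)
  refine ext_inner_left ℝ fun w => ?_
  rw [inner_gradient_right, ← integral_inner (𝕜 := ℝ) hint]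
  change fderiv ℝ (convolution _ _ _ _) x w = _
  rw [hder, convolution_eq_swap, ContinuousLinearMap.integral_apply hex]
  refine integral_congr_ae (Eventually.of_forall fun y => ?_)
  simp [inner_smul_right, inner_gradient_right, mul_comm]

theorem tsupport_mollifier_sub_subset {k : ℕ} {R : ℝ} {x : Space d}
    (hx : ‖x‖ + 1 / ((k : ℝ) + 1) < R) :
    tsupport (fun y => mollifier d k (x - y)) ⊆ Metric.ball 0 R := by
  refine (closure_minimal (fun y hy => ?_) (Metric.isClosed_closedBall
    (x := x) (ε := 1 / ((k : ℝ) + 1)))).trans fun y hy => ?_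
  · by_contra hcon
    refine hy (mollifier_eq_zero ?_)
    rw [Metric.mem_closedBall, dist_eq_norm, norm_sub_rev] at hcon
    exact (not_le.1 hcon).le
  · rw [Metric.mem_closedBall, dist_eq_norm] at hy
    rw [mem_ball_zero_iff]
    have := norm_add_le x (y - x)
    rw [add_sub_cancel] at this
    linarith

/-- Mollification commutes with weak gradients. -/
theorem gradient_mollify {k : ℕ} {R : ℝ} {u : Space d → ℝ} {g : Space d → Space d}
    (hu : LocallyIntegrable u)
    (h : ∀ η : Space d → ℝ, ContDiff ℝ ∞ η → HasCompactSupport η → tsupport η ⊆ Metric.ball 0 R →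
      ∫ x, u x • ∇ η x = -∫ x, η x • g x) {x : Space d} (hx : ‖x‖ + 1 / ((k : ℝ) + 1) < R) :
    ∇ (mollify k u) x = mollify k g x := by
  have hη : ContDiff ℝ ∞ fun y => mollifier d k (x - y) :=
    (contDiff_mollifier k).comp (contDiff_const.sub contDiff_id)
  have hc : HasCompactSupport fun y => mollifier d k (x - y) :=
    (hasCompactSupport_mollifier k).comp_homeomorph (Homeomorph.subLeft x)
  have hs := tsupport_mollifier_sub_subset hx
  have key := h _ hη hc hs
  simp_rw [gradient_mollifier_sub, smul_neg, integral_neg, neg_inj] at key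
  rw [gradient_mollify_eq_integral k hu, key, mollify_apply_swap]

/-- `m` is the distributional divergence of the vector field `b`. -/
def IsWeakDivergence (b : Space d → Space d) (m : Space d → ℝ) : Prop :=
  ∀ ψ : Space d → ℝ, ContDiff ℝ ∞ ψ → HasCompactSupport ψ →
    ∫ x, inner ℝ (b x) (∇ ψ x) = -∫ x, m x * ψ x

/-- If `v k → 0` in `L²` then the integrals of functions dominated by `‖v k‖ ‖w‖` tend to zero. -/
theorem tendsto_integral_zero_of_le {F G : Type*} [NormedAddCommGroup F] [NormedAddCommGroup G]
    {f : ℕ → Space d → ℝ} {v : ℕ → Space d → F} {w : Space d → G} (C : ℝ)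
    (hv : ∀ k, AEStronglyMeasurable (v k)) (hw : MemLp w 2)
    (h0 : Tendsto (fun k => eLpNorm (v k) 2 volume) atTop (𝓝 0))
    (hle : ∀ k x, |f k x| ≤ C * (‖v k x‖ * ‖w x‖)) :
    Tendsto (fun k => ∫ x, f k x) atTop (𝓝 0) := by
  have hb : ∀ k, ‖∫ x, f k x‖ₑ ≤
      ENNReal.ofReal C * (eLpNorm (v k) 2 volume * eLpNorm w 2 volume) := by
    intro k
    have h1 := ENNReal.lintegral_mul_le_Lp_mul_Lq volume Real.HolderConjugate.two_two
      (hv k).enorm hw.1.enorm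
    calc ‖∫ x, f k x‖ₑ ≤ ∫⁻ x, ‖f k x‖ₑ := enorm_integral_le_lintegral_enorm _
      _ ≤ ∫⁻ x, ENNReal.ofReal C * (‖v k x‖ₑ * ‖w x‖ₑ) := by
          refine lintegral_mono fun x => ?_
          rw [← ofReal_norm, ← ofReal_norm, ← ofReal_norm, ← ENNReal.ofReal_mul (norm_nonneg _),
            ← ENNReal.ofReal_mul' (by positivity)]
          exact ENNReal.ofReal_le_ofReal (hle k x)
      _ = ENNReal.ofReal C * ∫⁻ x, ‖v k x‖ₑ * ‖w x‖ₑ :=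
          lintegral_const_mul'' _ ((hv k).enorm.mul hw.1.enorm)
      _ ≤ _ := by
          gcongr
          refine h1.trans (le_of_eq ?_)
          rw [eLpNorm_eq_lintegral_rpow_enorm_toReal two_ne_zero ENNReal.ofNat_ne_top,
            eLpNorm_eq_lintegral_rpow_enorm_toReal two_ne_zero ENNReal.ofNat_ne_top]
          simp
  rw [tendsto_zero_iff_norm_tendsto_zero]
  have h2 : Tendsto (fun k => ‖∫ x, f k x‖ₑ) atTop (𝓝 0) := by
    refine tendsto_of_tendsto_of_tendsto_of_le_of_le tendsto_const_nhds ?_ (fun _ => zero_le) hb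
    have := ENNReal.Tendsto.const_mul (a := ENNReal.ofReal C)
      (ENNReal.Tendsto.mul_const h0 (Or.inr hw.2.ne)) (Or.inr ENNReal.ofReal_ne_top)
    simpa using this
  have h3 := (ENNReal.tendsto_toReal ENNReal.zero_ne_top).comp h2
  simpa [Function.comp_def] using h3

theorem locallyIntegrable_of_memLp_ball {F : Type*} [NormedAddCommGroup F] {b : Space d → F}
    (hb : ∀ R : ℝ, MemLp b 2 (volume.restrict (Metric.ball 0 R))) : LocallyIntegrable b :=
  fun x => by
    have : IsFiniteMeasure ((volume : Measure (Space d)).restrict (Metric.ball 0 (‖x‖ + 1))) :=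
      isFiniteMeasure_restrict.2 measure_ball_lt_top.ne
    exact ⟨Metric.ball 0 (‖x‖ + 1), Metric.isOpen_ball.mem_nhds (by simp),
      (hb (‖x‖ + 1)).integrable one_le_two⟩

/-- The product of a field in `L²_loc` and a continuous function of compact support is in `L²`. -/
theorem memLp_smul_of_hasCompactSupport {F : Type*} [NormedAddCommGroup F] [NormedSpace ℝ F]
    {b : Space d → F} (hb : ∀ R : ℝ, MemLp b 2 (volume.restrict (Metric.ball 0 R)))
    {η : Space d → ℝ} (hη : Continuous η) (hc : HasCompactSupport η) :
    MemLp (fun x => η x • b x) 2 := by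
  obtain ⟨A, hA⟩ := hη.bounded_above_of_compact_support hc
  obtain ⟨R, hR⟩ := hc.isBounded.subset_ball 0
  have h1 : MemLp ((Metric.ball 0 R).indicator b) 2 :=
    (memLp_indicator_iff_restrict Metric.isOpen_ball.measurableSet).2 (hb R)
  refine h1.of_le_mul (c := A)
    (hη.aestronglyMeasurable.smul (locallyIntegrable_of_memLp_ball hb).aestronglyMeasurable)
    (Eventually.of_forall fun x => ?_)
  by_cases hx : x ∈ Metric.ball (0 : Space d) R
  · rw [indicator_of_mem hx, norm_smul]
    exact mul_le_mul_of_nonneg_right (hA x) (norm_nonneg _)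
  · rw [image_eq_zero_of_notMem_tsupport fun h => hx (hR h), indicator_of_notMem hx]
    simp

theorem abs_comp_sub_le {θ : ℝ → ℝ} {C : ℝ} (hθ : Differentiable ℝ θ)
    (hC : ∀ s, |deriv θ s| ≤ C) (s t : ℝ) : |θ s - θ t| ≤ C * |s - t| := by
  have := Convex.norm_image_sub_le_of_norm_deriv_le (f := θ) (C := C) (s := univ) (x := t) (y := s)
    (fun x _ => hθ x) (fun x _ => hC x) convex_univ (mem_univ _) (mem_univ _)
  simpa using this

theorem integrable_comp_mul {θ : ℝ → ℝ} {C : ℝ} (hθ : Differentiable ℝ θ)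
    (hC : ∀ s, |deriv θ s| ≤ C) {u w : Space d → ℝ} (hu : MemLp u 2) (hw : MemLp w 2)
    (hw1 : Integrable w) : Integrable fun x => θ (u x) * w x := by
  refine ((hw1.norm.const_mul |θ 0|).add ((hu.norm.integrable_mul hw.norm).const_mul C)).mono'
    ((hθ.continuous.comp_aestronglyMeasurable hu.1).mul hw.1) (Eventually.of_forall fun x => ?_)
  have h1 := abs_comp_sub_le hθ hC (u x) 0
  have h2 := abs_sub_abs_le_abs_sub (θ (u x)) (θ 0)
  rw [sub_zero] at h1
  simp only [Pi.add_apply, Pi.mul_apply, norm_mul, Real.norm_eq_abs]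
  nlinarith [abs_nonneg (w x)]

theorem tendsto_integral_comp_mollify_mul {θ : ℝ → ℝ} {C : ℝ} (hθ : Differentiable ℝ θ)
    (hC : ∀ s, |deriv θ s| ≤ C) {u w : Space d → ℝ} (hu : MemLp u 2) (hw : MemLp w 2)
    (hw1 : Integrable w) (hi : ∀ k, Integrable fun x => θ (mollify k u x) * w x) :
    Tendsto (fun k => ∫ x, θ (mollify k u x) * w x) atTop (𝓝 (∫ x, θ (u x) * w x)) := by
  rw [← tendsto_sub_nhds_zero_iff]
  simp_rw [fun k => (integral_sub (hi k) (integrable_comp_mul hθ hC hu hw hw1)).symm]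
  have hul := hu.locallyIntegrable one_le_two
  refine tendsto_integral_zero_of_le (v := fun k => mollify k u - u) C
    (fun k => (contDiff_mollify k hul).continuous.aestronglyMeasurable.sub hu.1) hw
    (tendsto_eLpNorm_mollify_sub one_le_two (by simp) hu) fun k x => ?_
  rw [← sub_mul, abs_mul, ← mul_assoc]
  exact mul_le_mul_of_nonneg_right (abs_comp_sub_le hθ hC _ _) (abs_nonneg _)

theorem integrable_comp_smooth {v m ψ : Space d → ℝ} {b : Space d → Space d} {θ : ℝ → ℝ}
    (hv : ContDiff ℝ ∞ v) (hθ : ContDiff ℝ ∞ θ) (hb : LocallyIntegrable b)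
    (hm : LocallyIntegrable m) (hψ : ContDiff ℝ ∞ ψ) (hc : HasCompactSupport ψ) :
    (Integrable fun x => θ (v x) * inner ℝ (b x) (∇ ψ x)) ∧
    (Integrable fun x => deriv θ (v x) * inner ℝ (ψ x • b x) (∇ v x)) ∧
    Integrable fun x => θ (v x) * (ψ x • m x) := by
  have hθv : Continuous fun x => θ (v x) := hθ.continuous.comp hv.continuous
  have hθ'v : Continuous fun x => deriv θ (v x) :=
    (hθ.continuous_deriv (by simp)).comp hv.continuous
  refine ⟨?_, ?_, ?_⟩
  · have hcs : HasCompactSupport fun x => θ (v x) • ∇ ψ x :=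
      (hasCompactSupport_gradient hc).smul_left (f := fun x => θ (v x))
    have h := hb.integrable_inner (hθv.smul (contDiff_gradient hψ).continuous) hcs
    simpa only [Pi.smul_apply', inner_smul_right] using h
  · have hcs : HasCompactSupport fun x => ψ x • (deriv θ (v x) • ∇ v x) :=
      hc.smul_right (f' := fun x => deriv θ (v x) • ∇ v x)
    have h := hb.integrable_inner
      (hψ.continuous.smul (hθ'v.smul (contDiff_gradient hv).continuous)) hcs
    refine h.congr (Eventually.of_forall fun x => ?_)
    simp only [Pi.smul_apply', inner_smul_right, inner_smul_left, conj_trivial]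
    ring
  · have hcs : HasCompactSupport fun x => θ (v x) * ψ x := hc.mul_left (f := fun x => θ (v x))
    have h := hm.integrable_smul_left_of_hasCompactSupport (hθv.mul hψ.continuous) hcs
    simpa only [Pi.mul_apply, smul_eq_mul, mul_assoc] using h

/-- The definition of the weak divergence, tested with `θ(v) ψ`. -/
theorem integral_comp_smooth {v m ψ : Space d → ℝ} {b : Space d → Space d} {θ : ℝ → ℝ}
    (hv : ContDiff ℝ ∞ v) (hθ : ContDiff ℝ ∞ θ) (hb : LocallyIntegrable b)
    (hm : LocallyIntegrable m) (hbm : IsWeakDivergence b m) (hψ : ContDiff ℝ ∞ ψ)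
    (hc : HasCompactSupport ψ) :
    (∫ x, θ (v x) * inner ℝ (b x) (∇ ψ x)) +
      ∫ x, deriv θ (v x) * inner ℝ (ψ x • b x) (∇ v x) = -∫ x, θ (v x) * (ψ x • m x) := by
  obtain ⟨i1, i2, -⟩ := integrable_comp_smooth hv hθ hb hm hψ hc
  have hθv : ContDiff ℝ ∞ fun x => θ (v x) := hθ.comp hv
  have hcs : HasCompactSupport fun x => θ (v x) * ψ x := hc.mul_left (f := fun x => θ (v x))
  have h := hbm (fun x => θ (v x) * ψ x) (hθv.mul hψ) hcs
  rw [← integral_add i1 i2]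
  have e1 : ∀ x, inner ℝ (b x) (∇ (fun x => θ (v x) * ψ x) x) =
      θ (v x) * inner ℝ (b x) (∇ ψ x) + deriv θ (v x) * inner ℝ (ψ x • b x) (∇ v x) := by
    intro x
    rw [gradient_mul (hθv.differentiable (by simp) x) (hψ.differentiable (by simp) x),
      gradient_comp ((hθ.differentiable (by simp)) _).hasDerivAt (hv.differentiable (by simp) x)]
    simp only [inner_add_right, inner_smul_right, inner_smul_left, conj_trivial]
    ring
  have e2 : ∀ x, θ (v x) * (ψ x • m x) = m x * (θ (v x) * ψ x) := fun x => by
    simp only [smul_eq_mul]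
    ring
  simp_rw [e2, ← h, e1]

/-- The chain rule combined with integration by parts against a field with divergence in `L²`:
`∫ θ(u) b·∇ψ = -∫ (θ'(u) ∇u·b + θ(u) div b) ψ`. -/
theorem integral_comp_mul_inner_gradient {u m : Space d → ℝ} {g b : Space d → Space d}
    {θ : ℝ → ℝ} {C : ℝ} (hθ : ContDiff ℝ ∞ θ) (hC : ∀ s, |deriv θ s| ≤ C)
    (hu : MemLp u 2) (hg : MemLp g 2) (hug : IsWeakGradient u g)
    (hb : ∀ R : ℝ, MemLp b 2 (volume.restrict (Metric.ball 0 R)))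
    (hm : ∀ R : ℝ, MemLp m 2 (volume.restrict (Metric.ball 0 R)))
    (hbm : IsWeakDivergence b m) {ψ : Space d → ℝ} (hψ : ContDiff ℝ ∞ ψ)
    (hc : HasCompactSupport ψ) :
    ∫ x, θ (u x) * inner ℝ (b x) (∇ ψ x) =
      -∫ x, ψ x * (deriv θ (u x) * inner ℝ (g x) (b x) + θ (u x) * m x) := by
  have hul := hu.locallyIntegrable one_le_two
  have hgl := hg.locallyIntegrable one_le_two
  have hbl := locallyIntegrable_of_memLp_ball hb
  have hml := locallyIntegrable_of_memLp_ball hm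
  have hθd : Differentiable ℝ θ := hθ.differentiable (by simp)
  have hθ'c : Continuous (deriv θ) := hθ.continuous_deriv (by simp)
  have hψg : Continuous (∇ ψ) := (contDiff_gradient hψ).continuous
  have hcg : HasCompactSupport (∇ ψ) := hasCompactSupport_gradient hc
  have hus : ∀ k, ContDiff ℝ ∞ (mollify k u) := fun k => contDiff_mollify k hul
  have hgc : ∀ k, Continuous (mollify k g) := fun k => (contDiff_mollify k hgl).continuous
  have hgr : ∀ k x, ∇ (mollify k u) x = mollify k g x := fun k x =>
    gradient_mollify (R := ‖x‖ + 2) hul (fun η h1 h2 _ => hug.2.2 η h1 h2) (by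
      have : 1 / ((k : ℝ) + 1) ≤ 1 := by
        rw [div_le_one (by positivity)]
        linarith [(k.cast_nonneg : (0 : ℝ) ≤ k)]
      linarith)
  have hψb := memLp_smul_of_hasCompactSupport hb hψ.continuous hc
  have hψm := memLp_smul_of_hasCompactSupport hm hψ.continuous hc
  have hψm1 : Integrable fun x => ψ x • m x :=
    hml.integrable_smul_left_of_hasCompactSupport hψ.continuous hc
  have hw1 : Integrable fun x => inner ℝ (b x) (∇ ψ x) := hbl.integrable_inner hψg hcg
  have hw2 : MemLp (fun x => inner ℝ (b x) (∇ ψ x)) 2 := by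
    refine (memLp_smul_of_hasCompactSupport hb hψg.norm hcg.norm).mono hw1.1
      (Eventually.of_forall fun x => ?_)
    rw [norm_smul, norm_norm, mul_comm]
    exact norm_inner_le_norm _ _
  have i1 := fun k => (integrable_comp_smooth (hus k) hθ hbl hml hψ hc).1
  have i2 : ∀ k, Integrable fun x => deriv θ (mollify k u x) *
      inner ℝ (ψ x • b x) (mollify k g x) := fun k => by
    simpa only [hgr] using (integrable_comp_smooth (hus k) hθ hbl hml hψ hc).2.1
  have i3 := fun k => (integrable_comp_smooth (hus k) hθ hbl hml hψ hc).2.2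
  have hk : ∀ k, (∫ x, θ (mollify k u x) * inner ℝ (b x) (∇ ψ x)) +
      ∫ x, deriv θ (mollify k u x) * inner ℝ (ψ x • b x) (mollify k g x) =
        -∫ x, θ (mollify k u x) * (ψ x • m x) := fun k => by
    simpa only [hgr] using integral_comp_smooth (hus k) hθ hbl hml hbm hψ hc
  have t1 := tendsto_integral_comp_mollify_mul hθd hC hu hw2 hw1 i1
  have t3 := tendsto_integral_comp_mollify_mul hθd hC hu hψm hψm1 i3
  have iψ : Integrable fun x => inner ℝ (ψ x • b x) (g x) := by
    refine (hψb.norm.integrable_mul hg.norm).mono' (hψb.1.inner hg.1)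
      (Eventually.of_forall fun x => norm_inner_le_norm _ _)
  have iθ : ∀ {v : Space d → ℝ}, AEStronglyMeasurable v →
      Integrable fun x => deriv θ (v x) * inner ℝ (ψ x • b x) (g x) := fun {v} hv =>
    iψ.bdd_mul (hθ'c.comp_aestronglyMeasurable hv) (Eventually.of_forall fun x => hC (v x))
  have t2 : Tendsto (fun k => ∫ x, deriv θ (mollify k u x) *
      inner ℝ (ψ x • b x) (mollify k g x)) atTop
      (𝓝 (∫ x, deriv θ (u x) * inner ℝ (ψ x • b x) (g x))) := by
    have e : ∀ k, ∫ x, deriv θ (mollify k u x) * inner ℝ (ψ x • b x) (mollify k g x) =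
        (∫ x, deriv θ (mollify k u x) * inner ℝ (ψ x • b x) ((mollify k g - g) x)) +
          ∫ x, deriv θ (mollify k u x) * inner ℝ (ψ x • b x) (g x) := by
      intro k
      have i4 := iθ (hus k).continuous.aestronglyMeasurable
      have i5 : Integrable fun x =>
          deriv θ (mollify k u x) * inner ℝ (ψ x • b x) ((mollify k g - g) x) := by
        refine ((i2 k).sub i4).congr (Eventually.of_forall fun x => ?_)
        simp only [Pi.sub_apply, inner_sub_right]
        ring
      rw [← integral_add i5 i4]
      refine integral_congr_ae (Eventually.of_forall fun x => ?_)
      simp only [Pi.sub_apply, inner_sub_right]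
      ring
    simp_rw [e]
    rw [← zero_add (∫ x, deriv θ (u x) * inner ℝ (ψ x • b x) (g x))]
    refine Tendsto.add ?_ ?_
    · refine tendsto_integral_zero_of_le (v := fun k => mollify k g - g) C
        (fun k => (hgc k).aestronglyMeasurable.sub hg.1) hψb
        (tendsto_eLpNorm_mollify_sub one_le_two (by simp) hg) fun k x => ?_
      rw [abs_mul, mul_comm ‖_‖]
      exact mul_le_mul (hC _) (norm_inner_le_norm (𝕜 := ℝ) _ _) (abs_nonneg _)
        ((abs_nonneg _).trans (hC 0))
    · refine tendsto_integral_of_dominated_convergence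
        (fun x => C * ‖inner ℝ (ψ x • b x) (g x)‖)
        (fun k => (iθ (hus k).continuous.aestronglyMeasurable).1) (iψ.norm.const_mul C)
        (fun k => Eventually.of_forall fun x => ?_) ?_
      · rw [norm_mul]
        exact mul_le_mul_of_nonneg_right (hC _) (norm_nonneg _)
      · filter_upwards [ae_tendsto_mollify hul] with x hx
        exact ((hθ'c.tendsto _).comp hx).mul_const _
  have hlim := tendsto_nhds_unique (t1.add t2) (by simp_rw [hk]; exact t3.neg)
  have i6 := iθ hu.1
  have i7 := integrable_comp_mul hθd hC hu hψm hψm1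
  rw [eq_neg_iff_add_eq_zero] at hlim
  rw [eq_neg_iff_add_eq_zero, ← hlim, add_assoc, ← integral_add i6 i7]
  congr 1
  refine integral_congr_ae (Eventually.of_forall fun x => ?_)
  simp only [inner_smul_left, conj_trivial, smul_eq_mul, real_inner_comm (b x)]
  ring

end ProductRule

/-! ### The chain rule for primitives of integrable functions -/

theorem absolutelyContinuousOnInterval_comp {f θ : ℝ → ℝ} {a b C : ℝ}
    (hf : AbsolutelyContinuousOnInterval f a b) (hθ : ∀ s t, |θ s - θ t| ≤ C * |s - t|) :
    AbsolutelyContinuousOnInterval (fun t => θ (f t)) a b := by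
  have h := Tendsto.const_mul C hf
  rw [mul_zero] at h
  refine squeeze_zero (fun _ => Finset.sum_nonneg fun _ _ => dist_nonneg) (fun E => ?_) h
  rw [Finset.mul_sum]
  exact Finset.sum_le_sum fun i _ => hθ _ _

/-- The chain rule for a function `V` which is, on `[a, b]`, a primitive of an integrable function
`q`. -/
theorem comp_sub_comp_eq_integral {V q θ : ℝ → ℝ} {a b C : ℝ} (hab : a ≤ b)
    (hq : IntervalIntegrable q volume a b) (hV : ∀ t ∈ Icc a b, V t - V a = ∫ τ in a..t, q τ)
    (hθ : Differentiable ℝ θ) (hC : ∀ s, |deriv θ s| ≤ C) :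
    θ (V b) - θ (V a) = ∫ τ in a..b, deriv θ (V τ) * q τ := by
  have hP : AbsolutelyContinuousOnInterval (fun t => ∫ τ in a..t, q τ) a b :=
    hq.absolutelyContinuousOnInterval_intervalIntegral left_mem_uIcc
  have hac := absolutelyContinuousOnInterval_comp (θ := fun s => θ (V a + s)) (C := C) hP
    (fun s t => by
      have := abs_comp_sub_le hθ hC (V a + s) (V a + t)
      rwa [add_sub_add_left_eq_sub] at this)
  have h := hac.integral_deriv_eq_sub
  simp only [intervalIntegral.integral_same, add_zero] at h
  rw [← hV b (right_mem_Icc.2 hab), add_sub_cancel] at h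
  rw [← h]
  refine intervalIntegral.integral_congr_ae ?_
  filter_upwards [hq.ae_hasDerivAt_integral] with t ht hmem
  have hmem' : t ∈ uIcc a b := uIoc_subset_uIcc hmem
  have h1 := (ht hmem' a left_mem_uIcc)
  have h2 : HasDerivAt (fun s => θ (V a + ∫ τ in a..s, q τ)) (deriv θ (V t) * q t) t := by
    rw [uIcc_of_le hab] at hmem'
    have h3 : V t = V a + ∫ τ in a..t, q τ := by rw [← hV t hmem']; ring
    rw [h3]
    exact (hθ _).hasDerivAt.comp t (h1.const_add (V a))
  exact h2.deriv

/-! ### Limits of mollified integrands -/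

section Limits

variable {d : ℕ}

/-- If `f k → f` in `L¹` and the bounded functions `c k` converge a.e. to `c`, then
`∫ c k * f k → ∫ c * f`. -/
theorem tendsto_integral_mul_of_L1 {c : ℕ → Space d → ℝ} {c' : Space d → ℝ}
    {f : ℕ → Space d → ℝ} {f' : Space d → ℝ} {C : ℝ}
    (hcm : ∀ k, AEStronglyMeasurable (c k)) (hcC : ∀ k x, |c k x| ≤ C)
    (hc : ∀ᵐ x, Tendsto (fun k => c k x) atTop (𝓝 (c' x)))
    (hf : ∀ k, Integrable (f k)) (hf' : Integrable f')
    (hff : Tendsto (fun k => eLpNorm (f k - f') 1 volume) atTop (𝓝 0)) :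
    Tendsto (fun k => ∫ x, c k x * f k x) atTop (𝓝 (∫ x, c' x * f' x)) := by
  have i1 : ∀ k, Integrable fun x => c k x * (f k - f') x := fun k =>
    ((hf k).sub hf').bdd_mul (hcm k) (Eventually.of_forall (hcC k))
  have i2 : ∀ k, Integrable fun x => c k x * f' x := fun k =>
    hf'.bdd_mul (hcm k) (Eventually.of_forall (hcC k))
  have e : ∀ k, ∫ x, c k x * f k x = (∫ x, c k x * (f k - f') x) + ∫ x, c k x * f' x := by
    intro k
    rw [← integral_add (i1 k) (i2 k)]
    refine integral_congr_ae (Eventually.of_forall fun x => ?_)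
    simp only [Pi.sub_apply]
    ring
  simp_rw [e]
  rw [← zero_add (∫ x, c' x * f' x)]
  refine Tendsto.add ?_ ?_
  · have h := tendsto_integral_of_L1' (F := fun k x => c k x * (f k - f') x) (fun _ => (0 : ℝ))
      aestronglyMeasurable_const (Eventually.of_forall i1) (l := atTop) ?_
    · simpa using h
    · have h2 := ENNReal.Tendsto.const_mul (a := ENNReal.ofReal C) hff
        (Or.inr ENNReal.ofReal_ne_top)
      rw [mul_zero] at h2
      refine tendsto_of_tendsto_of_tendsto_of_le_of_le tendsto_const_nhds h2 (fun _ => zero_le)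
        fun k => ?_
      refine eLpNorm_le_mul_eLpNorm_of_ae_le_mul (Eventually.of_forall fun x => ?_) 1
      simp only [Pi.sub_apply, sub_zero, norm_mul]
      exact mul_le_mul_of_nonneg_right (hcC k x) (norm_nonneg _)
  · refine tendsto_integral_of_dominated_convergence (fun x => C * ‖f' x‖) (fun k => (i2 k).1)
      (hf'.norm.const_mul C) (fun k => Eventually.of_forall fun x => ?_) ?_
    · rw [norm_mul]
      exact mul_le_mul_of_nonneg_right (hcC k x) (norm_nonneg _)
    · filter_upwards [hc] with x hx
      exact hx.mul_const _

theorem integrable_mollify {F : Type*} [NormedAddCommGroup F] [NormedSpace ℝ F] [CompleteSpace F]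
    (k : ℕ) {f : Space d → F} (hf : Integrable f) : Integrable (mollify k f) :=
  (integrable_mollifier k).integrable_convolution _ hf

theorem integral_norm_mollify_le {F : Type*} [NormedAddCommGroup F] [NormedSpace ℝ F]
    [CompleteSpace F] (k : ℕ) {f : Space d → F} (hf : Integrable f) :
    ∫ x, ‖mollify k f x‖ ≤ ∫ x, ‖f x‖ := by
  have h1 : ∫ x, mollify k (fun y => ‖f y‖) x = ∫ x, ‖f x‖ := by
    rw [mollify, integral_convolution _ (integrable_mollifier k) hf.norm, integral_mollifier]
    simp
  rw [← h1]
  refine integral_mono (integrable_mollify k hf).norm (integrable_mollify k hf.norm) fun x => ?_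
  simp only [mollify_apply]
  refine (norm_integral_le_integral_norm _).trans (le_of_eq ?_)
  simp only [norm_smul, Real.norm_of_nonneg (mollifier_nonneg k _), smul_eq_mul]

/-- Integration by parts for the divergence of a mollified vector field. -/
theorem integral_mul_divergence_mollify (k : ℕ) {g : Space d → Space d} (hg : Integrable g)
    {η : Space d → ℝ} (hη : ContDiff ℝ 1 η) (hc : HasCompactSupport η) :
    ∫ x, η x * ∫ y, inner ℝ (g y) (∇ (mollifier d k) (x - y)) =
      -∫ x, inner ℝ (mollify k g x) (∇ η x) := by
  have hρ : ContDiff ℝ 1 (mollifier d k) := (contDiff_mollifier k).of_le (by simp)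
  have hρg := continuous_gradient hρ
  have hηg := continuous_gradient hη
  obtain ⟨A, hA⟩ := hρg.bounded_above_of_compact_support
    (hasCompactSupport_gradient (hasCompactSupport_mollifier k))
  obtain ⟨A', hA'⟩ := hρ.continuous.bounded_above_of_compact_support (hasCompactSupport_mollifier k)
  have hηi : Integrable η := hη.continuous.integrable_of_hasCompactSupport hc
  have hηgi : Integrable (∇ η) := hηg.integrable_of_hasCompactSupport (hasCompactSupport_gradient hc)
  have hgs : AEStronglyMeasurable (fun z : Space d × Space d => g z.2) (volume.prod volume) :=
    hg.1.comp_quasiMeasurePreserving Measure.quasiMeasurePreserving_snd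
  have i1 : Integrable (fun z : Space d × Space d =>
      η z.1 * inner ℝ (g z.2) (∇ (mollifier d k) (z.1 - z.2))) (volume.prod volume) := by
    refine ((hηi.norm.mul_prod hg.norm).const_mul A).mono' ?_ (Eventually.of_forall fun z => ?_)
    · exact (hη.continuous.comp continuous_fst).aestronglyMeasurable.mul
        (hgs.inner (hρg.comp (continuous_fst.sub continuous_snd)).aestronglyMeasurable)
    · rw [norm_mul]
      have h1 := norm_inner_le_norm (𝕜 := ℝ) (g z.2) (∇ (mollifier d k) (z.1 - z.2))
      have h2 := mul_le_mul_of_nonneg_left (hA (z.1 - z.2)) (norm_nonneg (g z.2))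
      have h3 := mul_le_mul_of_nonneg_left (h1.trans h2) (norm_nonneg (η z.1))
      linarith
  have i2 : Integrable (fun z : Space d × Space d =>
      inner ℝ (mollifier d k (z.1 - z.2) • g z.2) (∇ η z.1)) (volume.prod volume) := by
    refine ((hηgi.norm.mul_prod hg.norm).const_mul A').mono' ?_ (Eventually.of_forall fun z => ?_)
    · exact ((hρ.continuous.comp (continuous_fst.sub continuous_snd)).aestronglyMeasurable.smul
        hgs).inner (hηg.comp continuous_fst).aestronglyMeasurable
    · have h1 := norm_inner_le_norm (𝕜 := ℝ) (mollifier d k (z.1 - z.2) • g z.2) (∇ η z.1)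
      rw [norm_smul] at h1
      have h2 := mul_le_mul_of_nonneg_right (hA' (z.1 - z.2))
        (mul_nonneg (norm_nonneg (g z.2)) (norm_nonneg (∇ η z.1)))
      linarith
  have e1 : ∀ x, η x * ∫ y, inner ℝ (g y) (∇ (mollifier d k) (x - y)) =
      ∫ y, η x * inner ℝ (g y) (∇ (mollifier d k) (x - y)) := fun x =>
    (integral_const_mul _ _).symm
  have e2 : ∀ x, inner ℝ (mollify k g x) (∇ η x) =
      ∫ y, inner ℝ (mollifier d k (x - y) • g y) (∇ η x) := fun x => by
    have hi : Integrable fun y => mollifier d k (x - y) • g y :=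
      hg.bdd_smul A'
        (hρ.continuous.comp (continuous_const.sub continuous_id)).aestronglyMeasurable
        (Eventually.of_forall fun y => hA' (x - y))
    rw [mollify_apply_swap, real_inner_comm, ← integral_inner hi]
    simp_rw [real_inner_comm]
  have hsw := integral_integral_swap
    (f := fun x y => inner ℝ (mollifier d k (x - y) • g y) (∇ η x)) i2
  simp_rw [e1, e2]
  rw [integral_integral_swap i1, hsw, ← integral_neg]
  refine integral_congr_ae (Eventually.of_forall fun y => ?_)
  have hs : ContDiff ℝ 1 fun x => mollifier d k (x - y) := hρ.comp (contDiff_id.sub contDiff_const)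
  have hsc : HasCompactSupport fun x => mollifier d k (x - y) :=
    (hasCompactSupport_mollifier k).comp_homeomorph (Homeomorph.subRight y)
  have h := integral_smul_gradient_eq_neg hη hs hsc
  simp_rw [gradient_comp_sub_right] at h
  have i3 : Integrable fun x => η x • ∇ (mollifier d k) (x - y) :=
    (hη.continuous.smul (hρg.comp (continuous_id.sub continuous_const))).integrable_of_hasCompactSupport
      hc.smul_right
  have i4 : Integrable fun x => mollifier d k (x - y) • ∇ η x :=
    (hs.continuous.smul hηg).integrable_of_hasCompactSupport hsc.smul_right
  have h' := congrArg (fun v => inner ℝ (g y) v) h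
  simp only [inner_neg_right] at h'
  rw [← integral_inner i3, ← integral_inner i4] at h'
  simpa only [inner_smul_right, inner_smul_left, conj_trivial] using h'

end Limits

/-! ### The renormalized inequality -/

section Renormalize

variable {d : ℕ}

/-- The right-hand side `div g + F`, mollified at scale `1 / (k + 1)`. -/
def mollifiedRhs (k : ℕ) (g : Space d → Space d) (F : Space d → ℝ) (x : Space d) : ℝ :=
  ∫ y, (mollifier d k (x - y) * F y + inner ℝ (∇ (mollifier d k) (x - y)) (g y))

theorem integrable_gradient_mollifier (k : ℕ) : Integrable (∇ (mollifier d k)) :=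
  (continuous_gradient ((contDiff_mollifier k).of_le (by simp))).integrable_of_hasCompactSupport
    (hasCompactSupport_gradient (hasCompactSupport_mollifier k))

theorem exists_mollifier_bound (d k : ℕ) :
    ∃ A, (∀ x : Space d, ‖mollifier d k x‖ ≤ A) ∧ ∀ x : Space d, ‖∇ (mollifier d k) x‖ ≤ A := by
  obtain ⟨A, hA⟩ := (continuous_mollifier (d := d) k).bounded_above_of_compact_support
    (hasCompactSupport_mollifier k)
  obtain ⟨B, hB⟩ := (continuous_gradient ((contDiff_mollifier (d := d) k).of_le
    (by simp))).bounded_above_of_compact_support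
    (hasCompactSupport_gradient (hasCompactSupport_mollifier k))
  exact ⟨max A B, fun x => (hA x).trans (le_max_left _ _), fun x => (hB x).trans (le_max_right _ _)⟩

theorem mollifiedRhs_eq (k : ℕ) {g : Space d → Space d} {F : Space d → ℝ} (hg : Integrable g)
    (hF : Integrable F) (x : Space d) :
    mollifiedRhs k g F x = mollify k F x + ∫ y, inner ℝ (g y) (∇ (mollifier d k) (x - y)) := by
  obtain ⟨A, hA, hB⟩ := exists_mollifier_bound d k
  have hc : Continuous fun y => x - y := continuous_const.sub continuous_id
  have i1 : Integrable fun y => mollifier d k (x - y) * F y :=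
    hF.bdd_mul ((continuous_mollifier k).comp hc).aestronglyMeasurable
      (Eventually.of_forall fun y => hA (x - y))
  have i2 : Integrable fun y => inner ℝ (∇ (mollifier d k) (x - y)) (g y) := by
    refine (hg.norm.const_mul A).mono' ((((continuous_gradient ((contDiff_mollifier k).of_le
      (by simp))).comp hc).aestronglyMeasurable).inner hg.1) (Eventually.of_forall fun y => ?_)
    exact (norm_inner_le_norm _ _).trans (mul_le_mul_of_nonneg_right (hB _) (norm_nonneg _))
  rw [mollifiedRhs, integral_add i1 i2, mollify_apply_swap]
  simp_rw [real_inner_comm, smul_eq_mul]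

/-- The renormalized equation at a fixed time: `θ'(U) ΔU ≤ Δ θ(U)` for convex `θ`, in weak form. -/
theorem integral_mul_mollifiedRhs_le (k : ℕ) {u F ψ : Space d → ℝ} {g : Space d → Space d}
    {θ : ℝ → ℝ} (hu : LocallyIntegrable u) (hg : Integrable g) (hF : Integrable F)
    (hθ : ContDiff ℝ ∞ θ) (hmono : Monotone (deriv θ)) (hψ : ContDiff ℝ ∞ ψ)
    (hc : HasCompactSupport ψ) (hψ0 : ∀ x, 0 ≤ ψ x)
    (hgr : ∀ x ∈ tsupport ψ, ∇ (mollify k u) x = mollify k g x) (s s' : ℝ) :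
    ∫ x, ψ x * deriv θ (mollify k u x - s) * (mollifiedRhs k g F x - s') ≤
      ∫ x, deriv θ (mollify k u x - s) *
        (ψ x * (mollify k F x - s') - inner ℝ (mollify k g x) (∇ ψ x)) := by
  set U := mollify k u with hU
  have hUs : ContDiff ℝ ∞ U := contDiff_mollify k hu
  have hθ' : ContDiff ℝ ∞ (deriv θ) := (contDiff_infty_iff_deriv.1 hθ).2
  have hv : ContDiff ℝ ∞ fun x => deriv θ (U x - s) := hθ'.comp (hUs.sub contDiff_const)
  have hη : ContDiff ℝ ∞ fun x => ψ x * deriv θ (U x - s) := hψ.mul hv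
  have hηc : HasCompactSupport fun x => ψ x * deriv θ (U x - s) :=
    hc.mul_right (f' := fun x => deriv θ (U x - s))
  have hgc : Continuous (mollify k g) := (contDiff_mollify k hg.locallyIntegrable).continuous
  have hFc : Continuous (mollify k F) := (contDiff_mollify k hF.locallyIntegrable).continuous
  have hψg := (contDiff_gradient hψ).continuous
  have hdiv := integral_mul_divergence_mollify k hg (hη.of_le (by simp)) hηc
  have e1 : ∀ x, ψ x * deriv θ (U x - s) * (mollifiedRhs k g F x - s') =
      ψ x * deriv θ (U x - s) * (mollify k F x - s') +
      ψ x * deriv θ (U x - s) * ∫ y, inner ℝ (g y) (∇ (mollifier d k) (x - y)) := fun x => by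
    rw [mollifiedRhs_eq k hg hF]
    ring
  have i1 : Integrable fun x => ψ x * deriv θ (U x - s) * (mollify k F x - s') :=
    (hη.continuous.mul (hFc.sub continuous_const)).integrable_of_hasCompactSupport
      (hηc.mul_right (f' := fun x => mollify k F x - s'))
  have i2 : Integrable fun x =>
      ψ x * deriv θ (U x - s) * ∫ y, inner ℝ (g y) (∇ (mollifier d k) (x - y)) := by
    have h : Integrable fun x => ∫ y, inner ℝ (g y) (∇ (mollifier d k) (x - y)) :=
      hg.integrable_convolution (innerSL ℝ) (integrable_gradient_mollifier k)
    obtain ⟨B, hB⟩ := hη.continuous.bounded_above_of_compact_support hηc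
    exact h.bdd_mul hη.continuous.aestronglyMeasurable (Eventually.of_forall hB)
  have i3 : Integrable fun x => deriv θ (U x - s) * inner ℝ (mollify k g x) (∇ ψ x) := by
    refine (hv.continuous.mul (hgc.inner hψg)).integrable_of_hasCompactSupport ?_
    refine (hasCompactSupport_gradient hc).mono fun x hx => ?_
    intro h0
    exact hx (by simp only [Pi.mul_apply, h0, inner_zero_right, mul_zero])
  have i4 : Integrable fun x => inner ℝ (mollify k g x)
      (∇ (fun x => ψ x * deriv θ (U x - s)) x) := by
    refine (hgc.inner (contDiff_gradient hη).continuous).integrable_of_hasCompactSupport ?_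
    refine (hasCompactSupport_gradient hηc).mono fun x hx => ?_
    intro h0
    exact hx (by simp only [h0, inner_zero_right])
  simp_rw [e1, mul_sub (deriv θ _)]
  have i5 : Integrable fun x => deriv θ (U x - s) * (ψ x * (mollify k F x - s')) := by
    refine i1.congr (Eventually.of_forall fun x => ?_)
    simp only
    ring
  rw [integral_add i1 i2, hdiv, integral_sub i5 i3, sub_eq_add_neg]
  -- Integration by parts leaves the term `-∫ ψ θ''(U) ‖∇U‖²`, which has the right sign.
  refine add_le_add (le_of_eq ?_) (neg_le_neg (integral_mono i3 i4 fun x => ?_))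
  · refine integral_congr_ae (Eventually.of_forall fun x => ?_)
    simp only
    ring
  · simp only
    by_cases hx : x ∈ tsupport ψ
    · rw [gradient_mul (hψ.differentiable (by simp) x) (hv.differentiable (by simp) x),
        gradient_comp (u := fun x => U x - s) (θ := deriv θ)
          ((hθ'.differentiable (by simp) _).hasDerivAt)
          ((hUs.sub contDiff_const).differentiable (by simp) x)]
      have hgs : ∇ (fun y => U y - s) x = mollify k g x := by
        rw [← hgr x hx]
        simp [gradient, fderiv_sub_const]
      rw [hgs, inner_add_right, inner_smul_right, inner_smul_right, inner_smul_right,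
        real_inner_self_eq_norm_sq]
      have := hmono.deriv_nonneg (x := U x - s)
      have := hψ0 x
      nlinarith [mul_nonneg (mul_nonneg (hψ0 x) (hmono.deriv_nonneg (x := U x - s)))
        (sq_nonneg ‖mollify k g x‖)]
    · rw [gradient_eq_zero_of_notMem_tsupport hx, gradient_eq_zero_of_notMem_tsupport
        (ψ := fun x => ψ x * deriv θ (U x - s)) fun h => hx (tsupport_mul_subset_left h)]
      simp

end Renormalize

section Entropy

variable {d : ℕ}

theorem integrable_mollify_param {X F : Type*} [MeasurableSpace X] {μ : Measure X} [SFinite μ]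
    [NormedAddCommGroup F] [NormedSpace ℝ F] [CompleteSpace F] (k : ℕ) {w : X → Space d → F}
    (hw : Integrable (Function.uncurry w) (μ.prod volume)) :
    Integrable (fun z : X × Space d => mollify k (w z.1) z.2) (μ.prod volume) := by
  have h := (integrable_convolution_param (ContinuousLinearMap.lsmul ℝ ℝ) hw
    (integrable_mollifier (d := d) k)).integral_prod_left
  refine h.congr (Eventually.of_forall fun z => ?_)
  simp only [mollify_apply_swap]
  rfl

theorem integrable_mollifiedRhs_param {X : Type*} [MeasurableSpace X] {μ : Measure X} [SFinite μ]
    (k : ℕ) {g : X → Space d → Space d} {F : X → Space d → ℝ}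
    (hg : Integrable (Function.uncurry g) (μ.prod volume))
    (hF : Integrable (Function.uncurry F) (μ.prod volume)) :
    Integrable (fun z : X × Space d => mollifiedRhs k (g z.1) (F z.1) z.2) (μ.prod volume) := by
  have h1 := integrable_convolution_param (ContinuousLinearMap.lsmul ℝ ℝ) hF
    (integrable_mollifier (d := d) k)
  have h2 := integrable_convolution_param (innerSL ℝ) hg (integrable_gradient_mollifier (d := d) k)
  exact (h1.add h2).integral_prod_left

/-- On the time interval `(a, b]` and the ball of radius `R`, `u` solves `∂ₜ u = div g + F`
weakly, and `g` is the weak spatial gradient of `u`. Only test functions supported in the ball are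
admitted, so that `g` and `F` may be truncated outside of it. -/
structure IsLocalSolution (a b R : ℝ) (u : ℝ → Space d → ℝ) (g : ℝ → Space d → Space d)
    (F : ℝ → Space d → ℝ) : Prop where
  integrable : ∀ t ∈ Icc a b, Integrable (u t)
  integrable_uncurry : Integrable (Function.uncurry u) ((volume.restrict (Ioc a b)).prod volume)
  integrable_gradient : Integrable (Function.uncurry g) ((volume.restrict (Ioc a b)).prod volume)
  integrable_source : Integrable (Function.uncurry F) ((volume.restrict (Ioc a b)).prod volume)
  gradient : ∀ᵐ τ ∂(volume.restrict (Ioc a b)), ∀ η : Space d → ℝ, ContDiff ℝ ∞ η →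
    HasCompactSupport η → tsupport η ⊆ Metric.ball 0 R →
      ∫ x, u τ x • ∇ η x = -∫ x, η x • g τ x
  equation : ∀ η : Space d → ℝ, ContDiff ℝ ∞ η → HasCompactSupport η →
    tsupport η ⊆ Metric.ball 0 R → ∀ t ∈ Icc a b,
      (∫ x, u t x * η x) - ∫ x, u a x * η x =
        ∫ τ in a..t, ∫ x, (F τ x * η x - inner ℝ (g τ x) (∇ η x))

variable {a b R : ℝ} {u F : ℝ → Space d → ℝ} {g : ℝ → Space d → Space d}

/-- Testing the equation with the mollifier centred at `x`. -/
theorem IsLocalSolution.mollify_sub_eq (h : IsLocalSolution a b R u g F) {k : ℕ} {x : Space d}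
    (hx : ‖x‖ + 1 / ((k : ℝ) + 1) < R) {t : ℝ} (ht : t ∈ Icc a b) :
    mollify k (u t) x - mollify k (u a) x = ∫ τ in a..t, mollifiedRhs k (g τ) (F τ) x := by
  have := h.equation (fun y => mollifier d k (x - y))
    ((contDiff_mollifier k).comp (contDiff_const.sub contDiff_id))
    ((hasCompactSupport_mollifier k).comp_homeomorph (Homeomorph.subLeft x))
    (tsupport_mollifier_sub_subset hx) t ht
  simp_rw [gradient_mollifier_sub, inner_neg_right, sub_neg_eq_add] at this
  rw [mollify_apply_swap, mollify_apply_swap]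
  simp_rw [smul_eq_mul, mul_comm (mollifier d k _)]
  rw [this]
  unfold mollifiedRhs
  simp_rw [real_inner_comm, mul_comm (F _ _)]

variable {y y' : ℝ → ℝ} {θ : ℝ → ℝ} {ψ : Space d → ℝ}

/-- The renormalized inequality for the mollified solution, which is differentiable in time almost
everywhere and smooth in space. -/
theorem IsLocalSolution.integral_comp_mollify_sub_le (h : IsLocalSolution a b R u g F)
    (hab : a ≤ b) (hy : ∀ t ∈ Icc a b, HasDerivAt y (y' t) t) (hy' : ContinuousOn y' (Icc a b))
    (hθ : ContDiff ℝ ∞ θ) (hθ1 : ∀ s, |deriv θ s| ≤ 1) (hmono : Monotone (deriv θ))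
    (hψ : ContDiff ℝ ∞ ψ) (hc : HasCompactSupport ψ) (hψ0 : ∀ x, 0 ≤ ψ x) {k : ℕ}
    (hsupp : ∀ x ∈ tsupport ψ, ‖x‖ + 1 / ((k : ℝ) + 1) < R) :
    ∫ x, ψ x * (θ (mollify k (u b) x - y b) - θ (mollify k (u a) x - y a)) ≤
      ∫ τ in Ioc a b, ∫ x, deriv θ (mollify k (u τ) x - y τ) *
        (ψ x * (mollify k (F τ) x - y' τ) - inner ℝ (mollify k (g τ) x) (∇ ψ x)) := by
  set μ : Measure ℝ := volume.restrict (Ioc a b) with hμ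
  have hyc : ContinuousOn y (Icc a b) := fun t ht => (hy t ht).continuousAt.continuousWithinAt
  have hym : AEStronglyMeasurable y μ :=
    (hyc.mono Ioc_subset_Icc_self).aestronglyMeasurable measurableSet_Ioc
  have hy'i : Integrable y' μ := (hy'.integrableOn_Icc).mono_set Ioc_subset_Icc_self
  have hU := integrable_mollify_param k h.integrable_uncurry
  have hG := integrable_mollify_param k h.integrable_gradient
  have hFk := integrable_mollify_param k h.integrable_source
  have hQ := integrable_mollifiedRhs_param k h.integrable_gradient h.integrable_source
  have hθ' : Continuous (deriv θ) := hθ.continuous_deriv (by simp)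
  have hcm : AEStronglyMeasurable
      (fun z : ℝ × Space d => deriv θ (mollify k (u z.1) z.2 - y z.1)) (μ.prod volume) :=
    hθ'.comp_aestronglyMeasurable (hU.1.sub
      (hym.comp_quasiMeasurePreserving Measure.quasiMeasurePreserving_fst))
  obtain ⟨A, hA⟩ := hψ.continuous.bounded_above_of_compact_support hc
  have hψg := (contDiff_gradient hψ).continuous
  obtain ⟨A', hA'⟩ := hψg.bounded_above_of_compact_support (hasCompactSupport_gradient hc)
  have hψi : Integrable ψ := hψ.continuous.integrable_of_hasCompactSupport hc
  have hψm : AEStronglyMeasurable (fun z : ℝ × Space d => ψ z.2) (μ.prod volume) :=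
    (hψ.continuous.comp continuous_snd).aestronglyMeasurable
  have i0 : Integrable (fun z : ℝ × Space d => ψ z.2 * y' z.1) (μ.prod volume) := by
    refine (hy'i.mul_prod hψi).congr (Eventually.of_forall fun z => ?_)
    exact mul_comm _ _
  have i1 : Integrable (fun z : ℝ × Space d => deriv θ (mollify k (u z.1) z.2 - y z.1) *
      (ψ z.2 * (mollifiedRhs k (g z.1) (F z.1) z.2 - y' z.1))) (μ.prod volume) := by
    refine Integrable.bdd_mul ?_ hcm (Eventually.of_forall fun z => hθ1 _)
    simp_rw [mul_sub]
    exact (hQ.bdd_mul hψm (Eventually.of_forall fun z => hA _)).sub i0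
  have i2 : Integrable (fun z : ℝ × Space d => deriv θ (mollify k (u z.1) z.2 - y z.1) *
      (ψ z.2 * (mollify k (F z.1) z.2 - y' z.1) - inner ℝ (mollify k (g z.1) z.2) (∇ ψ z.2)))
      (μ.prod volume) := by
    refine Integrable.bdd_mul ?_ hcm (Eventually.of_forall fun z => hθ1 _)
    simp_rw [mul_sub]
    refine ((hFk.bdd_mul hψm (Eventually.of_forall fun z => hA _)).sub i0).sub ?_
    refine (hG.norm.const_mul A').mono'
      (hG.1.inner (hψg.comp continuous_snd).aestronglyMeasurable)
      (Eventually.of_forall fun z => (norm_inner_le_norm _ _).trans ?_)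
    rw [mul_comm A']
    exact mul_le_mul_of_nonneg_left (hA' _) (norm_nonneg _)
  -- The chain rule in time, at each point.
  have e1 : ∀ᵐ x : Space d, ψ x * (θ (mollify k (u b) x - y b) - θ (mollify k (u a) x - y a)) =
      ∫ τ, deriv θ (mollify k (u τ) x - y τ) *
        (ψ x * (mollifiedRhs k (g τ) (F τ) x - y' τ)) ∂μ := by
    filter_upwards [hQ.prod_left_ae] with x hx
    by_cases hxs : x ∈ tsupport ψ
    · have hx' := hsupp x hxs
      have hq : IntervalIntegrable (fun τ => mollifiedRhs k (g τ) (F τ) x - y' τ) volume a b :=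
        (intervalIntegrable_iff_integrableOn_Ioc_of_le hab).2 (hx.sub hy'i)
      have hV : ∀ t ∈ Icc a b, (mollify k (u t) x - y t) - (mollify k (u a) x - y a) =
          ∫ τ in a..t, (mollifiedRhs k (g τ) (F τ) x - y' τ) := by
        intro t ht
        have hsub : Ioc a t ⊆ Ioc a b := Ioc_subset_Ioc_right ht.2
        have j1 : IntervalIntegrable (fun τ => mollifiedRhs k (g τ) (F τ) x) volume a t :=
          (intervalIntegrable_iff_integrableOn_Ioc_of_le ht.1).2 (IntegrableOn.mono_set hx hsub)
        have j2 : IntervalIntegrable y' volume a t :=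
          (intervalIntegrable_iff_integrableOn_Ioc_of_le ht.1).2 (IntegrableOn.mono_set hy'i hsub)
        rw [intervalIntegral.integral_sub j1 j2, ← h.mollify_sub_eq hx' ht,
          intervalIntegral.integral_eq_sub_of_hasDerivAt (f := y) (fun s hs => hy s ?_) j2]
        · ring
        · rw [uIcc_of_le ht.1] at hs
          exact ⟨hs.1, hs.2.trans ht.2⟩
      rw [comp_sub_comp_eq_integral (V := fun t => mollify k (u t) x - y t) hab hq hV
        (hθ.differentiable (by simp)) hθ1, intervalIntegral.integral_of_le hab,
        ← integral_const_mul]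
      refine integral_congr_ae (Eventually.of_forall fun τ => ?_)
      simp only
      ring
    · have : ψ x = 0 := image_eq_zero_of_notMem_tsupport hxs
      simp [this]
  rw [integral_congr_ae e1, ← integral_integral_swap (f := fun τ x =>
    deriv θ (mollify k (u τ) x - y τ) * (ψ x * (mollifiedRhs k (g τ) (F τ) x - y' τ))) i1]
  refine integral_mono_ae i1.integral_prod_left i2.integral_prod_left ?_
  filter_upwards [h.gradient, h.integrable_gradient.prod_right_ae,
    h.integrable_source.prod_right_ae, h.integrable_uncurry.prod_right_ae] with τ h1 h2 h3 h4
  have := integral_mul_mollifiedRhs_le k (Integrable.locallyIntegrable h4) h2 h3 hθ hmono hψ hc hψ0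
    (fun x hx => gradient_mollify (Integrable.locallyIntegrable h4) h1 (hsupp x hx)) (y τ) (y' τ)
  refine (le_of_eq ?_).trans this
  refine integral_congr_ae (Eventually.of_forall fun x => ?_)
  simp only [Function.uncurry]
  ring

theorem tendsto_integral_mul_comp_mollify {w : Space d → ℝ} (hw : Integrable w)
    (hθ : Differentiable ℝ θ) (hθ1 : ∀ s, |deriv θ s| ≤ 1)
    (hψ : Continuous ψ) (hc : HasCompactSupport ψ) (s : ℝ) :
    Tendsto (fun k => ∫ x, ψ x * θ (mollify k w x - s)) atTop
      (𝓝 (∫ x, ψ x * θ (w x - s))) ∧ Integrable (fun x => ψ x * θ (w x - s)) ∧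
      ∀ k, Integrable fun x => ψ x * θ (mollify k w x - s) := by
  obtain ⟨A, hA⟩ := hψ.bounded_above_of_compact_support hc
  have hψi : Integrable ψ := hψ.integrable_of_hasCompactSupport hc
  have key : ∀ v : Space d → ℝ, Integrable v → Integrable fun x => ψ x * θ (v x - s) := by
    intro v hv
    refine ((hψi.norm.const_mul (|θ (-s)|)).add (hv.norm.const_mul A)).mono'
      (hψ.aestronglyMeasurable.mul (hθ.continuous.comp_aestronglyMeasurable
        (hv.1.sub aestronglyMeasurable_const))) (Eventually.of_forall fun x => ?_)
    have h1 := abs_comp_sub_le hθ hθ1 (v x - s) (-s)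
    have h2 := abs_sub_abs_le_abs_sub (θ (v x - s)) (θ (-s))
    have h3 : |θ (v x - s)| ≤ |θ (-s)| + |v x| := by
      have : v x - s - -s = v x := by ring
      rw [this] at h1
      linarith
    simp only [Pi.add_apply, norm_mul, Real.norm_eq_abs]
    have h4 := mul_le_mul_of_nonneg_left h3 (abs_nonneg (ψ x))
    have h5 := mul_le_mul_of_nonneg_right (hA x) (abs_nonneg (v x))
    rw [Real.norm_eq_abs] at h5
    linarith
  refine ⟨?_, key w hw, fun k => key _ (integrable_mollify k hw)⟩
  refine tendsto_integral_of_L1' _ (key w hw).1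
    (Eventually.of_forall fun k => key _ (integrable_mollify k hw)) ?_
  have h2 := ENNReal.Tendsto.const_mul (a := ENNReal.ofReal A)
    (tendsto_eLpNorm_mollify_sub le_rfl ENNReal.one_ne_top (memLp_one_iff_integrable.2 hw))
    (Or.inr ENNReal.ofReal_ne_top)
  rw [mul_zero] at h2
  refine tendsto_of_tendsto_of_tendsto_of_le_of_le tendsto_const_nhds h2 (fun _ => zero_le)
    fun k => ?_
  refine eLpNorm_le_mul_eLpNorm_of_ae_le_mul (Eventually.of_forall fun x => ?_) 1
  simp only [Pi.sub_apply, ← mul_sub, norm_mul]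
  refine mul_le_mul (hA x) ?_ (norm_nonneg _) ((norm_nonneg _).trans (hA x))
  have := abs_comp_sub_le hθ hθ1 (mollify k w x - s) (w x - s)
  rwa [one_mul, sub_sub_sub_cancel_right] at this

/-- The renormalized inequality: for convex `θ` and `∂ₜ u = div g + F`, `g = ∇u`,
`∂ₜ θ(u - y) ≤ Δ θ(u - y) + θ'(u - y) (F - y')` in weak form. -/
theorem IsLocalSolution.integral_comp_sub_le (h : IsLocalSolution a b R u g F)
    (hab : a ≤ b) (hy : ∀ t ∈ Icc a b, HasDerivAt y (y' t) t) (hy' : ContinuousOn y' (Icc a b))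
    (hθ : ContDiff ℝ ∞ θ) (hθ1 : ∀ s, |deriv θ s| ≤ 1) (hmono : Monotone (deriv θ))
    (hψ : ContDiff ℝ ∞ ψ) (hc : HasCompactSupport ψ) (hψ0 : ∀ x, 0 ≤ ψ x)
    {r : ℝ} (hr : r < R) (hsupp : ∀ x ∈ tsupport ψ, ‖x‖ ≤ r) :
    (∫ x, ψ x * θ (u b x - y b)) - ∫ x, ψ x * θ (u a x - y a) ≤
      ∫ τ in Ioc a b, ∫ x, deriv θ (u τ x - y τ) *
        (ψ x * (F τ x - y' τ) - inner ℝ (g τ x) (∇ ψ x)) := by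
  set μ : Measure ℝ := volume.restrict (Ioc a b) with hμ
  obtain ⟨A, hA⟩ := hψ.continuous.bounded_above_of_compact_support hc
  have hψg := (contDiff_gradient hψ).continuous
  obtain ⟨A', hA'⟩ := hψg.bounded_above_of_compact_support (hasCompactSupport_gradient hc)
  have hψi : Integrable ψ := hψ.continuous.integrable_of_hasCompactSupport hc
  have hA0 : 0 ≤ A := (norm_nonneg _).trans (hA 0)
  have hA'0 : 0 ≤ A' := (norm_nonneg _).trans (hA' 0)
  have hθ' : Continuous (deriv θ) := hθ.continuous_deriv (by simp)
  have hyc : ContinuousOn y (Icc a b) := fun t ht => (hy t ht).continuousAt.continuousWithinAt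
  have hym : AEStronglyMeasurable y μ :=
    (hyc.mono Ioc_subset_Icc_self).aestronglyMeasurable measurableSet_Ioc
  have hy'i : Integrable y' μ := (hy'.integrableOn_Icc).mono_set Ioc_subset_Icc_self
  have hψm : AEStronglyMeasurable (fun z : ℝ × Space d => ψ z.2) (μ.prod volume) :=
    (hψ.continuous.comp continuous_snd).aestronglyMeasurable
  have hd := hθ.differentiable (by simp)
  obtain ⟨lb, ib, ibk⟩ := tendsto_integral_mul_comp_mollify (h.integrable b ⟨hab, le_rfl⟩) hd hθ1
    hψ.continuous hc (y b)
  obtain ⟨la, ia, iak⟩ := tendsto_integral_mul_comp_mollify (h.integrable a ⟨le_rfl, hab⟩) hd hθ1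
    hψ.continuous hc (y a)
  have hev : ∀ᶠ k : ℕ in atTop, ∀ x ∈ tsupport ψ, ‖x‖ + 1 / ((k : ℝ) + 1) < R := by
    filter_upwards [tendsto_radius.eventually_lt_const (sub_pos.2 hr)] with k hk x hx
    have := hsupp x hx
    linarith
  refine le_of_tendsto_of_tendsto (lb.sub la) (?_ : Tendsto (fun k => ∫ τ, (∫ x,
    deriv θ (mollify k (u τ) x - y τ) * (ψ x * (mollify k (F τ) x - y' τ) -
      inner ℝ (mollify k (g τ) x) (∇ ψ x))) ∂μ) atTop _) (hev.mono fun k hk => ?_)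
  swap
  · have := h.integral_comp_mollify_sub_le hab hy hy' hθ hθ1 hmono hψ hc hψ0 hk
    simp_rw [mul_sub (ψ _) (θ _)] at this
    rwa [integral_sub (ibk k) (iak k)] at this
  -- Integrability and size of the integrand at a fixed time.
  have hint : ∀ {F₁ : Space d → ℝ} {g₁ : Space d → Space d}, Integrable F₁ → Integrable g₁ →
      ∀ s : ℝ, Integrable fun x => ψ x * (F₁ x - s) - inner ℝ (g₁ x) (∇ ψ x) := by
    intro F₁ g₁ h1 h2 s
    simp_rw [mul_sub]
    refine ((h1.bdd_mul hψ.continuous.aestronglyMeasurable (Eventually.of_forall hA)).sub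
      (hψi.mul_const s)).sub ((h2.norm.const_mul A').mono' (h2.1.inner hψg.aestronglyMeasurable)
      (Eventually.of_forall fun x => (norm_inner_le_norm _ _).trans ?_))
    rw [mul_comm A']
    exact mul_le_mul_of_nonneg_left (hA' _) (norm_nonneg _)
  have hle : ∀ (c f₁ s : ℝ) (v w : Space d) (p : ℝ), |c| ≤ 1 → |p| ≤ A → ‖w‖ ≤ A' →
      ‖c * (p * (f₁ - s) - inner ℝ v w)‖ ≤ A * ‖f₁‖ + |s| * ‖p‖ + A' * ‖v‖ := by
    intro c f₁ s v w p h1 h2 h3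
    have h4 := abs_real_inner_le_norm v w
    have h5 := mul_le_mul_of_nonneg_left h3 (norm_nonneg v)
    have h6 := abs_sub (p * (f₁ - s)) (inner ℝ v w)
    have h7 : |p * (f₁ - s)| ≤ A * |f₁| + |s| * |p| := by
      rw [abs_mul]
      have := mul_le_mul_of_nonneg_left (abs_sub f₁ s) (abs_nonneg p)
      have := mul_le_mul_of_nonneg_right h2 (abs_nonneg f₁)
      nlinarith
    have h8 := mul_le_mul h1 (le_refl |p * (f₁ - s) - inner ℝ v w|) (abs_nonneg _) zero_le_one
    rw [norm_mul]
    simp only [Real.norm_eq_abs] at *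
    linarith
  refine tendsto_integral_of_dominated_convergence (fun τ => A * (∫ x, ‖F τ x‖) +
    |y' τ| * (∫ x, ‖ψ x‖) + A' * ∫ x, ‖g τ x‖) (fun k => ?_) ?_ (fun k => ?_) ?_
  · have hU := integrable_mollify_param k h.integrable_uncurry
    have hG := integrable_mollify_param k h.integrable_gradient
    have hFk := integrable_mollify_param k h.integrable_source
    refine AEStronglyMeasurable.integral_prod_right' (f := fun z : ℝ × Space d =>
      deriv θ (mollify k (u z.1) z.2 - y z.1) * (ψ z.2 * (mollify k (F z.1) z.2 - y' z.1) -
      inner ℝ (mollify k (g z.1) z.2) (∇ ψ z.2))) ?_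
    refine (hθ'.comp_aestronglyMeasurable (hU.1.sub
      (hym.comp_quasiMeasurePreserving Measure.quasiMeasurePreserving_fst))).mul ?_
    exact (hψm.mul (hFk.1.sub (hy'i.1.comp_quasiMeasurePreserving
      Measure.quasiMeasurePreserving_fst))).sub
      (hG.1.inner (hψg.comp continuous_snd).aestronglyMeasurable)
  · exact ((h.integrable_source.norm.integral_prod_left.const_mul A).add
      (hy'i.norm.mul_const _)).add (h.integrable_gradient.norm.integral_prod_left.const_mul A')
  · filter_upwards [h.integrable_gradient.prod_right_ae,
      h.integrable_source.prod_right_ae] with τ (h2 : Integrable (g τ)) (h3 : Integrable (F τ))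
    have j1 := integrable_mollify k h3
    have j2 := integrable_mollify k h2
    refine (norm_integral_le_integral_norm _).trans ((integral_mono_of_nonneg
      (Eventually.of_forall fun _ => norm_nonneg _) (((j1.norm.const_mul A).add
      (hψi.norm.const_mul |y' τ|)).add (j2.norm.const_mul A')) (Eventually.of_forall fun x =>
      hle _ _ _ _ _ _ (hθ1 _) (hA x) (hA' x))).trans ?_)
    have j3 : Integrable fun x => A * ‖mollify k (F τ) x‖ + |y' τ| * ‖ψ x‖ :=
      (j1.norm.const_mul A).add (hψi.norm.const_mul |y' τ|)
    refine (le_of_eq (integral_add j3 (j2.norm.const_mul A'))).trans ?_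
    rw [integral_add (j1.norm.const_mul A) (hψi.norm.const_mul |y' τ|),
      integral_const_mul, integral_const_mul, integral_const_mul]
    have h4 := mul_le_mul_of_nonneg_left (integral_norm_mollify_le k h3) hA0
    have h5 := mul_le_mul_of_nonneg_left (integral_norm_mollify_le k h2) hA'0
    linarith
  · filter_upwards [h.integrable_gradient.prod_right_ae,
      h.integrable_source.prod_right_ae, h.integrable_uncurry.prod_right_ae] with τ h2 h3 h4
    refine tendsto_integral_mul_of_L1 (C := 1) (fun k => ?_) (fun k x => hθ1 _) ?_
      (fun k => hint (integrable_mollify k h3) (integrable_mollify k h2) _) (hint h3 h2 _) ?_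
    · exact (hθ'.comp ((contDiff_mollify k
        (Integrable.locallyIntegrable h4)).continuous.sub continuous_const)).aestronglyMeasurable
    · filter_upwards [ae_tendsto_mollify (Integrable.locallyIntegrable h4)] with x hx
      exact (hθ'.tendsto _).comp (hx.sub_const _)
    · have l1 := ENNReal.Tendsto.const_mul (a := ENNReal.ofReal A)
        (tendsto_eLpNorm_mollify_sub le_rfl ENNReal.one_ne_top (memLp_one_iff_integrable.2 h3))
        (Or.inr ENNReal.ofReal_ne_top)
      have l2 := ENNReal.Tendsto.const_mul (a := ENNReal.ofReal A')
        (tendsto_eLpNorm_mollify_sub le_rfl ENNReal.one_ne_top (memLp_one_iff_integrable.2 h2))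
        (Or.inr ENNReal.ofReal_ne_top)
      have l := l1.add l2
      rw [mul_zero, mul_zero, add_zero] at l
      refine tendsto_of_tendsto_of_tendsto_of_le_of_le tendsto_const_nhds l (fun _ => zero_le)
        fun k => ?_
      have j1 := (integrable_mollify k h3).sub h3
      have j2 := (integrable_mollify k h2).sub h2
      have e : (fun x => ψ x * (mollify k (F τ) x - y' τ) - inner ℝ (mollify k (g τ) x) (∇ ψ x)) -
          (fun x => ψ x * (F τ x - y' τ) - inner ℝ (g τ x) (∇ ψ x)) =
          (fun x => ψ x * (mollify k (F τ) - F τ) x) -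
            fun x => inner ℝ ((mollify k (g τ) - g τ) x) (∇ ψ x) := by
        ext x
        simp only [Pi.sub_apply, inner_sub_left]
        ring
      refine (le_of_eq (congrArg (fun f => eLpNorm f 1 volume) e)).trans
        ((eLpNorm_sub_le (hψ.continuous.aestronglyMeasurable.mul j1.1)
        (j2.1.inner hψg.aestronglyMeasurable) le_rfl).trans (add_le_add ?_ ?_))
      · refine eLpNorm_le_mul_eLpNorm_of_ae_le_mul (Eventually.of_forall fun x => ?_) 1
        rw [Pi.mul_apply, norm_mul]
        exact mul_le_mul_of_nonneg_right (hA x) (norm_nonneg _)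
      · refine eLpNorm_le_mul_eLpNorm_of_ae_le_mul (Eventually.of_forall fun x => ?_) 1
        refine (norm_inner_le_norm _ _).trans ?_
        rw [mul_comm A']
        exact mul_le_mul_of_nonneg_left (hA' _) (norm_nonneg _)

end Entropy

/-! ### A smooth convex approximation of the positive part -/

/-- A smooth convex nondecreasing function, equal to zero on `(-∞, 0]`, positive on `(0, ∞)`,
with slope at most one. -/
def hinge (z : ℝ) : ℝ := ∫ s in (0 : ℝ)..z, Real.smoothTransition s

theorem hasDerivAt_hinge (z : ℝ) : HasDerivAt hinge (Real.smoothTransition z) z :=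
  intervalIntegral.integral_hasDerivAt_right
    (Real.smoothTransition.continuous.intervalIntegrable _ _)
    (Real.smoothTransition.continuous.stronglyMeasurableAtFilter _ _)
    Real.smoothTransition.continuousAt

theorem deriv_hinge : deriv hinge = Real.smoothTransition :=
  funext fun z => (hasDerivAt_hinge z).deriv

theorem contDiff_hinge : ContDiff ℝ ∞ hinge := by
  rw [contDiff_infty_iff_deriv, deriv_hinge]
  exact ⟨fun z => (hasDerivAt_hinge z).differentiableAt, Real.smoothTransition.contDiff⟩

theorem abs_deriv_hinge_le (s : ℝ) : |deriv hinge s| ≤ 1 := by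
  rw [deriv_hinge, abs_of_nonneg (Real.smoothTransition.nonneg s)]
  exact Real.smoothTransition.le_one s

theorem monotone_deriv_hinge : Monotone (deriv hinge) := by
  rw [deriv_hinge]
  exact Real.smoothTransition.monotone

theorem hinge_of_nonpos {z : ℝ} (hz : z ≤ 0) : hinge z = 0 := by
  rw [hinge, intervalIntegral.integral_congr (g := fun _ => (0 : ℝ)) fun s hs => ?_]
  · simp
  · rw [uIcc_of_ge hz] at hs
    exact Real.smoothTransition.zero_of_nonpos hs.2

theorem monotone_hinge : Monotone hinge :=
  monotone_of_deriv_nonneg (fun z => (hasDerivAt_hinge z).differentiableAt) fun z => by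
    rw [deriv_hinge]
    exact Real.smoothTransition.nonneg z

theorem hinge_nonneg (z : ℝ) : 0 ≤ hinge z := by
  rcases le_total z 0 with h | h
  · exact (hinge_of_nonpos h).ge
  · rw [← hinge_of_nonpos le_rfl]
    exact monotone_hinge h

theorem hinge_pos {z : ℝ} (hz : 0 < z) : 0 < hinge z :=
  intervalIntegral.intervalIntegral_pos_of_pos_on
    (Real.smoothTransition.continuous.intervalIntegrable _ _)
    (fun _ hs => Real.smoothTransition.pos_of_pos hs.1) hz

theorem hinge_le_mul_deriv {z : ℝ} (hz : 0 ≤ z) : hinge z ≤ z * deriv hinge z := by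
  have h : hinge z ≤ ∫ _ in (0 : ℝ)..z, Real.smoothTransition z :=
    intervalIntegral.integral_mono_on hz (Real.smoothTransition.continuous.intervalIntegrable _ _)
      intervalIntegrable_const fun s hs => Real.smoothTransition.monotone hs.2
  rw [deriv_hinge]
  simpa using h

theorem hinge_le_max (z : ℝ) : hinge z ≤ max z 0 := by
  rcases le_total z 0 with h | h
  · rw [hinge_of_nonpos h]
    exact le_max_right _ _
  · refine (hinge_le_mul_deriv h).trans ((mul_le_of_le_one_right h ?_).trans (le_max_left _ _))
    exact (le_abs_self _).trans (abs_deriv_hinge_le z)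

/-! ### Cutoff functions -/

section Cutoff

variable {d : ℕ}

theorem gradient_comp_smul {f : Space d → ℝ} (c : ℝ) {x : Space d}
    (hf : DifferentiableAt ℝ f (c • x)) : ∇ (fun x => f (c • x)) x = c • ∇ f (c • x) := by
  refine ext_inner_right ℝ fun w => ?_
  have h := (hf.hasFDerivAt.comp x ((hasFDerivAt_id x).const_smul c)).fderiv
  have h' : fderiv ℝ (fun x => f (c • x)) x = _ := h
  rw [inner_smul_left, inner_gradient_left, inner_gradient_left, h']
  simp

theorem gradient_const_mul {f : Space d → ℝ} (c : ℝ) {x : Space d} (hf : DifferentiableAt ℝ f x) :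
    ∇ (fun x => c * f x) x = c • ∇ f x := by
  simp only [gradient, fderiv_const_mul hf, map_smul]

/-- A smooth function with values in `[0, 1]`, equal to one on the ball of radius `j + 1` and
supported in the ball of radius `2 (j + 1)`. -/
def cutoff (d j : ℕ) (x : Space d) : ℝ :=
  (⟨1, 2, one_pos, one_lt_two⟩ : ContDiffBump (0 : Space d)) (((j : ℝ) + 1)⁻¹ • x)

theorem cutoff_nonneg (j : ℕ) (x : Space d) : 0 ≤ cutoff d j x := ContDiffBump.nonneg _

theorem cutoff_le_one (j : ℕ) (x : Space d) : cutoff d j x ≤ 1 := ContDiffBump.le_one _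

theorem contDiff_cutoff (j : ℕ) : ContDiff ℝ ∞ (cutoff d j) :=
  (ContDiffBump.contDiff _).comp (contDiff_const_smul _)

theorem norm_inv_smul_natCast (j : ℕ) (x : Space d) :
    ‖((j : ℝ) + 1)⁻¹ • x‖ = ‖x‖ / ((j : ℝ) + 1) := by
  have : (0 : ℝ) < (j : ℝ) + 1 := by positivity
  rw [norm_smul, Real.norm_of_nonneg (inv_nonneg.2 this.le), inv_mul_eq_div]

theorem norm_le_of_mem_tsupport_cutoff {j : ℕ} {x : Space d} (hx : x ∈ tsupport (cutoff d j)) :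
    ‖x‖ ≤ 2 * ((j : ℝ) + 1) := by
  have h0 : (0 : ℝ) < (j : ℝ) + 1 := by positivity
  have h : tsupport (cutoff d j) ⊆ Metric.closedBall 0 (2 * ((j : ℝ) + 1)) := by
    refine closure_minimal (fun y hy => ?_) Metric.isClosed_closedBall
    by_contra hcon
    refine hy (ContDiffBump.zero_of_le_dist _ ?_)
    rw [mem_closedBall_zero_iff, not_le] at hcon
    rw [dist_zero_right, norm_inv_smul_natCast]
    exact (le_div_iff₀ h0).2 hcon.le
  exact mem_closedBall_zero_iff.1 (h hx)

theorem hasCompactSupport_cutoff (j : ℕ) : HasCompactSupport (cutoff d j) :=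
  HasCompactSupport.of_support_subset_isCompact (isCompact_closedBall 0 (2 * ((j : ℝ) + 1)))
    fun _ hx => mem_closedBall_zero_iff.2 (norm_le_of_mem_tsupport_cutoff (subset_tsupport _ hx))

theorem cutoff_eq_one {j : ℕ} {x : Space d} (hx : ‖x‖ ≤ (j : ℝ) + 1) : cutoff d j x = 1 := by
  refine ContDiffBump.one_of_mem_closedBall _ ?_
  rw [mem_closedBall_zero_iff, norm_inv_smul_natCast]
  exact (div_le_one (by positivity)).2 hx

theorem eventually_norm_lt (x : Space d) : ∀ᶠ j : ℕ in atTop, ‖x‖ < (j : ℝ) + 1 := by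
  filter_upwards [tendsto_natCast_atTop_atTop.eventually_gt_atTop ‖x‖] with j hj
  linarith

theorem tendsto_cutoff (x : Space d) : Tendsto (fun j => cutoff d j x) atTop (𝓝 1) :=
  tendsto_const_nhds.congr' ((eventually_norm_lt x).mono fun _ hj => (cutoff_eq_one hj.le).symm)

/-- The indicator function of the complement of the ball of radius `j + 1`. -/
def tail (d j : ℕ) : Space d → ℝ := (Metric.ball (0 : Space d) ((j : ℝ) + 1))ᶜ.indicator fun _ => 1

theorem tail_nonneg (j : ℕ) (x : Space d) : 0 ≤ tail d j x :=
  indicator_nonneg (fun _ _ => zero_le_one) x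

theorem tail_le_one (j : ℕ) (x : Space d) : tail d j x ≤ 1 := by
  unfold tail
  exact indicator_le_self' (fun _ _ => zero_le_one) x

theorem tail_eq_zero {j : ℕ} {x : Space d} (hx : ‖x‖ < (j : ℝ) + 1) : tail d j x = 0 :=
  indicator_of_notMem (notMem_compl_iff.2 (mem_ball_zero_iff.2 hx)) _

theorem tail_eq_one {j : ℕ} {x : Space d} (hx : (j : ℝ) + 1 ≤ ‖x‖) : tail d j x = 1 :=
  indicator_of_mem (mem_compl fun h => not_lt.2 hx (mem_ball_zero_iff.1 h)) _

theorem measurable_tail (j : ℕ) : Measurable (tail d j) :=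
  measurable_const.indicator Metric.isOpen_ball.measurableSet.compl

theorem tendsto_integral_mul_tail {X : Type*} [MeasurableSpace X] {μ : Measure X} [SFinite μ]
    {E : X × Space d → ℝ} (hE : Integrable E (μ.prod volume)) :
    Tendsto (fun j => ∫ z, E z * tail d j z.2 ∂(μ.prod volume)) atTop (𝓝 0) := by
  have : (0 : ℝ) = ∫ z, 0 ∂(μ.prod (volume : Measure (Space d))) := by simp
  rw [this]
  refine tendsto_integral_of_dominated_convergence (fun z => ‖E z‖)
    (fun j => hE.1.mul ((measurable_tail j).comp measurable_snd).aestronglyMeasurable) hE.norm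
    (fun j => Eventually.of_forall fun z => ?_) (Eventually.of_forall fun z => ?_)
  · rw [norm_mul, Real.norm_of_nonneg (tail_nonneg j z.2)]
    exact mul_le_of_le_one_right (norm_nonneg _) (tail_le_one j z.2)
  · refine tendsto_const_nhds.congr' ((eventually_norm_lt z.2).mono fun j hj => ?_)
    simp only [tail_eq_zero hj, mul_zero]

theorem gradient_eq_of_eventuallyEq {f g : Space d → ℝ} {x : Space d} (h : f =ᶠ[𝓝 x] g) :
    ∇ f x = ∇ g x := by
  simp only [gradient, h.fderiv_eq]

theorem gradient_cutoff_eq_zero {j : ℕ} {x : Space d} (hx : ‖x‖ < (j : ℝ) + 1) :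
    ∇ (cutoff d j) x = 0 := by
  have : cutoff d j =ᶠ[𝓝 x] fun _ => (1 : ℝ) := by
    filter_upwards [Metric.isOpen_ball.mem_nhds (mem_ball_zero_iff.2 hx)] with y hy
    exact cutoff_eq_one (mem_ball_zero_iff.1 hy).le
  rw [gradient_eq_of_eventuallyEq this]
  simp [gradient]

theorem contDiff_gradient_apply {ψ : Space d → ℝ} (hψ : ContDiff ℝ ∞ ψ) (i : Fin d) :
    ContDiff ℝ ∞ fun x => ∇ ψ x i :=
  (EuclideanSpace.proj (𝕜 := ℝ) i).contDiff.comp (contDiff_gradient hψ)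

theorem hasCompactSupport_gradient_apply {ψ : Space d → ℝ} (hc : HasCompactSupport ψ) (i : Fin d) :
    HasCompactSupport fun x => ∇ ψ x i :=
  (hasCompactSupport_gradient hc).comp_left (g := fun v : Space d => v i) rfl

/-- The derivatives of the cutoff functions: the first ones decay like `1 / ‖x‖`, the second ones
are bounded, and all of them live outside the ball of radius `j + 1`. -/
theorem exists_cutoff_bound (d : ℕ) : ∃ A : ℝ, 0 ≤ A ∧
    (∀ j (x : Space d), (1 + ‖x‖) * ‖∇ (cutoff d j) x‖ ≤ A * tail d j x) ∧
    ∀ j i (x : Space d), ‖∇ (fun x => ∇ (cutoff d j) x i) x‖ ≤ A * tail d j x := by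
  set χ : ContDiffBump (0 : Space d) := ⟨1, 2, one_pos, one_lt_two⟩ with hχ
  have hs : ContDiff ℝ ∞ χ := χ.contDiff
  obtain ⟨B, hB⟩ := (contDiff_gradient hs).continuous.bounded_above_of_compact_support
    (hasCompactSupport_gradient χ.hasCompactSupport)
  have hB0 : 0 ≤ B := (norm_nonneg _).trans (hB 0)
  choose D hD using fun i : Fin d =>
    (contDiff_gradient (contDiff_gradient_apply hs i)).continuous.bounded_above_of_compact_support
      (hasCompactSupport_gradient (hasCompactSupport_gradient_apply χ.hasCompactSupport i))
  have hD0 : ∀ i, 0 ≤ D i := fun i => (norm_nonneg _).trans (hD i 0)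
  have hgr : ∀ (j : ℕ) (x : Space d), ∇ (cutoff d j) x =
      ((j : ℝ) + 1)⁻¹ • ∇ χ (((j : ℝ) + 1)⁻¹ • x) := fun j x =>
    gradient_comp_smul _ (hs.differentiable (by simp) _)
  have hS : 0 ≤ ∑ i, D i := Finset.sum_nonneg fun i _ => hD0 i
  refine ⟨3 * B + ∑ i, D i, by positivity, fun j x => ?_, fun j i x => ?_⟩
  · have h0 : (1 : ℝ) ≤ (j : ℝ) + 1 := by simp
    rcases lt_or_ge ‖x‖ ((j : ℝ) + 1) with hx | hx
    · rw [gradient_cutoff_eq_zero hx, tail_eq_zero hx]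
      simp
    rw [tail_eq_one hx, mul_one]
    by_cases hx2 : x ∈ tsupport (cutoff d j)
    · have h1 := norm_le_of_mem_tsupport_cutoff hx2
      have h2 : ‖∇ (cutoff d j) x‖ ≤ B / ((j : ℝ) + 1) := by
        rw [hgr, norm_smul, Real.norm_of_nonneg (by positivity), inv_mul_eq_div]
        gcongr
        exact hB _
      calc (1 + ‖x‖) * ‖∇ (cutoff d j) x‖ ≤ (3 * ((j : ℝ) + 1)) * (B / ((j : ℝ) + 1)) := by
            gcongr
            linarith
        _ = 3 * B := by field_simp
        _ ≤ _ := by linarith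
    · rw [gradient_eq_zero_of_notMem_tsupport hx2, norm_zero, mul_zero]
      positivity
  · rcases lt_or_ge ‖x‖ ((j : ℝ) + 1) with hx | hx
    · have : (fun x => ∇ (cutoff d j) x i) =ᶠ[𝓝 x] fun _ => (0 : ℝ) := by
        filter_upwards [Metric.isOpen_ball.mem_nhds (mem_ball_zero_iff.2 hx)] with y hy
        rw [gradient_cutoff_eq_zero (mem_ball_zero_iff.1 hy)]
        rfl
      rw [gradient_eq_of_eventuallyEq this, tail_eq_zero hx]
      simp [gradient]
    rw [tail_eq_one hx, mul_one]
    have e : (fun x => ∇ (cutoff d j) x i) =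
        fun x => ((j : ℝ) + 1)⁻¹ * (fun y => ∇ χ y i) (((j : ℝ) + 1)⁻¹ • x) := by
      ext x
      rw [hgr]
      rfl
    have hsm := (contDiff_gradient_apply hs i).differentiable (by simp)
    have e2 : ∇ (fun x => ∇ (cutoff d j) x i) x = ((j : ℝ) + 1)⁻¹ • ((j : ℝ) + 1)⁻¹ •
        ∇ (fun y => ∇ χ y i) (((j : ℝ) + 1)⁻¹ • x) := by
      rw [e, ← gradient_comp_smul _ (hsm _)]
      have h3 : DifferentiableAt ℝ (fun x => (fun y => ∇ χ y i) (((j : ℝ) + 1)⁻¹ • x)) x :=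
        (hsm _).comp x (differentiable_id.const_smul (((j : ℝ) + 1)⁻¹) x)
      exact gradient_const_mul _ h3
    have h1 : ((j : ℝ) + 1)⁻¹ ≤ 1 := inv_le_one_of_one_le₀ (by simp)
    have h2 : 0 ≤ ((j : ℝ) + 1)⁻¹ := by positivity
    rw [e2, norm_smul, norm_smul, Real.norm_of_nonneg h2]
    have h3 := mul_le_of_le_one_left (norm_nonneg (∇ (fun y => ∇ χ y i) (((j : ℝ) + 1)⁻¹ • x))) h1
    have h4 := mul_le_of_le_one_left (mul_nonneg h2
      (norm_nonneg (∇ (fun y => ∇ χ y i) (((j : ℝ) + 1)⁻¹ • x)))) h1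
    have h5 := hD i (((j : ℝ) + 1)⁻¹ • x)
    have h6 := Finset.single_le_sum (fun i _ => hD0 i) (Finset.mem_univ i)
    linarith

/-- The weak Laplacian: if `g = ∇u` weakly then `∫ g · ∇ψ = -∫ u Δψ`, in the form of a bound. -/
theorem IsWeakGradient.abs_integral_inner_gradient_le {u : Space d → ℝ} {g : Space d → Space d}
    (h : IsWeakGradient u g) {ψ : Space d → ℝ} (hψ : ContDiff ℝ ∞ ψ) (hc : HasCompactSupport ψ)
    {q : Space d → ℝ} (hq : ∀ i x, ‖∇ (fun x => ∇ ψ x i) x‖ ≤ q x)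
    (hi : Integrable fun x => |u x| * q x) :
    |∫ x, inner ℝ (g x) (∇ ψ x)| ≤ d * ∫ x, |u x| * q x := by
  have hgi : ∀ i : Fin d, Integrable fun x => ∇ ψ x i • g x := fun i =>
    h.2.1.integrable_smul_left_of_hasCompactSupport
      (contDiff_gradient_apply hψ i).continuous (hasCompactSupport_gradient_apply hc i)
  have hgi' : ∀ i : Fin d, Integrable fun x => g x i * ∇ ψ x i := fun i => by
    refine ((EuclideanSpace.proj (𝕜 := ℝ) i).integrable_comp (hgi i)).congr
      (Eventually.of_forall fun x => ?_)
    simp [mul_comm]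
  have e : ∀ x, inner ℝ (g x) (∇ ψ x) = ∑ i, g x i * ∇ ψ x i := fun x => by
    rw [PiLp.inner_apply]
    exact Finset.sum_congr rfl fun i _ => by simp [mul_comm]
  simp_rw [e]
  rw [integral_finsetSum _ fun i _ => hgi' i]
  refine (Finset.abs_sum_le_sum_abs _ _).trans ?_
  have : ∀ i : Fin d, |∫ x, g x i * ∇ ψ x i| ≤ ∫ x, |u x| * q x := by
    intro i
    have h1 := h.2.2 _ (contDiff_gradient_apply hψ i) (hasCompactSupport_gradient_apply hc i)
    have h2 : ∫ x, g x i * ∇ ψ x i = (∫ x, ∇ ψ x i • g x) i := by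
      have := (EuclideanSpace.proj (𝕜 := ℝ) i).integral_comp_comm (hgi i)
      refine Eq.trans ?_ this
      refine integral_congr_ae (Eventually.of_forall fun x => ?_)
      simp [mul_comm]
    have h3 : ‖∫ x, ∇ ψ x i • g x‖ ≤ ∫ x, |u x| * q x := by
      rw [← norm_neg, ← h1]
      refine (norm_integral_le_integral_norm _).trans (integral_mono_of_nonneg
        (Eventually.of_forall fun _ => norm_nonneg _) hi (Eventually.of_forall fun x => ?_))
      simp only [norm_smul, Real.norm_eq_abs]
      exact mul_le_mul_of_nonneg_left (hq i x) (abs_nonneg _)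
    rw [h2]
    exact (PiLp.norm_apply_le (p := 2) (∫ x, ∇ ψ x i • g x) i).trans h3
  refine (Finset.sum_le_sum fun i _ => this i).trans (le_of_eq ?_)
  simp

/-- A Lipschitz vector field has a bounded distributional divergence. -/
theorem exists_isWeakDivergence_of_lipschitz {V : Space d → Space d} {K : ℝ≥0}
    (hV : LipschitzWith K V) : ∃ (m : Space d → ℝ) (B : ℝ), AEStronglyMeasurable m ∧
      (∀ x, |m x| ≤ B) ∧ IsWeakDivergence V m := by
  have hVi : ∀ i : Fin d, LipschitzWith K fun x => V x i := fun i =>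
    LipschitzWith.of_dist_le_mul fun x y => by
      refine le_trans ?_ (hV.dist_le_mul x y)
      rw [dist_eq_norm, dist_eq_norm]
      exact PiLp.norm_apply_le (p := 2) (V x - V y) i
  set e : Fin d → Space d := fun i => EuclideanSpace.single i (1 : ℝ) with he
  have hmem := fun i => (hVi i).memLp_lineDeriv (μ := volume) (e i)
  refine ⟨fun x => ∑ i, lineDeriv ℝ (fun x => V x i) x (e i), ∑ _i : Fin d, K, ?_, ?_, ?_⟩
  · exact Finset.aestronglyMeasurable_fun_sum _ fun i _ => (hmem i).1
  · intro x
    refine (Finset.abs_sum_le_sum_abs _ _).trans (Finset.sum_le_sum fun i _ => ?_)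
    have := norm_lineDeriv_le_of_lipschitz ℝ (hVi i) (x₀ := x) (v := e i)
    simpa [he] using this
  · intro ψ hψ hc
    obtain ⟨D, hD⟩ := hψ.lipschitzWith_of_hasCompactSupport hc (by simp)
    have hψi : Integrable ψ := hψ.continuous.integrable_of_hasCompactSupport hc
    have h1 : ∀ i, ∫ x, V x i * ∇ ψ x i = -∫ x, lineDeriv ℝ (fun x => V x i) x (e i) * ψ x := by
      intro i
      rw [(hVi i).integral_lineDeriv_mul_eq hD hc (e i), ← integral_neg]
      refine integral_congr_ae (Eventually.of_forall fun x => ?_)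
      have hdx := hψ.differentiable (by simp) x
      simp only
      rw [hdx.lineDeriv_eq_fderiv, map_neg, ← inner_gradient_left]
      simp only [he, EuclideanSpace.inner_single_right]
      simp [mul_comm]
    have i1 : ∀ i, Integrable fun x => V x i * ∇ ψ x i := fun i =>
      ((hVi i).continuous.mul (contDiff_gradient_apply hψ i).continuous).integrable_of_hasCompactSupport
        (HasCompactSupport.mul_left (f := fun x => V x i) (hasCompactSupport_gradient_apply hc i))
    have i2 : ∀ i, Integrable fun x => lineDeriv ℝ (fun x => V x i) x (e i) * ψ x := fun i =>
      hψi.bdd_mul (c := K) (hmem i).1 (Eventually.of_forall fun x => by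
        simpa [he] using norm_lineDeriv_le_of_lipschitz ℝ (hVi i) (x₀ := x) (v := e i))
    simp_rw [Finset.sum_mul]
    rw [integral_finsetSum _ fun i _ => i2 i, ← Finset.sum_neg_distrib]
    simp_rw [← h1]
    rw [← integral_finsetSum _ fun i _ => i1 i]
    refine integral_congr_ae (Eventually.of_forall fun x => ?_)
    simp only [PiLp.inner_apply]
    exact Finset.sum_congr rfl fun i _ => by simp [mul_comm]

end Cutoff

/-! ### Estimates at a fixed time -/

section Slice

variable {d : ℕ}

/-- A continuous vector field `V` of linear growth with bounded distributional divergence `m`. -/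
structure IsDrift (V : Space d → Space d) (m : Space d → ℝ) (B : ℝ) : Prop where
  continuous : Continuous V
  norm_le : ∀ x, ‖V x‖ ≤ B * (1 + ‖x‖)
  aestronglyMeasurable : AEStronglyMeasurable m
  abs_le : ∀ x, |m x| ≤ B
  divergence : IsWeakDivergence V m

theorem IsDrift.nonneg {V : Space d → Space d} {m : Space d → ℝ} {B : ℝ} (h : IsDrift V m B) :
    0 ≤ B := (abs_nonneg _).trans (h.abs_le 0)

theorem exists_isDrift {V : Space d → Space d} {K : ℝ≥0} (hV : LipschitzWith K V) :
    ∃ m B, IsDrift V m B := by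
  obtain ⟨m, B, h1, h2, h3⟩ := exists_isWeakDivergence_of_lipschitz hV
  refine ⟨m, max B (max K ‖V 0‖), hV.continuous, fun x => ?_, h1,
    fun x => (h2 x).trans (le_max_left _ _), h3⟩
  have h4 := hV.dist_le_mul x 0
  rw [dist_zero_right, dist_eq_norm] at h4
  have h5 := norm_add_le (V x - V 0) (V 0)
  rw [sub_add_cancel] at h5
  have h6 : (K : ℝ) ≤ max B (max K ‖V 0‖) := (le_max_left _ _).trans (le_max_right _ _)
  have h7 : ‖V 0‖ ≤ max B (max K ‖V 0‖) := (le_max_right _ _).trans (le_max_right _ _)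
  have h8 := mul_le_mul_of_nonneg_right h6 (norm_nonneg x)
  linarith

/-- The regularity of a solution and of the field it generates, at almost every time. The constant
`N` bounds the contribution of distant charges to the field. -/
structure IsRegularSlice (ρ : Space d → ℝ) (g : Space d → Space d) (N : ℝ) : Prop where
  integrable : Integrable ρ
  memLp : MemLp ρ 2
  memLp_gradient : MemLp g 2
  gradient : IsWeakGradient ρ g
  integrable_nearField_sq : Integrable fun x => nearField d ρ x ^ 2
  norm_field_le : ∀ᵐ x, ‖field d ρ x‖ ≤ nearField d ρ x + N

/-- An integrable function that dominates, up to the linear growth of the drift, all the fluxes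
of a solution. -/
def energy (ρ : Space d → ℝ) (g : Space d → Space d) (x : Space d) : ℝ :=
  |ρ x| + ρ x ^ 2 + ‖g x‖ ^ 2 + nearField d ρ x ^ 2

theorem energy_nonneg (ρ : Space d → ℝ) (g : Space d → Space d) (x : Space d) :
    0 ≤ energy ρ g x := by
  unfold energy
  positivity

variable {ρ m ψ : Space d → ℝ} {g V : Space d → Space d} {N B : ℝ}

theorem IsRegularSlice.integrable_energy (h : IsRegularSlice ρ g N) : Integrable (energy ρ g) :=
  ((h.integrable.abs.add h.memLp.integrable_sq).add h.memLp_gradient.norm.integrable_sq).add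
    h.integrable_nearField_sq

theorem integrable_energy_mul_tail {ρ : Space d → ℝ} {g : Space d → Space d}
    (h : Integrable (energy ρ g)) (j : ℕ) : Integrable fun x => energy ρ g x * tail d j x :=
  h.mul_bdd (c := 1) (measurable_tail j).aestronglyMeasurable (Eventually.of_forall fun x => by
    rw [Real.norm_of_nonneg (tail_nonneg j x)]
    exact tail_le_one j x)

theorem IsRegularSlice.aestronglyMeasurable_drift (hd : 2 ≤ d) (h : IsRegularSlice ρ g N)
    (hV : Continuous V) : AEStronglyMeasurable fun x => field d ρ x + V x :=
  (locallyIntegrable_field hd h.integrable).aestronglyMeasurable.add hV.aestronglyMeasurable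

theorem IsRegularSlice.norm_drift_le (h : IsRegularSlice ρ g N) (hV : IsDrift V m B) :
    ∀ᵐ x, ‖field d ρ x + V x‖ ≤ nearField d ρ x + N + B * (1 + ‖x‖) := by
  filter_upwards [h.norm_field_le] with x hx
  exact (norm_add_le _ _).trans (add_le_add hx (hV.norm_le x))

theorem IsRegularSlice.memLp_drift (hd : 2 ≤ d) (h : IsRegularSlice ρ g N) (hV : IsDrift V m B)
    (R : ℝ) : MemLp (fun x => field d ρ x + V x) 2 (volume.restrict (Metric.ball 0 R)) := by
  have : IsFiniteMeasure ((volume : Measure (Space d)).restrict (Metric.ball 0 R)) :=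
    isFiniteMeasure_restrict.2 measure_ball_lt_top.ne
  have hm := (h.aestronglyMeasurable_drift hd hV.continuous).restrict (s := Metric.ball 0 R)
  have hle : ∀ᵐ x ∂(volume.restrict (Metric.ball 0 R)),
      ‖field d ρ x + V x‖ ≤ nearField d ρ x + (N + B * (1 + R)) := by
    filter_upwards [ae_restrict_of_ae (h.norm_drift_le hV),
      ae_restrict_mem Metric.isOpen_ball.measurableSet] with x hx hxR
    have := mul_le_mul_of_nonneg_left (mem_ball_zero_iff.1 hxR).le hV.nonneg
    linarith
  refine (memLp_two_iff_integrable_sq_norm hm).2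
    (((h.integrable_nearField_sq.integrableOn.const_mul 2).add
      (integrable_const (2 * (N + B * (1 + R)) ^ 2))).mono' (hm.norm.pow 2) ?_)
  filter_upwards [hle] with x hx
  simp only [Pi.add_apply]
  rw [Real.norm_of_nonneg (sq_nonneg _)]
  have := pow_le_pow_left₀ (norm_nonneg _) hx 2
  nlinarith [sq_nonneg (nearField d ρ x - (N + B * (1 + R)))]

theorem IsRegularSlice.isWeakDivergence_drift (hd : d = 2 ∨ d = 3) (h : IsRegularSlice ρ g N)
    (hV : IsDrift V m B) :
    IsWeakDivergence (fun x => field d ρ x + V x) fun x => m x - ρ x := by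
  intro ψ hψ hc
  have hg := (contDiff_gradient hψ).continuous
  have hgc := hasCompactSupport_gradient hc
  have i1 := (locallyIntegrable_field (by omega) h.integrable).integrable_inner hg hgc
  have i2 := hV.continuous.locallyIntegrable (μ := volume).integrable_inner hg hgc
  have hψi : Integrable ψ := hψ.continuous.integrable_of_hasCompactSupport hc
  obtain ⟨A, hA⟩ := hψ.continuous.bounded_above_of_compact_support hc
  have i3 : Integrable fun x => m x * ψ x :=
    hψi.bdd_mul hV.aestronglyMeasurable (Eventually.of_forall hV.abs_le)
  have i4 : Integrable fun x => ρ x * ψ x :=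
    h.integrable.mul_bdd hψ.continuous.aestronglyMeasurable (Eventually.of_forall hA)
  simp_rw [inner_add_left, sub_mul]
  rw [integral_add i1 i2, integral_sub i3 i4, hV.divergence ψ hψ hc,
    integral_inner_field_gradient hd h.integrable hψ hc]
  ring

theorem IsRegularSlice.memLp_divergence (h : IsRegularSlice ρ g N) (hV : IsDrift V m B) (R : ℝ) :
    MemLp (fun x => m x - ρ x) 2 (volume.restrict (Metric.ball 0 R)) := by
  have : IsFiniteMeasure ((volume : Measure (Space d)).restrict (Metric.ball 0 R)) :=
    isFiniteMeasure_restrict.2 measure_ball_lt_top.ne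
  exact (MemLp.of_bound hV.aestronglyMeasurable.restrict B
    (Eventually.of_forall hV.abs_le)).sub (h.memLp.restrict _)

/-- The convective term `∇·(ρ (∇c + V))` in non-divergence form. -/
def source (V : Space d → Space d) (m : Space d → ℝ) (ρ : Space d → ℝ) (g : Space d → Space d)
    (x : Space d) : ℝ :=
  inner ℝ (g x) (field d ρ x + V x) + ρ x * (m x - ρ x)

theorem IsRegularSlice.integrable_mul_inner_drift (hd : 2 ≤ d) (h : IsRegularSlice ρ g N)
    (hV : IsDrift V m B) (hψ : Continuous ψ) (hc : HasCompactSupport ψ) :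
    Integrable fun x => ψ x * inner ℝ (g x) (field d ρ x + V x) := by
  have h1 := memLp_smul_of_hasCompactSupport (h.memLp_drift hd hV) hψ hc
  refine (h.memLp_gradient.norm.integrable_mul h1.norm).mono' (hψ.aestronglyMeasurable.mul
    (h.memLp_gradient.1.inner (h.aestronglyMeasurable_drift hd hV.continuous)))
    (Eventually.of_forall fun x => ?_)
  rw [← inner_smul_right]
  exact norm_inner_le_norm _ _

theorem IsRegularSlice.integrable_mul_divergence (h : IsRegularSlice ρ g N)
    (hV : IsDrift V m B) (hψ : Continuous ψ) (hc : HasCompactSupport ψ) {w : Space d → ℝ}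
    (hw : AEStronglyMeasurable w) (hwρ : ∀ᵐ x, |w x| ≤ |ρ x|) :
    Integrable fun x => ψ x * (w x * (m x - ρ x)) := by
  obtain ⟨A, hA⟩ := hψ.bounded_above_of_compact_support hc
  refine Integrable.bdd_mul ?_ hψ.aestronglyMeasurable (Eventually.of_forall hA)
  refine ((h.integrable.abs.const_mul B).add h.memLp.integrable_sq).mono'
    (hw.mul (hV.aestronglyMeasurable.sub h.integrable.1)) ?_
  filter_upwards [hwρ] with x hx
  rw [norm_mul]
  simp only [Real.norm_eq_abs, Pi.add_apply]
  have h1 := (abs_sub (m x) (ρ x)).trans (add_le_add_left (hV.abs_le x) _)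
  calc |w x| * |m x - ρ x| ≤ |ρ x| * (B + |ρ x|) := by gcongr
    _ = _ := by rw [← sq_abs (ρ x)]; ring

theorem IsRegularSlice.integrable_mul_source (hd : 2 ≤ d) (h : IsRegularSlice ρ g N)
    (hV : IsDrift V m B) (hψ : Continuous ψ) (hc : HasCompactSupport ψ) :
    Integrable fun x => ψ x * source V m ρ g x := by
  have := (h.integrable_mul_inner_drift hd hV hψ hc).add
    (h.integrable_mul_divergence hV hψ hc h.integrable.1 (Eventually.of_forall fun _ => le_rfl))
  refine this.congr (Eventually.of_forall fun x => ?_)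
  simp only [source, Pi.add_apply]
  ring

theorem IsRegularSlice.integrable_mul_inner_drift_gradient (hd : 2 ≤ d)
    (h : IsRegularSlice ρ g N) (hV : IsDrift V m B) (hψ : ContDiff ℝ ∞ ψ)
    (hc : HasCompactSupport ψ) :
    Integrable fun x => ρ x * inner ℝ (field d ρ x + V x) (∇ ψ x) := by
  have hgc := (hasCompactSupport_gradient hc).norm
  have h1 := memLp_smul_of_hasCompactSupport (h.memLp_drift hd hV)
    (contDiff_gradient hψ).continuous.norm hgc
  refine (h.memLp.norm.integrable_mul h1.norm).mono' (h.memLp.1.mul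
    ((h.aestronglyMeasurable_drift hd hV.continuous).inner
      (contDiff_gradient hψ).continuous.aestronglyMeasurable)) (Eventually.of_forall fun x => ?_)
  rw [norm_mul, Pi.mul_apply, norm_smul, norm_norm, mul_comm ‖∇ ψ x‖]
  exact mul_le_mul_of_nonneg_left (norm_inner_le_norm _ _) (norm_nonneg _)

/-- The flux of a slice against a test function, in non-divergence form. -/
theorem IsRegularSlice.integral_inner_flux (hd : d = 2 ∨ d = 3) (h : IsRegularSlice ρ g N)
    (hV : IsDrift V m B) (hψ : ContDiff ℝ ∞ ψ) (hc : HasCompactSupport ψ) :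
    -∫ x, inner ℝ (g x + ρ x • (field d ρ x + V x)) (∇ ψ x) =
      ∫ x, (source V m ρ g x * ψ x - inner ℝ (g x) (∇ ψ x)) := by
  have hd2 : 2 ≤ d := by omega
  have i1 := h.gradient.2.1.integrable_inner (contDiff_gradient hψ).continuous
    (hasCompactSupport_gradient hc)
  have i2 := h.integrable_mul_inner_drift_gradient hd2 hV hψ hc
  have i3 := h.integrable_mul_source hd2 hV hψ.continuous hc
  have key := integral_comp_mul_inner_gradient (θ := fun s : ℝ => s) (C := 1) contDiff_id
    (fun s => by simp) h.memLp h.memLp_gradient h.gradient (h.memLp_drift hd2 hV)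
    (h.memLp_divergence hV) (h.isWeakDivergence_drift hd hV) hψ hc
  have e1 : ∫ x, inner ℝ (g x + ρ x • (field d ρ x + V x)) (∇ ψ x) =
      (∫ x, inner ℝ (g x) (∇ ψ x)) + ∫ x, ρ x * inner ℝ (field d ρ x + V x) (∇ ψ x) := by
    rw [← integral_add i1 i2]
    refine integral_congr_ae (Eventually.of_forall fun x => ?_)
    simp only [inner_add_left, inner_smul_left, conj_trivial]
  have e2 : ∫ x, (source V m ρ g x * ψ x - inner ℝ (g x) (∇ ψ x)) =
      (∫ x, ψ x * source V m ρ g x) - ∫ x, inner ℝ (g x) (∇ ψ x) := by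
    rw [← integral_sub i3 i1]
    simp_rw [mul_comm (ψ _)]
  simp only [deriv_id'', one_mul] at key
  rw [e1, e2, key]
  simp only [source]
  ring

/-- Young's inequality for the convective flux. -/
theorem mul_drift_le_energy {r b nf x : ℝ} {G : ℝ} (hN : 0 ≤ N) (hB : 0 ≤ B) (hr : 0 ≤ r)
    (hx : 0 ≤ x) (hnf : 0 ≤ nf) (hb : b ≤ nf + N + B * (1 + x)) :
    r * b ≤ (1 + N + B) * (r + r ^ 2 + G ^ 2 + nf ^ 2) * (1 + x) := by
  have h1 : b ≤ (nf + N + B) * (1 + x) := by nlinarith [mul_nonneg hnf hx, mul_nonneg hN hx]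
  have h2 : r * (nf + N + B) ≤ (1 + N + B) * (r + r ^ 2 + G ^ 2 + nf ^ 2) := by
    have h3 : 0 ≤ r ^ 2 + G ^ 2 + nf ^ 2 := by positivity
    have h4 : 0 ≤ (N + B) * (r ^ 2 + G ^ 2 + nf ^ 2) := by positivity
    nlinarith [sq_nonneg (r - nf), sq_nonneg G]
  calc r * b ≤ r * ((nf + N + B) * (1 + x)) := mul_le_mul_of_nonneg_left h1 hr
    _ = r * (nf + N + B) * (1 + x) := by ring
    _ ≤ _ := mul_le_mul_of_nonneg_right h2 (by linarith)

/-- The convective flux through the transition region of the cutoff functions. -/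
theorem IsRegularSlice.mul_norm_drift_mul_le (h : IsRegularSlice ρ g N) (hV : IsDrift V m B)
    (hN : 0 ≤ N) {A : ℝ}
    (hA : ∀ j (x : Space d), (1 + ‖x‖) * ‖∇ (cutoff d j) x‖ ≤ A * tail d j x) (j : ℕ) :
    ∀ᵐ x, |ρ x| * ‖field d ρ x + V x‖ * ‖∇ (cutoff d j) x‖ ≤
      (1 + N + B) * A * (energy ρ g x * tail d j x) := by
  filter_upwards [h.norm_drift_le hV] with x hx
  have hB := hV.nonneg
  have h1 := mul_drift_le_energy (G := ‖g x‖) hN hB (abs_nonneg (ρ x)) (norm_nonneg x)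
    (nearField_nonneg ρ x) hx
  rw [sq_abs] at h1
  have h2 := mul_le_mul_of_nonneg_right h1 (norm_nonneg (∇ (cutoff d j) x))
  have h3 := mul_le_mul_of_nonneg_left (hA j x)
    (mul_nonneg (by positivity : 0 ≤ 1 + N + B) (energy_nonneg ρ g x))
  unfold energy at h3 ⊢
  linarith

end Slice

section SliceEstimates

variable {d : ℕ} {ρ m : Space d → ℝ} {g V : Space d → Space d} {N B A L s : ℝ}

/-- The quadratic damping of the equation beats the reaction term `m ρ` above the level `L + s`,
with a margin that pays for a decrease of this level with speed `s ^ 2`. -/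
theorem deriv_hinge_mul_reaction_le {r c : ℝ} (hL : 0 ≤ L) (hs : 0 ≤ s) (hc : c ≤ L) :
    deriv hinge (r - (L + s)) * (r * (c - r) + s ^ 2) ≤ hinge (r - (L + s)) * (c - r) := by
  rcases le_or_gt r (L + s) with h | h
  · have h0 : r - (L + s) ≤ 0 := by linarith
    rw [hinge_of_nonpos h0, deriv_hinge, Real.smoothTransition.zero_of_nonpos h0]
    simp
  · have h1 := hinge_le_mul_deriv (z := r - (L + s)) (by linarith)
    have h2 : 0 ≤ deriv hinge (r - (L + s)) := by
      rw [deriv_hinge]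
      exact Real.smoothTransition.nonneg _
    have h3 : c - r ≤ -s := by linarith
    have h4 := mul_le_mul_of_nonpos_right h1 (by linarith : c - r ≤ 0)
    have h5 : (L + s) * (c - r) + s ^ 2 ≤ 0 := by nlinarith
    nlinarith [mul_nonneg h2 (neg_nonneg.2 h5)]

theorem norm_gradient_cutoff_le
    (hA : ∀ j (x : Space d), (1 + ‖x‖) * ‖∇ (cutoff d j) x‖ ≤ A * tail d j x) (j : ℕ)
    (x : Space d) : ‖∇ (cutoff d j) x‖ ≤ A * tail d j x :=
  (le_mul_of_one_le_left (norm_nonneg _) (by linarith [norm_nonneg x])).trans (hA j x)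

/-- The mass that crosses the transition region of the cutoff functions. The diffusive flux is
integrated by parts once more, because `g` need not be integrable. -/
theorem IsRegularSlice.abs_integral_flux_cutoff_le (hd : 2 ≤ d) (h : IsRegularSlice ρ g N)
    (hV : IsDrift V m B) (hN : 0 ≤ N) (hA0 : 0 ≤ A)
    (hA : ∀ j (x : Space d), (1 + ‖x‖) * ‖∇ (cutoff d j) x‖ ≤ A * tail d j x)
    (hA' : ∀ j i (x : Space d), ‖∇ (fun x => ∇ (cutoff d j) x i) x‖ ≤ A * tail d j x) (j : ℕ) :
    |∫ x, inner ℝ (g x + ρ x • (field d ρ x + V x)) (∇ (cutoff d j) x)| ≤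
      (d * A + (1 + N + B) * A) * ∫ x, energy ρ g x * tail d j x := by
  have hψ := contDiff_cutoff (d := d) j
  have hc := hasCompactSupport_cutoff (d := d) j
  have i1 := h.gradient.2.1.integrable_inner (contDiff_gradient hψ).continuous
    (hasCompactSupport_gradient hc)
  have i2 := h.integrable_mul_inner_drift_gradient hd hV hψ hc
  have iE := integrable_energy_mul_tail h.integrable_energy j
  have e1 : ∫ x, inner ℝ (g x + ρ x • (field d ρ x + V x)) (∇ (cutoff d j) x) =
      (∫ x, inner ℝ (g x) (∇ (cutoff d j) x)) +
        ∫ x, ρ x * inner ℝ (field d ρ x + V x) (∇ (cutoff d j) x) := by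
    rw [← integral_add i1 i2]
    refine integral_congr_ae (Eventually.of_forall fun x => ?_)
    simp only [inner_add_left, inner_smul_left, conj_trivial]
  have iq : Integrable fun x => |ρ x| * (A * tail d j x) := by
    refine (h.integrable.abs.mul_const A).mul_bdd (c := 1)
      (measurable_tail j).aestronglyMeasurable (Eventually.of_forall fun x => ?_) |>.congr
      (Eventually.of_forall fun x => mul_assoc _ _ _)
    rw [Real.norm_of_nonneg (tail_nonneg j x)]
    exact tail_le_one j x
  have h1 := h.gradient.abs_integral_inner_gradient_le hψ hc (fun i x => hA' j i x) iq
  have h2 : ∫ x, |ρ x| * (A * tail d j x) ≤ A * ∫ x, energy ρ g x * tail d j x := by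
    rw [← integral_const_mul]
    refine integral_mono iq (iE.const_mul A) fun x => ?_
    have h3 : |ρ x| ≤ energy ρ g x := by
      unfold energy
      have : 0 ≤ ρ x ^ 2 + ‖g x‖ ^ 2 + nearField d ρ x ^ 2 := by positivity
      linarith
    have h4 := mul_le_mul_of_nonneg_right h3 (mul_nonneg hA0 (tail_nonneg j x))
    simp only
    linarith
  have h5 : |∫ x, ρ x * inner ℝ (field d ρ x + V x) (∇ (cutoff d j) x)| ≤
      (1 + N + B) * A * ∫ x, energy ρ g x * tail d j x := by
    rw [← integral_const_mul, ← Real.norm_eq_abs]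
    refine norm_integral_le_of_norm_le (iE.const_mul _) ?_
    filter_upwards [h.mul_norm_drift_mul_le hV hN hA j] with x hx
    refine le_trans ?_ hx
    rw [norm_mul, mul_assoc, Real.norm_eq_abs]
    exact mul_le_mul_of_nonneg_left (norm_inner_le_norm _ _) (abs_nonneg _)
  have h6 := mul_le_mul_of_nonneg_left h2 (Nat.cast_nonneg (α := ℝ) d)
  rw [e1]
  refine (abs_add_le _ _).trans ?_
  linarith

theorem abs_hinge_sub_le {r y : ℝ} (hy : 0 ≤ y) : |hinge (r - y)| ≤ |r| := by
  rw [abs_of_nonneg (hinge_nonneg _)]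
  refine (hinge_le_max _).trans (max_le ?_ (abs_nonneg r))
  linarith [le_abs_self r]

/-- The production of entropy above the level `L + s` at a fixed time, localized by a cutoff: only
the fluxes through the transition region of the cutoff remain. -/
theorem IsRegularSlice.integral_deriv_hinge_mul_le (hd : d = 2 ∨ d = 3)
    (h : IsRegularSlice ρ g N) (hV : IsDrift V m B) (hN : 0 ≤ N) (hA0 : 0 ≤ A)
    (hA : ∀ j (x : Space d), (1 + ‖x‖) * ‖∇ (cutoff d j) x‖ ≤ A * tail d j x)
    (hL : 1 ≤ L) (hmL : ∀ x, m x ≤ L) (hs : 0 ≤ s) (j : ℕ) :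
    ∫ x, deriv hinge (ρ x - (L + s)) * (cutoff d j x * (source V m ρ g x + s ^ 2) -
      inner ℝ (g x) (∇ (cutoff d j) x)) ≤
      ((1 + N + B) * A + A) * ∫ x, energy ρ g x * tail d j x := by
  have hd2 : 2 ≤ d := by omega
  set y := L + s with hy
  have hy1 : 1 ≤ y := by linarith
  have hψ := contDiff_cutoff (d := d) j
  have hc := hasCompactSupport_cutoff (d := d) j
  have hψi : Integrable (cutoff d j) := hψ.continuous.integrable_of_hasCompactSupport hc
  have iE := integrable_energy_mul_tail h.integrable_energy j
  have hθ' : AEStronglyMeasurable fun x => deriv hinge (ρ x - y) :=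
    (contDiff_hinge.continuous_deriv (by simp)).comp_aestronglyMeasurable
      (h.integrable.1.sub aestronglyMeasurable_const)
  have hθ : AEStronglyMeasurable fun x => hinge (ρ x - y) :=
    contDiff_hinge.continuous.comp_aestronglyMeasurable
      (h.integrable.1.sub aestronglyMeasurable_const)
  have hθb : ∀ᵐ x, ‖deriv hinge (ρ x - y)‖ ≤ 1 :=
    Eventually.of_forall fun x => abs_deriv_hinge_le _
  have i1 := h.integrable_mul_inner_drift hd2 hV hψ.continuous hc
  have i1' := i1.bdd_mul hθ' hθb
  have i2 := h.integrable_mul_divergence hV hψ.continuous hc hθ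
    (Eventually.of_forall fun x => abs_hinge_sub_le (by linarith))
  have i3 := h.gradient.2.1.integrable_inner (contDiff_gradient hψ).continuous
    (hasCompactSupport_gradient hc)
  have i3' := i3.bdd_mul hθ' hθb
  have i4 := h.integrable_mul_source hd2 hV hψ.continuous hc
  have i5 : Integrable fun x => deriv hinge (ρ x - y) *
      (cutoff d j x * (source V m ρ g x + s ^ 2) - inner ℝ (g x) (∇ (cutoff d j) x)) := by
    refine (((i4.add (hψi.mul_const (s ^ 2))).sub i3).congr
      (Eventually.of_forall fun x => ?_)).bdd_mul hθ' hθb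
    simp only [Pi.add_apply, Pi.sub_apply]
    ring
  have i6 : Integrable fun x => cutoff d j x * (deriv hinge (ρ x - y) *
      inner ℝ (g x) (field d ρ x + V x) + hinge (ρ x - y) * (m x - ρ x)) := by
    refine (i1'.add i2).congr (Eventually.of_forall fun x => ?_)
    simp only [Pi.add_apply]
    ring
  have key := integral_comp_mul_inner_gradient (θ := fun z : ℝ => hinge (z - y)) (C := 1)
    (contDiff_hinge.comp (contDiff_id.sub contDiff_const))
    (fun z => by rw [deriv_comp_sub_const]; exact abs_deriv_hinge_le _)
    h.memLp h.memLp_gradient h.gradient (h.memLp_drift hd2 hV) (h.memLp_divergence hV)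
    (h.isWeakDivergence_drift hd hV) hψ hc
  simp only [deriv_comp_sub_const] at key
  -- The reaction term has the right sign, and what is left of the source is the quantity that
  -- the product rule turns into a flux.
  have h1 : ∫ x, deriv hinge (ρ x - y) * (cutoff d j x * (source V m ρ g x + s ^ 2) -
      inner ℝ (g x) (∇ (cutoff d j) x)) ≤
      (∫ x, cutoff d j x * (deriv hinge (ρ x - y) * inner ℝ (g x) (field d ρ x + V x) +
        hinge (ρ x - y) * (m x - ρ x))) -
        ∫ x, deriv hinge (ρ x - y) * inner ℝ (g x) (∇ (cutoff d j) x) := by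
    rw [← integral_sub i6 i3']
    refine integral_mono i5 (i6.sub i3') fun x => ?_
    have h2 := mul_le_mul_of_nonneg_left (deriv_hinge_mul_reaction_le (r := ρ x) (L := L) (s := s)
      (by linarith) hs (hmL x)) (cutoff_nonneg j x)
    simp only [source]
    linarith
  have h2 : |∫ x, hinge (ρ x - y) * inner ℝ (field d ρ x + V x) (∇ (cutoff d j) x)| ≤
      (1 + N + B) * A * ∫ x, energy ρ g x * tail d j x := by
    rw [← integral_const_mul, ← Real.norm_eq_abs]
    refine norm_integral_le_of_norm_le (iE.const_mul _) ?_
    filter_upwards [h.mul_norm_drift_mul_le hV hN hA j] with x hx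
    refine le_trans ?_ hx
    rw [norm_mul, mul_assoc, Real.norm_eq_abs]
    exact mul_le_mul (abs_hinge_sub_le (by linarith)) (norm_inner_le_norm _ _) (norm_nonneg _)
      (abs_nonneg _)
  -- Where the slope of the hinge does not vanish, `1 ≤ ρ` and so `‖g‖ ≤ ρ ‖g‖`.
  have h3 : |∫ x, deriv hinge (ρ x - y) * inner ℝ (g x) (∇ (cutoff d j) x)| ≤
      A * ∫ x, energy ρ g x * tail d j x := by
    rw [← integral_const_mul, ← Real.norm_eq_abs]
    refine norm_integral_le_of_norm_le (iE.const_mul _) (Eventually.of_forall fun x => ?_)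
    have hE := energy_nonneg ρ g x
    have ht := mul_nonneg hA0 (tail_nonneg j x)
    rcases le_or_gt (ρ x) y with hx | hx
    · rw [deriv_hinge, Real.smoothTransition.zero_of_nonpos (by linarith), zero_mul, norm_zero]
      nlinarith [mul_nonneg hE ht]
    · have h4 : ‖g x‖ ≤ energy ρ g x := by
        have h5 : ‖g x‖ ≤ ρ x * ‖g x‖ := le_mul_of_one_le_left (norm_nonneg _) (by linarith)
        unfold energy
        nlinarith [sq_nonneg (ρ x - ‖g x‖), abs_nonneg (ρ x), sq_nonneg (nearField d ρ x),
          sq_nonneg (ρ x), sq_nonneg ‖g x‖]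
      calc ‖deriv hinge (ρ x - y) * inner ℝ (g x) (∇ (cutoff d j) x)‖
          ≤ 1 * (‖g x‖ * ‖∇ (cutoff d j) x‖) := by
            rw [norm_mul]
            exact mul_le_mul (abs_deriv_hinge_le _) (norm_inner_le_norm _ _) (norm_nonneg _)
              zero_le_one
        _ ≤ 1 * (energy ρ g x * (A * tail d j x)) := by
            gcongr
            exact norm_gradient_cutoff_le hA j x
        _ = _ := by ring
  have h4 := neg_le_of_abs_le h2
  have h5 := neg_le_of_abs_le h3
  rw [key] at h4
  linarith

end SliceEstimates

/-! ### Entropy and mass on a time interval -/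

section DriftSolution

variable {d : ℕ}

/-- `n` is a weak solution of `∂ₜ n = Δ n + ∇·(n ∇c) + ∇·(n V)` on the time interval `(a, b]`,
with `∇c` the field generated by `n`, with `g = ∇n` and with mass at most `N`. -/
structure IsDriftSolution (V : Space d → Space d) (a b : ℝ) (n : ℝ → Space d → ℝ)
    (g : ℝ → Space d → Space d) (N : ℝ) : Prop where
  nonneg : ∀ t ∈ Icc a b, 0 ≤ᵐ[volume] n t
  integrable : ∀ t ∈ Icc a b, Integrable (n t)
  integral_le : ∀ t ∈ Icc a b, ∫ x, |n t x| ≤ N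
  integrable_uncurry : Integrable (Function.uncurry n) ((volume.restrict (Ioc a b)).prod volume)
  integrable_sq : Integrable (fun z => Function.uncurry n z ^ 2)
    ((volume.restrict (Ioc a b)).prod volume)
  memLp_gradient : MemLp (Function.uncurry g) 2 ((volume.restrict (Ioc a b)).prod volume)
  gradient : ∀ᵐ τ ∂(volume.restrict (Ioc a b)), IsWeakGradient (n τ) (g τ)
  equation : ∀ ψ : Space d → ℝ, ContDiff ℝ ∞ ψ → HasCompactSupport ψ → ∀ t ∈ Icc a b,
    (∫ x, n t x * ψ x) - ∫ x, n a x * ψ x =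
      -∫ τ in a..t, ∫ x, inner ℝ (g τ x + n τ x • (field d (n τ) x + V x)) (∇ ψ x)

variable {V : Space d → Space d} {m : Space d → ℝ} {a b N B : ℝ} {n : ℝ → Space d → ℝ}
  {g : ℝ → Space d → Space d}

theorem IsDriftSolution.integrable_energy (hd : 2 ≤ d) (h : IsDriftSolution V a b n g N) :
    Integrable (fun z : ℝ × Space d => energy (n z.1) (g z.1) z.2)
      ((volume.restrict (Ioc a b)).prod volume) :=
  ((h.integrable_uncurry.abs.add h.integrable_sq).add h.memLp_gradient.norm.integrable_sq).add
    (integrable_nearField_sq hd h.integrable_uncurry h.integrable_sq)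

theorem IsDriftSolution.norm_field_le (hd : 2 ≤ d) (h : IsDriftSolution V a b n g N) :
    ∀ᵐ z : ℝ × Space d ∂((volume.restrict (Ioc a b)).prod volume),
      ‖field d (n z.1) z.2‖ ≤ nearField d (n z.1) z.2 + kernelConst d * N := by
  filter_upwards [ae_integrable_nearKernel_mul hd h.integrable_uncurry,
    Measure.quasiMeasurePreserving_fst.ae (ae_restrict_mem measurableSet_Ioc)] with z hz hz1
  have hz2 := Ioc_subset_Icc_self hz1
  have h1 := mul_le_mul_of_nonneg_left (h.integral_le _ hz2) (kernelConst_pos d).le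
  have h2 := NernstPlanck.norm_field_le hd (h.integrable _ hz2) hz
  linarith

theorem IsDriftSolution.isRegularSlice (hd : 2 ≤ d) (h : IsDriftSolution V a b n g N) :
    ∀ᵐ τ ∂(volume.restrict (Ioc a b)), IsRegularSlice (n τ) (g τ) (kernelConst d * N) := by
  filter_upwards [ae_restrict_mem measurableSet_Ioc, h.gradient,
    Measure.ae_ae_of_ae_prod (h.norm_field_le hd), h.integrable_sq.prod_right_ae,
    h.memLp_gradient.1.prodMk_left, h.memLp_gradient.norm.integrable_sq.prod_right_ae,
    (integrable_nearField_sq hd h.integrable_uncurry h.integrable_sq).prod_right_ae]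
    with τ h1 h2 h3 h4 h5 h6 h7
  have h1' := Ioc_subset_Icc_self h1
  exact ⟨h.integrable τ h1',
    (memLp_two_iff_integrable_sq (h.integrable τ h1').1).2 h4,
    (memLp_two_iff_integrable_sq_norm h5).2 h6, h2, h7, h3⟩

/-- A solution satisfies, locally in space, the equation in non-divergence form. -/
theorem IsDriftSolution.isLocalSolution (hd : d = 2 ∨ d = 3) (h : IsDriftSolution V a b n g N)
    (hV : IsDrift V m B) (R : ℝ) :
    IsLocalSolution a b R n (fun τ => (Metric.ball 0 R).indicator (g τ))
      fun τ => (Metric.ball 0 R).indicator (source V m (n τ) (g τ)) := by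
  have hd2 : 2 ≤ d := by omega
  set μ : Measure ℝ := volume.restrict (Ioc a b) with hμ
  have hball : MeasurableSet (Metric.ball (0 : Space d) R) := Metric.isOpen_ball.measurableSet
  have hballs : MeasurableSet ((Prod.snd : ℝ × Space d → Space d) ⁻¹' Metric.ball 0 R) :=
    measurable_snd hball
  have i1 : Integrable (fun z : ℝ × Space d =>
      (1 : ℝ) * (Metric.ball (0 : Space d) R).indicator (fun _ => (1 : ℝ)) z.2) (μ.prod volume) :=
    (integrable_const (1 : ℝ)).mul_prod
      ((integrable_indicator_iff hball).2 (integrableOn_const measure_ball_lt_top.ne))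
  have hE := h.integrable_energy hd2
  have hsm : AEStronglyMeasurable
      (fun z : ℝ × Space d => source V m (n z.1) (g z.1) z.2) (μ.prod volume) := by
    refine (h.memLp_gradient.1.inner ((aestronglyMeasurable_field h.integrable_uncurry.1).add
      (hV.continuous.comp continuous_snd).aestronglyMeasurable)).add
      (h.integrable_uncurry.1.mul ((hV.aestronglyMeasurable.comp_quasiMeasurePreserving
        Measure.quasiMeasurePreserving_snd).sub h.integrable_uncurry.1))
  refine ⟨h.integrable, h.integrable_uncurry, ?_, ?_, ?_, ?_⟩
  · refine (hE.add i1).mono' (h.memLp_gradient.1.indicator hballs) (Eventually.of_forall fun z => ?_)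
    have h0 := energy_nonneg (n z.1) (g z.1) z.2
    simp only [Function.uncurry, Pi.add_apply, one_mul]
    by_cases hz : z.2 ∈ Metric.ball (0 : Space d) R
    · rw [indicator_of_mem hz, indicator_of_mem hz]
      unfold energy
      nlinarith [sq_nonneg (‖g z.1 z.2‖ - 1), abs_nonneg (n z.1 z.2), sq_nonneg (n z.1 z.2),
        sq_nonneg (nearField d (n z.1) z.2)]
    · rw [indicator_of_notMem hz, indicator_of_notMem hz, norm_zero]
      linarith
  · set c := kernelConst d * N + B * (1 + R) with hc
    refine ((hE.const_mul (1 + B)).add (i1.const_mul (c ^ 2))).mono' (hsm.indicator hballs) ?_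
    filter_upwards [h.norm_field_le hd2] with z hz
    have hB := hV.nonneg
    have h0 := energy_nonneg (n z.1) (g z.1) z.2
    simp only [Function.uncurry, Pi.add_apply, one_mul]
    by_cases hzR : z.2 ∈ Metric.ball (0 : Space d) R
    · rw [indicator_of_mem hzR, indicator_of_mem hzR]
      have h1 := mul_le_mul_of_nonneg_left (mem_ball_zero_iff.1 hzR).le hB
      have h2 : ‖field d (n z.1) z.2 + V z.2‖ ≤ nearField d (n z.1) z.2 + c := by
        have := (norm_add_le (field d (n z.1) z.2) (V z.2)).trans
          (add_le_add hz (hV.norm_le z.2))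
        linarith
      have h3 : |n z.1 z.2 * (m z.2 - n z.1 z.2)| ≤ B * |n z.1 z.2| + n z.1 z.2 ^ 2 := by
        rw [abs_mul, ← sq_abs (n z.1 z.2)]
        have := (abs_sub (m z.2) (n z.1 z.2)).trans (add_le_add_left (hV.abs_le z.2) _)
        nlinarith [mul_le_mul_of_nonneg_left this (abs_nonneg (n z.1 z.2))]
      have h4 : |inner ℝ (g z.1 z.2) (field d (n z.1) z.2 + V z.2)| ≤
          ‖g z.1 z.2‖ * (nearField d (n z.1) z.2 + c) :=
        (abs_real_inner_le_norm _ _).trans (mul_le_mul_of_nonneg_left h2 (norm_nonneg _))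
      have h5 := abs_add_le (inner ℝ (g z.1 z.2) (field d (n z.1) z.2 + V z.2))
        (n z.1 z.2 * (m z.2 - n z.1 z.2))
      rw [source, Real.norm_eq_abs]
      unfold energy
      have h6 : ‖g z.1 z.2‖ * (nearField d (n z.1) z.2 + c) ≤
          ‖g z.1 z.2‖ ^ 2 + nearField d (n z.1) z.2 ^ 2 + c ^ 2 := by
        nlinarith [sq_nonneg (‖g z.1 z.2‖ - 2 * nearField d (n z.1) z.2),
          sq_nonneg (‖g z.1 z.2‖ - 2 * c), sq_nonneg (nearField d (n z.1) z.2), sq_nonneg c,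
          sq_nonneg (‖g z.1 z.2‖)]
      have h7 : 0 ≤ B * (n z.1 z.2 ^ 2 + ‖g z.1 z.2‖ ^ 2 + nearField d (n z.1) z.2 ^ 2) := by
        positivity
      have h8 := abs_nonneg (n z.1 z.2)
      linarith
    · rw [indicator_of_notMem hzR, indicator_of_notMem hzR, norm_zero]
      have : 0 ≤ (1 + B) * energy (n z.1) (g z.1) z.2 := by positivity
      linarith
  · filter_upwards [h.gradient] with τ hτ η hη hc hs
    rw [hτ.2.2 η hη hc]
    congr 1
    refine integral_congr_ae (Eventually.of_forall fun x => ?_)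
    by_cases hx : x ∈ Metric.ball (0 : Space d) R
    · simp only [indicator_of_mem hx]
    · simp only [image_eq_zero_of_notMem_tsupport fun hx' => hx (hs hx'), zero_smul]
  · intro η hη hc hs t ht
    rw [h.equation η hη hc t ht, ← intervalIntegral.integral_neg]
    refine intervalIntegral.integral_congr_ae ?_
    filter_upwards [(ae_restrict_iff' measurableSet_Ioc).1 (h.isRegularSlice hd2)] with τ hτ hmem
    rw [uIoc_of_le ht.1] at hmem
    rw [(hτ (Ioc_subset_Ioc_right ht.2 hmem)).integral_inner_flux hd hV hη hc]
    refine integral_congr_ae (Eventually.of_forall fun x => ?_)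
    by_cases hx : x ∈ Metric.ball (0 : Space d) R
    · simp only [indicator_of_mem hx]
    · simp only [indicator_of_notMem hx,
        image_eq_zero_of_notMem_tsupport fun hx' => hx (hs hx'),
        gradient_eq_zero_of_notMem_tsupport fun hx' => hx (hs hx'), inner_zero_right, mul_zero]

theorem integral_le_integral_of_ae_le {α : Type*} [MeasurableSpace α] {μ : Measure α}
    {f f' : α → ℝ} (h0 : ∀ x, 0 ≤ f' x) (hi : Integrable f' μ) (hle : ∀ᵐ x ∂μ, f x ≤ f' x) :
    ∫ x, f x ∂μ ≤ ∫ x, f' x ∂μ := by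
  by_cases hf : Integrable f μ
  · exact integral_mono_ae hf hi hle
  · rw [integral_undef hf]
    exact integral_nonneg h0

theorem tendsto_integral_cutoff_mul {f : Space d → ℝ} (hf : Integrable f) :
    Tendsto (fun j => ∫ x, cutoff d j x * f x) atTop (𝓝 (∫ x, f x)) := by
  refine tendsto_integral_of_dominated_convergence (fun x => ‖f x‖)
    (fun j => (contDiff_cutoff j).continuous.aestronglyMeasurable.mul hf.1) hf.norm
    (fun j => Eventually.of_forall fun x => ?_) (Eventually.of_forall fun x => ?_)
  · rw [norm_mul, Real.norm_of_nonneg (cutoff_nonneg j x)]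
    exact mul_le_of_le_one_left (norm_nonneg _) (cutoff_le_one j x)
  · simpa using (tendsto_cutoff x).mul_const (f x)

theorem IsDriftSolution.integrable_energy_mul_tail (hd : 2 ≤ d) (h : IsDriftSolution V a b n g N)
    (j : ℕ) : Integrable (fun z : ℝ × Space d => energy (n z.1) (g z.1) z.2 * tail d j z.2)
      ((volume.restrict (Ioc a b)).prod volume) := by
  refine (h.integrable_energy hd).mul_bdd (c := 1)
    ((measurable_tail j).comp measurable_snd).aestronglyMeasurable (Eventually.of_forall fun z => ?_)
  rw [Real.norm_of_nonneg (tail_nonneg j z.2)]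
  exact tail_le_one j z.2

theorem integrable_hinge_sub {f : Space d → ℝ} (hf : Integrable f) {y : ℝ} (hy : 0 ≤ y) :
    Integrable fun x => hinge (f x - y) :=
  hf.mono (contDiff_hinge.continuous.comp_aestronglyMeasurable
    (hf.1.sub aestronglyMeasurable_const)) (Eventually.of_forall fun _ => abs_hinge_sub_le hy)

theorem IsDriftSolution.nonneg_mass (h : IsDriftSolution V a b n g N) (hab : a ≤ b) : 0 ≤ N :=
  (integral_nonneg fun _ => abs_nonneg _).trans (h.integral_le a ⟨le_rfl, hab⟩)

/-- Above the supersolution `L + 1 / t` the solution carries a nonincreasing entropy. -/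
theorem IsDriftSolution.integral_hinge_le (hd : d = 2 ∨ d = 3) (h : IsDriftSolution V a b n g N)
    (hV : IsDrift V m B) (ha : 0 < a) (hab : a ≤ b) {L : ℝ} (hL : 1 ≤ L) (hmL : ∀ x, m x ≤ L) :
    ∫ x, hinge (n b x - (L + b⁻¹)) ≤ ∫ x, hinge (n a x - (L + a⁻¹)) := by
  have hd2 : 2 ≤ d := by omega
  obtain ⟨A, hA0, hA, -⟩ := exists_cutoff_bound d
  have hN : 0 ≤ kernelConst d * N := mul_nonneg (kernelConst_pos d).le (h.nonneg_mass hab)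
  have hB := hV.nonneg
  set K := (1 + kernelConst d * N + B) * A + A with hK
  have hK0 : 0 ≤ K := by positivity
  have hy : ∀ t ∈ Icc a b, HasDerivAt (fun t : ℝ => L + t⁻¹) (-(t⁻¹) ^ 2) t := fun t ht => by
    have := (hasDerivAt_inv (ha.trans_le ht.1).ne').const_add L
    rwa [← inv_pow] at this
  have hy' : ContinuousOn (fun t : ℝ => -(t⁻¹) ^ 2) (Icc a b) :=
    ((continuousOn_id.inv₀ fun t ht => (ha.trans_le ht.1).ne').pow 2).neg
  have hinv : ∀ {t : ℝ}, a ≤ t → 0 ≤ L + t⁻¹ := fun {t} ht => by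
    have := inv_pos.2 (ha.trans_le ht)
    linarith
  have key : ∀ j : ℕ, (∫ x, cutoff d j x * hinge (n b x - (L + b⁻¹))) -
      ∫ x, cutoff d j x * hinge (n a x - (L + a⁻¹)) ≤
      K * ∫ z : ℝ × Space d, energy (n z.1) (g z.1) z.2 * tail d j z.2
        ∂((volume.restrict (Ioc a b)).prod volume) := by
    intro j
    have iE := h.integrable_energy_mul_tail hd2 j
    refine ((h.isLocalSolution hd hV (2 * ((j : ℝ) + 1) + 1)).integral_comp_sub_le hab hy hy'
      contDiff_hinge abs_deriv_hinge_le monotone_deriv_hinge (contDiff_cutoff j)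
      (hasCompactSupport_cutoff j) (cutoff_nonneg j) (lt_add_one _)
      fun x hx => norm_le_of_mem_tsupport_cutoff hx).trans ?_
    rw [integral_prod _ iE, ← integral_const_mul]
    refine integral_le_integral_of_ae_le (fun τ => mul_nonneg hK0 (integral_nonneg fun x =>
      mul_nonneg (energy_nonneg _ _ _) (tail_nonneg j x))) (iE.integral_prod_left.const_mul K) ?_
    filter_upwards [h.isRegularSlice hd2, ae_restrict_mem measurableSet_Ioc] with τ hτ hmem
    refine le_trans (le_of_eq ?_) (hτ.integral_deriv_hinge_mul_le hd hV hN hA0 hA hL hmL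
      (inv_nonneg.2 (ha.trans hmem.1).le) j)
    refine integral_congr_ae (Eventually.of_forall fun x => ?_)
    by_cases hx : x ∈ tsupport (cutoff d j)
    · have hx' : x ∈ Metric.ball (0 : Space d) (2 * ((j : ℝ) + 1) + 1) :=
        mem_ball_zero_iff.2 ((norm_le_of_mem_tsupport_cutoff hx).trans_lt (lt_add_one _))
      simp only [indicator_of_mem hx', sub_neg_eq_add]
    · simp only [image_eq_zero_of_notMem_tsupport hx, gradient_eq_zero_of_notMem_tsupport hx,
        inner_zero_right, zero_mul]
  have l1 := tendsto_integral_cutoff_mul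
    (integrable_hinge_sub (h.integrable b ⟨hab, le_rfl⟩) (hinv hab))
  have l2 := tendsto_integral_cutoff_mul
    (integrable_hinge_sub (h.integrable a ⟨le_rfl, hab⟩) (hinv le_rfl))
  have l3 := (tendsto_integral_mul_tail (h.integrable_energy hd2)).const_mul K
  rw [mul_zero] at l3
  exact sub_nonpos.1 (le_of_tendsto_of_tendsto' (l1.sub l2) l3 key)

/-- The mass does not increase. -/
theorem IsDriftSolution.integral_le_integral (hd : d = 2 ∨ d = 3)
    (h : IsDriftSolution V a b n g N) (hV : IsDrift V m B) (hab : a ≤ b) :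
    ∫ x, n b x ≤ ∫ x, n a x := by
  have hd2 : 2 ≤ d := by omega
  obtain ⟨A, hA0, hA, hA'⟩ := exists_cutoff_bound d
  have hN : 0 ≤ kernelConst d * N := mul_nonneg (kernelConst_pos d).le (h.nonneg_mass hab)
  have hB := hV.nonneg
  set K := d * A + (1 + kernelConst d * N + B) * A with hK
  have key : ∀ j : ℕ, (∫ x, cutoff d j x * n b x) - ∫ x, cutoff d j x * n a x ≤
      K * ∫ z : ℝ × Space d, energy (n z.1) (g z.1) z.2 * tail d j z.2
        ∂((volume.restrict (Ioc a b)).prod volume) := by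
    intro j
    have iE := h.integrable_energy_mul_tail hd2 j
    simp_rw [mul_comm (cutoff d j _)]
    rw [h.equation _ (contDiff_cutoff j) (hasCompactSupport_cutoff j) b ⟨hab, le_rfl⟩,
      intervalIntegral.integral_of_le hab, integral_prod _ iE, ← integral_const_mul]
    refine (neg_le_abs _).trans ?_
    rw [← Real.norm_eq_abs]
    refine norm_integral_le_of_norm_le (iE.integral_prod_left.const_mul K) ?_
    filter_upwards [h.isRegularSlice hd2] with τ hτ
    exact hτ.abs_integral_flux_cutoff_le hd2 hV hN hA0 hA hA' j
  have l1 := tendsto_integral_cutoff_mul (h.integrable b ⟨hab, le_rfl⟩)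
  have l2 := tendsto_integral_cutoff_mul (h.integrable a ⟨le_rfl, hab⟩)
  have l3 := (tendsto_integral_mul_tail (h.integrable_energy hd2)).const_mul K
  rw [mul_zero] at l3
  exact sub_nonpos.1 (le_of_tendsto_of_tendsto' (l1.sub l2) l3 key)

end DriftSolution

/-! ### Uniform bounds -/

section Bounds

variable {d : ℕ} {M : ℝ} {φ n₀ : Space d → ℝ} {n : ℝ → Space d → ℝ}

theorem IsSolution.continuousOn_mass (hn : IsSolution d M φ n₀ n) :
    ContinuousOn (fun t => ∫ x, n t x) (Ici 0) := fun t ht =>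
  tendsto_integral_of_L1' (n t) (hn.integrable t ht).1
    (eventually_mem_nhdsWithin.mono fun s hs => hn.integrable s hs) (hn.continuous_L1 t ht)

/-- Away from the initial time, and with the weak gradient of the potential identified, a solution
is a solution with drift `∇φ`. -/
theorem IsSolution.exists_isDriftSolution (hd : d = 2 ∨ d = 3) (hn : IsSolution d M φ n₀ n)
    {a b : ℝ} (ha : 0 < a) (hab : a < b) : ∃ g N, IsDriftSolution (∇ φ) a b n g N := by
  obtain ⟨g, h, hg, hh, hreg, heq⟩ := hn.equation
  obtain ⟨h1, h2, -⟩ := hreg a b ha hab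
  have hpos : ∀ t ∈ Icc a b, 0 ≤ t := fun t ht => ha.le.trans ht.1
  obtain ⟨N, hN⟩ := isCompact_Icc.bddAbove_image
    (hn.continuousOn_mass.mono fun t ht => mem_Ici.2 (hpos t ht) : ContinuousOn _ (Icc a b))
  have hN' : ∀ t ∈ Icc a b, ∫ x, |n t x| ≤ N := fun t ht => by
    refine (le_of_eq (integral_congr_ae ?_)).trans (hN (mem_image_of_mem _ ht))
    filter_upwards [hn.nonneg t (hpos t ht)] with x hx
    exact abs_of_nonneg hx
  have hsub : Ioc a b ⊆ Ioi 0 := fun t ht => ha.trans ht.1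
  refine ⟨g, N, fun t ht => hn.nonneg t (hpos t ht), fun t ht => hn.integrable t (hpos t ht), hN',
    ?_, h1.integrable_sq, h2, ae_restrict_of_ae_restrict_of_subset hsub hg,
    fun ψ hψ hc t ht => ?_⟩
  · refine (integrable_prod_iff h1.1).2 ⟨?_, ?_⟩
    · filter_upwards [ae_restrict_mem measurableSet_Ioc] with τ hτ
      exact hn.integrable τ (hpos τ (Ioc_subset_Icc_self hτ))
    · refine (integrable_const N).mono' h1.1.norm.integral_prod_right' ?_
      filter_upwards [ae_restrict_mem measurableSet_Ioc] with τ hτ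
      rw [Real.norm_of_nonneg (integral_nonneg fun _ => norm_nonneg _)]
      exact hN' τ (Ioc_subset_Icc_self hτ)
  · rcases ht.1.eq_or_lt with rfl | hat
    · simp
    rw [heq ψ hψ hc a t ha hat, neg_inj]
    refine intervalIntegral.integral_congr_ae ?_
    filter_upwards [(ae_restrict_iff' measurableSet_Ioi).1 hh,
      (ae_restrict_iff' measurableSet_Ioi).1 hn.potential_converges] with τ h3 h4 hmem
    rw [uIoc_of_le hat.le] at hmem
    have hτ : 0 < τ := ha.trans hmem.1
    refine integral_congr_ae ?_
    filter_upwards [(h3 hτ).ae_eq_field hd (hn.integrable τ hτ.le) (h4 hτ)] with x hx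
    rw [hx, smul_add, add_assoc]

theorem tendsto_div_add_two {t : ℝ} (ht : 0 < t) :
    Tendsto (fun k : ℕ => t / ((k : ℝ) + 2)) atTop (𝓝[Ici 0] 0) :=
  tendsto_nhdsWithin_iff.2 ⟨tendsto_const_nhds.div_atTop
    (tendsto_atTop_add_const_right _ _ tendsto_natCast_atTop_atTop),
    Eventually.of_forall fun k => by rw [mem_Ici]; positivity⟩

/-- The mass stays below its initial value, by `L¹` continuity at the initial time. -/
theorem IsSolution.integral_le (hd : d = 2 ∨ d = 3) (hn : IsSolution d M φ n₀ n)
    {m : Space d → ℝ} {B : ℝ} (hV : IsDrift (∇ φ) m B) {t : ℝ} (ht : 0 < t) :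
    ∫ x, n t x ≤ M := by
  have h0 : ∫ x, n 0 x = M := by rw [integral_congr_ae hn.initial, hn.initial_mass]
  rw [← h0]
  refine ge_of_tendsto (Tendsto.comp (f := fun k : ℕ => t / ((k : ℝ) + 2))
    (hn.continuousOn_mass 0 self_mem_Ici) (tendsto_div_add_two ht)) ?_
  refine Eventually.of_forall fun k => ?_
  have hk : t / ((k : ℝ) + 2) < t := div_lt_self ht (by linarith [Nat.cast_nonneg (α := ℝ) k])
  obtain ⟨g, N, h⟩ := hn.exists_isDriftSolution hd (a := t / ((k : ℝ) + 2)) (by positivity) hk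
  exact h.integral_le_integral hd hV hk.le

/-- The pointwise bound, which does not depend on the initial datum: as `a → 0` the level `L + 1 / a`
tends to infinity, and the entropy above it tends to zero by `L¹` continuity. -/
theorem IsSolution.le_add_inv (hd : d = 2 ∨ d = 3) (hn : IsSolution d M φ n₀ n)
    {m : Space d → ℝ} {B : ℝ} (hV : IsDrift (∇ φ) m B) {L : ℝ} (hL : 1 ≤ L) (hmL : ∀ x, m x ≤ L)
    {t : ℝ} (ht : 0 < t) : ∀ᵐ x, n t x ≤ L + t⁻¹ := by
  set a : ℕ → ℝ := fun k => t / ((k : ℝ) + 2) with ha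
  have ha0 : ∀ k, 0 < a k := fun k => by simp only [ha]; positivity
  have hat : ∀ k, a k < t := fun k =>
    div_lt_self ht (by linarith [Nat.cast_nonneg (α := ℝ) k])
  have hlim : Tendsto a atTop (𝓝[Ici 0] 0) := tendsto_div_add_two ht
  have hy0 : ∀ k, 0 ≤ L + (a k)⁻¹ := fun k => by
    have := inv_pos.2 (ha0 k)
    linarith
  have i0 := hn.integrable 0 le_rfl
  have i1 : ∀ k, Integrable fun x => |n (a k) x - n 0 x| := fun k =>
    ((hn.integrable _ (ha0 k).le).sub i0).abs
  have i2 : ∀ k, Integrable fun x => max (n 0 x - (L + (a k)⁻¹)) 0 := fun k => by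
    refine i0.mono ((i0.1.sub aestronglyMeasurable_const).sup aestronglyMeasurable_const)
      (Eventually.of_forall fun x => ?_)
    rw [Real.norm_of_nonneg (le_max_right _ _)]
    exact max_le (by linarith [le_abs_self (n 0 x), hy0 k, Real.norm_eq_abs (n 0 x)])
      (norm_nonneg _)
  -- The entropy at time `t` is at most the entropy at the earlier time `a k`.
  have key : ∀ k, ∫ x, hinge (n t x - (L + t⁻¹)) ≤
      (∫ x, |n (a k) x - n 0 x|) + ∫ x, max (n 0 x - (L + (a k)⁻¹)) 0 := by
    intro k
    obtain ⟨g, N, h⟩ := hn.exists_isDriftSolution hd (ha0 k) (hat k)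
    refine (h.integral_hinge_le hd hV (ha0 k) (hat k).le hL hmL).trans ?_
    rw [← integral_add (i1 k) (i2 k)]
    refine integral_mono (integrable_hinge_sub (hn.integrable _ (ha0 k).le) (hy0 k))
      ((i1 k).add (i2 k)) fun x => (hinge_le_max _).trans (max_le ?_ ?_)
    · have := le_abs_self (n (a k) x - n 0 x)
      have := le_max_left (n 0 x - (L + (a k)⁻¹)) 0
      linarith
    · exact add_nonneg (abs_nonneg _) (le_max_right _ _)
  have l1 : Tendsto (fun k => ∫ x, |n (a k) x - n 0 x|) atTop (𝓝 0) := by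
    have h := (hn.continuous_L1 0 le_rfl).comp hlim
    have h' := (ENNReal.tendsto_toReal ENNReal.zero_ne_top).comp h
    rw [ENNReal.toReal_zero] at h'
    refine h'.congr fun k => ?_
    simp only [Function.comp_apply]
    have := integral_norm_eq_lintegral_enorm ((hn.integrable _ (ha0 k).le).sub i0).1
    rw [eLpNorm_one_eq_lintegral_enorm, ← this]
    rfl
  have l2 : Tendsto (fun k => ∫ x, max (n 0 x - (L + (a k)⁻¹)) 0) atTop (𝓝 0) := by
    have e : (0 : ℝ) = ∫ _ : Space d, 0 := by simp
    refine Eq.subst (motive := fun c => Tendsto _ atTop (𝓝 c)) e.symm ?_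
    refine tendsto_integral_of_dominated_convergence (fun x => ‖n 0 x‖) (fun k => (i2 k).1)
      i0.norm (fun k => Eventually.of_forall fun x => ?_) (Eventually.of_forall fun x => ?_)
    · rw [Real.norm_of_nonneg (le_max_right _ _)]
      exact max_le (by linarith [le_abs_self (n 0 x), hy0 k, Real.norm_eq_abs (n 0 x)])
        (norm_nonneg _)
    · have h1 : Tendsto (fun k => (a k)⁻¹) atTop atTop :=
        tendsto_inv_nhdsGT_zero.comp (tendsto_nhdsWithin_iff.2
          ⟨hlim.mono_right nhdsWithin_le_nhds, Eventually.of_forall ha0⟩)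
      refine tendsto_const_nhds.congr' ((h1.eventually_ge_atTop (n 0 x)).mono fun k hk => ?_)
      exact (max_eq_right (by linarith)).symm
  have hle : ∫ x, hinge (n t x - (L + t⁻¹)) ≤ 0 := by
    have := ge_of_tendsto' (l1.add l2) key
    rwa [add_zero] at this
  have hy : 0 ≤ L + t⁻¹ := by
    have := inv_pos.2 ht
    linarith
  have h0 := (integral_eq_zero_iff_of_nonneg (fun x => hinge_nonneg _)
    (integrable_hinge_sub (hn.integrable t ht.le) hy)).1
    (le_antisymm hle (integral_nonneg fun x => hinge_nonneg _))
  filter_upwards [h0] with x hx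
  by_contra! hcon
  exact (hinge_pos (sub_pos.2 hcon)).ne' hx

/-- Interpolation between `L¹` and `L^∞`, with the same bound `C` for both norms. -/
theorem eLpNorm_le_of_le {f : Space d → ℝ} {C : ℝ} (hf : Integrable f)
    (h0 : 0 ≤ᵐ[volume] f) (hfC : ∀ᵐ x, f x ≤ C) (hint : ∫ x, f x ≤ C) {p : ℝ≥0∞} (hp : 1 < p) :
    eLpNorm f p volume ≤ ENNReal.ofReal C := by
  have hle : ∀ᵐ x, ‖f x‖ₑ ≤ ENNReal.ofReal C := by
    filter_upwards [h0, hfC] with x h1 h2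
    rw [Real.enorm_of_nonneg h1]
    exact ENNReal.ofReal_le_ofReal h2
  have h1 : ∫⁻ x, ‖f x‖ₑ ≤ ENNReal.ofReal C := by
    rw [← ofReal_integral_norm_eq_lintegral_enorm hf]
    refine ENNReal.ofReal_le_ofReal ((le_of_eq (integral_congr_ae ?_)).trans hint)
    filter_upwards [h0] with x hx
    exact Real.norm_of_nonneg hx
  rcases eq_or_ne p ⊤ with rfl | hp'
  · rw [eLpNorm_exponent_top]
    exact essSup_le_of_ae_le _ hle
  · have hp0 : p ≠ 0 := (zero_lt_one.trans hp).ne'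
    have hq : 1 < p.toReal := by
      rw [← ENNReal.toReal_one]
      exact (ENNReal.toReal_lt_toReal ENNReal.one_ne_top hp').2 hp
    rw [eLpNorm_eq_lintegral_rpow_enorm_toReal hp0 hp', one_div,
      ENNReal.rpow_inv_le_iff (by linarith)]
    have e : ∀ c : ℝ≥0∞, c ^ p.toReal = c ^ (p.toReal - 1) * c := fun c => by
      conv_rhs => rw [← ENNReal.rpow_one c, ← ENNReal.rpow_mul, one_mul]
      rw [← ENNReal.rpow_add_of_nonneg _ _ (by linarith) zero_le_one, sub_add_cancel]
    calc ∫⁻ x, ‖f x‖ₑ ^ p.toReal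
        ≤ ∫⁻ x, ENNReal.ofReal C ^ (p.toReal - 1) * ‖f x‖ₑ := by
          refine lintegral_mono_ae ?_
          filter_upwards [hle] with x hx
          rw [e]
          gcongr
      _ = ENNReal.ofReal C ^ (p.toReal - 1) * ∫⁻ x, ‖f x‖ₑ :=
          lintegral_const_mul' _ _ (ENNReal.rpow_ne_top_of_nonneg (by linarith)
            ENNReal.ofReal_ne_top)
      _ ≤ ENNReal.ofReal C ^ (p.toReal - 1) * ENNReal.ofReal C := by gcongr
      _ = _ := (e _).symm

end Bounds

end NernstPlanck

end

theorem mainTheorem9 (d : ℕ) (hd : d = 2 ∨ d = 3) (M : ℝ) (hM : 0 < M)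
    (φ : EuclideanSpace ℝ (Fin d) → ℝ) (hφ : NernstPlanck.ConfinementC d M φ)
    (n₀ : EuclideanSpace ℝ (Fin d) → ℝ) (n : ℝ → EuclideanSpace ℝ (Fin d) → ℝ)
    (hn : NernstPlanck.IsSolution d M φ n₀ n) :
    ∃ C T : ℝ, 0 < C ∧ 0 < T ∧ ∀ t : ℝ, T ≤ t → ∀ p : ℝ≥0∞, 1 < p →
      eLpNorm (n t) p volume ≤ ENNReal.ofReal C := by
  obtain ⟨K, hK⟩ := hφ.lipschitz_gradient
  obtain ⟨m, B, hV⟩ := NernstPlanck.exists_isDrift hK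
  have hmL : ∀ x, m x ≤ max B 1 := fun x =>
    ((le_abs_self _).trans (hV.abs_le x)).trans (le_max_left _ _)
  refine ⟨max (max B 1 + 1) M, 1, lt_max_of_lt_right hM, one_pos, fun t ht p hp => ?_⟩
  have ht0 : 0 < t := one_pos.trans_le ht
  refine NernstPlanck.eLpNorm_le_of_le (hn.integrable t ht0.le)
    (hn.nonneg t ht0.le) ?_ ((hn.integral_le hd hV ht0).trans (le_max_right _ _)) hp
  filter_upwards [hn.le_add_inv hd hV (le_max_right B 1) hmL ht0] with x hx
  refine hx.trans (le_trans ?_ (le_max_left _ _))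
  have := inv_le_one_of_one_le₀ ht
  linarith
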